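/- For $d \ge 2$ let $\rho$ be the uniform distribution on the unit sphere $\mathbb{S}^{d-1} \subset \mathbb{R}^d$. For $p \in (0,1)$ let $\tau(p) = \tau_d(p)$ be the threshold with $\Pr_{x,y\sim\rho}[\langle x,y\rangle \ge \tau(p)] = p$ for independent $x, y$. The random geometric graph $\mathsf{Geo}_d(n,p)$ has vertex set $[n]$: sample $v_1,\dots,v_n \sim \rho$ independently and join $i \ne j$ if and only if $\langle v_i, v_j\rangle \ge \tau(p)$. Let $\mathsf{G}(n,p)$ be the Erdős–Rényi random graph on $[n]$ with edge probability $p$. For a graph $G$ on $[n]$ with edge indicators $G_{ij}\in\{0,1\}$ let $$T(G) = \sum_{1 \le i<j<k \le n} (G_{ij}-p)(G_{jk}-p)(G_{ik}-p)$$ be the signed triangle count, and let $H(p) = p\log\frac1p + (1-p)\log\frac1{1-p}$ be the binary entropy (natural logarithm). All asymptotics are as $n \to \infty$, and $f \ll g$ means $f(n)/g(n) \to 0$. Let $\delta > 0$ be a fixed constant, and let $p = p(n) \in [0,1]$ and integers $d = d(n) \ge 2$ satisfy $\frac{1}{n^2} \ll p \le 1-\delta$ and $d \ll (nH(p))^3$.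 Then $$\left|\mathbb{E}_{\mathsf{Geo}_d(n,p)} T(G) - \mathbb{E}_{\mathsf{G}(n,p)} T(G)\right| \gg \max\left(\sqrt{\mathrm{Var}_{\mathsf{Geo}_d(n,p)} T(G)},\ \sqrt{\mathrm{Var}_{\mathsf{G}(n,p)} T(G)}\right).$$ Moreover, the signed triangle count distinguishes the two models: there are sets $A_n \subseteq \mathbb{R}$ with $\Pr_{G \sim \mathsf{Geo}_d(n,p)}[T(G) \in A_n] \to 1$ and $\Pr_{G \sim \mathsf{G}(n,p)}[T(G)\in A_n] \to 0$. -/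

import Mathlib

open MeasureTheory ProbabilityTheory Filter Asymptotics
open scoped Topology

namespace RandomGeometric

/-- The unit sphere of `ℝ^d` with its Euclidean norm. -/
abbrev Sphere (d : ℕ) : Type :=
  Metric.sphere (0 : EuclideanSpace ℝ (Fin d)) 1

/-- The uniform distribution on the unit sphere of `ℝ^d`: normalized surface measure. -/
noncomputable def uniformSphere (d : ℕ) : Measure (Sphere d) :=
  ((volume : Measure (EuclideanSpace ℝ (Fin d))).toSphere Set.univ)⁻¹ •
    (volume : Measure (EuclideanSpace ℝ (Fin d))).toSphere

/-- The probability that two independent uniform points of the sphere have inner product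
at least `t`. -/
noncomputable def capProb (d : ℕ) (t : ℝ) : ℝ :=
  ((uniformSphere d).prod (uniformSphere d)).real
    {x | t ≤ inner ℝ (x.1 : EuclideanSpace ℝ (Fin d)) (x.2 : EuclideanSpace ℝ (Fin d))}

/-- The threshold `τ(p)`. If `2 ≤ d`, then `capProb d` decreases continuously and strictly on
`[-1, 1]` from `1` to `0`, so this is the unique `t ∈ [-1, 1]` with `capProb d t = p`. -/
noncomputable def threshold (d : ℕ) (p : ℝ) : ℝ :=
  sSup {t | t ∈ Set.Icc (-1 : ℝ) 1 ∧ p ≤ capProb d t}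

/-- The geometric graph of the points `v`: distinct `i` and `j` are adjacent if and only if
`τ ≤ ⟨v i, v j⟩`. -/
def geometricGraph {n d : ℕ} (τ : ℝ) (v : Fin n → Sphere d) : SimpleGraph (Fin n) where
  Adj i j := i ≠ j ∧
    τ ≤ inner ℝ (v i : EuclideanSpace ℝ (Fin d)) (v j : EuclideanSpace ℝ (Fin d))
  symm := ⟨fun _ _ h => ⟨h.1.symm, by rw [real_inner_comm]; exact h.2⟩⟩
  loopless := ⟨fun _ h => h.1 rfl⟩

/-- The law `Geo_d(n, p)` of the random geometric graph on `n` independent uniform points of the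
sphere, as a measure on graphs with vertex set `Fin n`. -/
noncomputable def geo (d n : ℕ) (p : ℝ) : Measure (SimpleGraph (Fin n)) :=
  (Measure.pi fun _ : Fin n => uniformSphere d).map (geometricGraph (threshold d p))

/-- The edge indicator `G_{ij}`. -/
noncomputable def edgeInd {n : ℕ} (G : SimpleGraph (Fin n)) (i j : Fin n) : ℝ :=
  open Classical in if G.Adj i j then 1 else 0

/-- The signed triangle count
`T(G) = ∑_{i < j < k} (G_{ij} - p) (G_{jk} - p) (G_{ik} - p)`. -/
noncomputable def signedTriangles {n : ℕ} (p : ℝ) (G : SimpleGraph (Fin n)) : ℝ :=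
  ∑ i : Fin n, ∑ j ∈ Finset.Ioi i, ∑ k ∈ Finset.Ioi j,
    (edgeInd G i j - p) * (edgeInd G j k - p) * (edgeInd G i k - p)

theorem measurable_geometricGraph {n d : ℕ} (τ : ℝ) :
    Measurable (geometricGraph τ : (Fin n → Sphere d) → SimpleGraph (Fin n)) := by
  rw [SimpleGraph.measurable_iff_adj]
  intro i j
  have h : Measurable fun v : Fin n → Sphere d =>
      inner ℝ (v i : EuclideanSpace ℝ (Fin d)) (v j : EuclideanSpace ℝ (Fin d)) := by
    fun_prop
  exact Measurable.and measurable_const (measurableSet_le measurable_const h).mem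

theorem isProbabilityMeasure_uniformSphere {d : ℕ} (hd : 1 ≤ d) :
    IsProbabilityMeasure (uniformSphere d) := by
  have hn : Nontrivial (EuclideanSpace ℝ (Fin d)) := by
    have : Nonempty (Fin d) := ⟨⟨0, hd⟩⟩
    infer_instance
  have h0 : (volume : Measure (EuclideanSpace ℝ (Fin d))).toSphere ≠ 0 :=
    Measure.toSphere_ne_zero _
  refine ⟨?_⟩
  rw [uniformSphere, Measure.smul_apply, smul_eq_mul]
  exact ENNReal.inv_mul_cancel (Measure.measure_univ_ne_zero.2 h0) (measure_ne_top _ _)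

theorem isProbabilityMeasure_geo {d : ℕ} (hd : 1 ≤ d) (n : ℕ) (p : ℝ) :
    IsProbabilityMeasure (geo d n p) := by
  have := isProbabilityMeasure_uniformSphere hd
  exact Measure.isProbabilityMeasure_map (measurable_geometricGraph _).aemeasurable

end RandomGeometric

/-! ### Sums over triples of vertices and their variance -/

namespace RandomGeometric

/-! Under the binomial graph the mean of `T` is zero and distinct triangles are uncorrelated, so its
variance is at most `n.choose 3 * (p(1-p))^3`. Under the geometric graph put `d = k + 2`, `κ(s) =
1{τ ≤ s} - p`, and let `h(s)` be the covariance of two cap indicators whose centres have inner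
product `s` (`overlap`). Integrating out one vertex of a triangle replaces its two edges by `h`, so
the mean of `T` is `n.choose 3 * Δ` with `Δ = E[κ h]` (`triangleMean`). Triples with at most one
common vertex are uncorrelated; those with two common vertices contribute at most `E[(κ h)^2]`,
those with three at most `(1-2p)^3 Δ + (p(1-p))^3` (`variance_signedTriangles_geo_le`).

Everything then rests on `h`. A Gaussian computation (`uniformSphere_real_two_caps`) shows that two
caps at height `t ≥ 0` whose centres make an angle `2ψ` meet in measure `π⁻¹ ∫_ψ^{π/2} (1 - t²/cos²
x)_+^{k/2} dx`; negative `τ` is reduced to `|τ|` by passing to complementary caps. Hence `h` is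
increasing with mean zero. Monotonicity bounds `Δ` from below by increments of `h`
(`integral_centredStep_mul_ge`) and gives `E[(κ h)^2] ≤ (2/δ) p Δ + p² W` with `W = E[h²]`
(`wedgeMoment_le`).

With `L = 1 - log p`, `triangleMean_bounds` shows, up to constants depending on `δ`: if `τ² ≤ 8/9`,
then `Δ` is at least `p³L³/d`, `Δ²` is at least `p⁶L³/d` and `W` is at most `p²L/d`; if `τ² ≥ 8/9`,
then `Δ²` is at least `p⁵` and `W` is at most `2p³`. Since `H(p) ≤ pL`, the hypothesis makes
`(npL)³/d` arbitrarily large, and elementary algebra shows that each term of the variance is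
negligible against the squared mean (`exists_varianceBound_le`). Chebyshev's inequality at half the
geometric mean separates the models. -/

/-- The product of a weight over the edges of the complete graph on `S`. -/
noncomputable def cliqueWeight {V : Type*} [DecidableEq V] (w : Sym2 V → ℝ) (S : Finset V) : ℝ :=
  ∏ e ∈ S.sym2 with ¬ e.IsDiag, w e

theorem cliqueWeight_triple {V : Type*} [DecidableEq V] (w : Sym2 V → ℝ) {a b c : V}
    (hab : a ≠ b) (hbc : b ≠ c) (hac : a ≠ c) :
    cliqueWeight w {a, b, c} = w s(a, b) * w s(b, c) * w s(a, c) := by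
  have h : (({a, b, c} : Finset V).sym2.filter fun e => ¬ e.IsDiag)
      = {s(a, b), s(b, c), s(a, c)} := by
    ext e
    induction e with
    | _ x y =>
      simp only [Finset.mem_filter, Finset.mk_mem_sym2_iff, Finset.mem_insert,
        Finset.mem_singleton, Sym2.mk_isDiag_iff, Sym2.eq_iff]
      constructor
      · rintro ⟨⟨rfl | rfl | rfl, rfl | rfl | rfl⟩, h⟩ <;> simp_all
      · rintro ((⟨rfl, rfl⟩ | ⟨rfl, rfl⟩) | (⟨rfl, rfl⟩ | ⟨rfl, rfl⟩) | (⟨rfl, rfl⟩ | ⟨rfl, rfl⟩))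
          <;> simp_all [eq_comm]
  rw [cliqueWeight, h, Finset.prod_insert, Finset.prod_insert, Finset.prod_singleton, mul_assoc]
  · simp only [Finset.mem_singleton, Sym2.eq_iff]
    tauto
  · simp only [Finset.mem_insert, Finset.mem_singleton, Sym2.eq_iff]
    tauto

theorem cliqueWeight_congr {V : Type*} [DecidableEq V] {w w' : Sym2 V → ℝ} {S : Finset V}
    (h : ∀ a ∈ S, ∀ b ∈ S, a ≠ b → w s(a, b) = w' s(a, b)) :
    cliqueWeight w S = cliqueWeight w' S := by
  refine Finset.prod_congr rfl fun e he => ?_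
  induction e with
  | _ x y =>
    simp only [Finset.mem_filter, Finset.mk_mem_sym2_iff, Sym2.mk_isDiag_iff] at he
    exact h x he.1.1 y he.1.2 he.2

/-- Increasing triples correspond to 3-subsets through their increasing enumeration. The unordered
form lets the second moment be sorted by the size of the intersection of two triples. -/
theorem sum_ordered_triples_eq {n : ℕ} (w : Sym2 (Fin n) → ℝ) :
    ∑ i : Fin n, ∑ j ∈ Finset.Ioi i, ∑ k ∈ Finset.Ioi j, w s(i, j) * w s(j, k) * w s(i, k)
      = ∑ S ∈ Finset.powersetCard 3 (Finset.univ : Finset (Fin n)), cliqueWeight w S := by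
  have h1 : ∀ i : Fin n, ∑ j ∈ Finset.Ioi i, ∑ k ∈ Finset.Ioi j,
      w s(i, j) * w s(j, k) * w s(i, k)
      = ∑ x ∈ (Finset.Ioi i).sigma fun j => Finset.Ioi j,
        w s(i, x.1) * w s(x.1, x.2) * w s(i, x.2) := fun i => by rw [Finset.sum_sigma]
  simp_rw [h1]
  rw [← Finset.sum_sigma (Finset.univ : Finset (Fin n))
    (fun i => (Finset.Ioi i).sigma fun j => Finset.Ioi j)
    (fun x => w s(x.1, x.2.1) * w s(x.2.1, x.2.2) * w s(x.1, x.2.2))]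
  refine Finset.sum_nbij (fun x => ({x.1, x.2.1, x.2.2} : Finset (Fin n))) ?_ ?_ ?_ ?_
  · rintro ⟨i, j, k⟩ hx
    simp only [Finset.mem_sigma, Finset.mem_univ, Finset.mem_Ioi, true_and] at hx
    rw [Finset.mem_powersetCard]
    exact ⟨Finset.subset_univ _, Finset.card_eq_three.2
      ⟨i, j, k, hx.1.ne, (hx.1.trans hx.2).ne, hx.2.ne, rfl⟩⟩
  · rintro ⟨i, j, k⟩ hx ⟨i', j', k'⟩ hx' h
    simp only [Finset.coe_sigma, Set.mem_sigma_iff, Finset.mem_coe, Finset.mem_univ,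
      Finset.mem_Ioi, true_and] at hx hx' h
    have e1 : i ∈ ({i', j', k'} : Finset (Fin n)) := by rw [← h]; simp
    have e2 : j ∈ ({i', j', k'} : Finset (Fin n)) := by rw [← h]; simp
    have e3 : k ∈ ({i', j', k'} : Finset (Fin n)) := by rw [← h]; simp
    simp only [Finset.mem_insert, Finset.mem_singleton] at e1 e2 e3
    have : i = i' ∧ j = j' ∧ k = k' := by
      simp only [Fin.ext_iff, Fin.lt_def] at *
      omega
    obtain ⟨rfl, rfl, rfl⟩ := this
    rfl
  · intro S hS
    rw [Finset.mem_coe, Finset.mem_powersetCard] at hS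
    refine ⟨⟨S.orderEmbOfFin hS.2 0, S.orderEmbOfFin hS.2 1, S.orderEmbOfFin hS.2 2⟩, ?_, ?_⟩
    · simp only [Finset.coe_sigma, Set.mem_sigma_iff, Finset.mem_coe, Finset.mem_univ,
        Finset.mem_Ioi, true_and, OrderEmbedding.lt_iff_lt]
      decide
    · have := Finset.image_orderEmbOfFin_univ S hS.2
      conv_rhs => rw [← this]
      ext x
      simp only [Finset.mem_insert, Finset.mem_singleton, Finset.mem_image, Finset.mem_univ,
        true_and, Fin.exists_fin_succ, Fin.succ_zero_eq_one, Fin.succ_one_eq_two,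
        IsEmpty.exists_iff, or_false, eq_comm]
  · rintro ⟨i, j, k⟩ hx
    simp only [Finset.mem_sigma, Finset.mem_univ, Finset.mem_Ioi, true_and] at hx
    exact (cliqueWeight_triple w hx.1.ne hx.2.ne (hx.1.trans hx.2).ne).symm

/-- Such a set is one of the three pairs in `S` together with one more vertex. -/
theorem card_filter_inter_eq_two_le {n : ℕ} {S : Finset (Fin n)} (hS : S.card = 3) :
    ((Finset.powersetCard 3 (Finset.univ : Finset (Fin n))).filter
      fun S' => (S ∩ S').card = 2).card ≤ 3 * n := by
  have hsub : ((Finset.powersetCard 3 (Finset.univ : Finset (Fin n))).filter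
      fun S' => (S ∩ S').card = 2) ⊆
      (Finset.powersetCard 2 S ×ˢ (Finset.univ : Finset (Fin n))).image
        fun x => insert x.2 x.1 := by
    intro S' hS'
    simp only [Finset.mem_filter, Finset.mem_powersetCard] at hS'
    have hcard : (S' \ S).card = 1 := by
      have := Finset.card_sdiff_add_card_inter S' S
      rw [Finset.inter_comm] at this
      omega
    obtain ⟨c, hc⟩ := Finset.card_eq_one.1 hcard
    refine Finset.mem_image.2 ⟨(S ∩ S', c), ?_, ?_⟩
    · simp [Finset.mem_powersetCard, hS'.2]
    · ext x
      have := congrArg (x ∈ ·) hc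
      simp only [Finset.mem_sdiff, Finset.mem_singleton, eq_iff_iff] at this
      simp only [Finset.mem_insert, Finset.mem_inter]
      tauto
  refine (Finset.card_le_card hsub).trans (Finset.card_image_le.trans ?_)
  simp [hS]

/-- A second moment bound for a sum indexed by triples. -/
theorem variance_sum_triples_le {Ω : Type*} [MeasurableSpace Ω] {μ : Measure Ω}
    [IsProbabilityMeasure μ] {n : ℕ} {X : Finset (Fin n) → Ω → ℝ} {m V Q : ℝ}
    (hX : ∀ S, MemLp (X S) 2 μ) (hm : ∀ S, S.card = 3 → ∫ ω, X S ω ∂μ = m)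
    (hV : ∀ S, S.card = 3 → ∫ ω, X S ω * X S ω ∂μ ≤ V)
    (hQ : ∀ S S', S.card = 3 → S'.card = 3 → (S ∩ S').card = 2 → ∫ ω, X S ω * X S' ω ∂μ ≤ Q)
    (h0 : ∀ S S', S.card = 3 → S'.card = 3 → (S ∩ S').card ≤ 1 →
      ∫ ω, X S ω * X S' ω ∂μ = m ^ 2) (hQ0 : 0 ≤ Q) :
    variance (fun ω => ∑ S ∈ Finset.powersetCard 3 (Finset.univ : Finset (Fin n)), X S ω) μ
      ≤ n.choose 3 * (V + 3 * n * Q) := by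
  set P := Finset.powersetCard 3 (Finset.univ : Finset (Fin n)) with hP
  have hcard : ∀ S ∈ P, S.card = 3 := fun S hS => (Finset.mem_powersetCard.1 hS).2
  have hint : ∀ S S', Integrable (fun ω => X S ω * X S' ω) μ := fun S S' =>
    (hX S).integrable_mul (hX S')
  have hvar := variance_eq_sub (memLp_finsetSum P fun S _ => hX S)
  have hE : ∫ ω, ∑ S ∈ P, X S ω ∂μ = P.card * m := by
    rw [integral_finsetSum _ fun S _ => (hX S).integrable (by norm_num),
      Finset.sum_congr rfl fun S hS => hm S (hcard S hS)]
    simp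
  have hE2 : ∫ ω, (∑ S ∈ P, X S ω) ^ 2 ∂μ = ∑ S ∈ P, ∑ S' ∈ P, ∫ ω, X S ω * X S' ω ∂μ := by
    simp_rw [pow_two, Finset.sum_mul_sum]
    rw [integral_finsetSum _ fun S _ => integrable_finsetSum _ fun S' _ => hint S S']
    exact Finset.sum_congr rfl fun S _ => integral_finsetSum _ fun S' _ => hint S S'
  -- Subtracting `m ^ 2` only helps when the triples share two or three vertices, and cancels the
  -- product moment exactly otherwise.
  have hpair : ∀ S ∈ P, ∀ S' ∈ P, ∫ ω, X S ω * X S' ω ∂μ - m ^ 2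
      ≤ (if S = S' then V else 0) + if (S ∩ S').card = 2 then Q else 0 := by
    intro S hS S' hS'
    have hle : (S ∩ S').card ≤ 3 := (Finset.card_le_card Finset.inter_subset_left).trans
      (hcard S hS).le
    by_cases hSS : S = S'
    · subst hSS
      have : (S ∩ S).card ≠ 2 := by rw [Finset.inter_self, hcard S hS]; norm_num
      rw [if_pos rfl, if_neg this]
      nlinarith [hV S (hcard S hS)]
    · have h3 : (S ∩ S').card ≠ 3 := fun h => hSS <| by
        rw [← Finset.eq_of_subset_of_card_le (Finset.inter_subset_left : S ∩ S' ⊆ S)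
          (by rw [h, hcard S hS])]
        exact Finset.eq_of_subset_of_card_le Finset.inter_subset_right
          (by rw [h, hcard S' hS'])
      rw [if_neg hSS]
      by_cases h2 : (S ∩ S').card = 2
      · rw [if_pos h2]
        nlinarith [hQ S S' (hcard S hS) (hcard S' hS') h2]
      · rw [if_neg h2, h0 S S' (hcard S hS) (hcard S' hS') (by omega)]
        simp
  have hrow : ∀ S ∈ P, ∑ S' ∈ P, (∫ ω, X S ω * X S' ω ∂μ - m ^ 2) ≤ V + 3 * n * Q := by
    intro S hS
    refine (Finset.sum_le_sum fun S' hS' => hpair S hS S' hS').trans ?_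
    rw [Finset.sum_add_distrib, Finset.sum_ite_eq, if_pos hS, ← Finset.sum_filter,
      Finset.sum_const, nsmul_eq_mul]
    have := card_filter_inter_eq_two_le (hcard S hS)
    have : (((P.filter fun S' => (S ∩ S').card = 2).card : ℕ) : ℝ) ≤ 3 * n := by
      exact_mod_cast this
    gcongr
  have hPc : P.card = n.choose 3 := by simp [hP]
  have hfun : (∑ S ∈ P, X S) = fun ω => ∑ S ∈ P, X S ω := by ext; simp
  rw [← hPc]
  have key : variance (fun ω => ∑ S ∈ P, X S ω) μ
      = ∑ S ∈ P, ∑ S' ∈ P, (∫ ω, X S ω * X S' ω ∂μ - m ^ 2) := by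
    rw [hvar]
    simp only [Pi.pow_apply, hE2, hE, Finset.sum_sub_distrib, Finset.sum_const, nsmul_eq_mul]
    ring
  rw [key]
  calc _ ≤ ∑ S ∈ P, (V + 3 * n * Q) := Finset.sum_le_sum hrow
    _ = _ := by rw [Finset.sum_const, nsmul_eq_mul]

/-! ### Integrating out one coordinate -/

/-- Resampling one coordinate of a product probability measure. -/
theorem measurePreserving_update {ι X : Type*} [Fintype ι] [DecidableEq ι] [MeasurableSpace X]
    (μ : ι → Measure X) [∀ i, IsProbabilityMeasure (μ i)] (i : ι) :
    MeasurePreserving (fun x : (ι → X) × X => Function.update x.1 i x.2)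
      ((Measure.pi μ).prod (μ i)) (Measure.pi μ) := by
  have hmeas : Measurable fun x : (ι → X) × X => Function.update x.1 i x.2 := by
    rw [measurable_pi_iff]
    intro j
    by_cases h : j = i
    · subst h; simpa using measurable_snd
    · simp only [Function.update_of_ne h]
      exact (measurable_pi_apply j).comp measurable_fst
  refine ⟨hmeas, (Measure.pi_eq fun s hs => ?_).symm⟩
  have hpre : (fun x : (ι → X) × X => Function.update x.1 i x.2) ⁻¹' (Set.univ.pi s)
      = (Set.univ.pi (Function.update s i Set.univ)) ×ˢ s i := by
    ext x
    simp only [Set.mem_preimage, Set.mem_univ_pi, Set.mem_prod]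
    constructor
    · intro h
      refine ⟨fun j => ?_, by simpa using h i⟩
      by_cases hj : j = i
      · subst hj; simp
      · simpa [Function.update_of_ne hj] using h j
    · rintro ⟨h1, h2⟩ j
      by_cases hj : j = i
      · subst hj; simpa
      · simpa [Function.update_of_ne hj] using h1 j
  rw [Measure.map_apply hmeas (MeasurableSet.univ_pi hs), hpre, Measure.prod_prod, Measure.pi_pi,
    ← Finset.prod_erase_mul _ _ (Finset.mem_univ i), Function.update_self, measure_univ, mul_one,
    ← Finset.prod_erase_mul Finset.univ (fun j => (μ j) (s j)) (Finset.mem_univ i)]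
  congr 1
  refine Finset.prod_congr rfl fun j hj => ?_
  rw [Function.update_of_ne (Finset.ne_of_mem_erase hj)]

theorem integral_pi_eq_integral_update {ι X : Type*} [Fintype ι] [DecidableEq ι]
    [MeasurableSpace X] (μ : ι → Measure X) [∀ i, IsProbabilityMeasure (μ i)] (i : ι)
    {f : (ι → X) → ℝ} (hf : Integrable f (Measure.pi μ)) :
    ∫ x, f x ∂(Measure.pi μ) = ∫ x, ∫ y, f (Function.update x i y) ∂(μ i) ∂(Measure.pi μ) := by
  have h := measurePreserving_update μ i
  conv_lhs => rw [← h.map_eq]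
  rw [integral_map h.measurable.aemeasurable (by rw [h.map_eq]; exact hf.aestronglyMeasurable)]
  exact integral_prod _ (h.integrable_comp_of_integrable hf)

end RandomGeometric

namespace RandomGeometric

/-- This is conditioning on all coordinates except `i`: the factor `f` does not see that coordinate
and comes out. The independence arguments for both models run through this lemma. -/
theorem integral_pi_mul_eq {ι X : Type*} [Fintype ι] [DecidableEq ι] [MeasurableSpace X]
    (μ : ι → Measure X) [∀ i, IsProbabilityMeasure (μ i)] (i : ι) {f φ ψ : (ι → X) → ℝ}
    (hint : Integrable (fun x => f x * φ x) (Measure.pi μ))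
    (hf : ∀ x y, f (Function.update x i y) = f x)
    (hφ : ∀ x, ∫ y, φ (Function.update x i y) ∂(μ i) = ψ x) :
    ∫ x, f x * φ x ∂(Measure.pi μ) = ∫ x, f x * ψ x ∂(Measure.pi μ) := by
  rw [integral_pi_eq_integral_update μ i hint]
  refine integral_congr_ae (.of_forall fun x => ?_)
  simp only [hf, ← hφ]
  exact integral_const_mul _ _

/-! ### Moments of signed triangles in the binomial random graph -/

/-- The centred indicator that an unordered pair is an edge. -/
noncomputable def signedEdge {V : Type*} (p : ℝ) (G : SimpleGraph V) (e : Sym2 V) : ℝ :=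
  open Classical in (if e ∈ G.edgeSet then 1 else 0) - p

theorem signedEdge_mk {n : ℕ} (p : ℝ) (G : SimpleGraph (Fin n)) (i j : Fin n) :
    signedEdge p G s(i, j) = edgeInd G i j - p := rfl

theorem signedTriangles_eq_sum {n : ℕ} (p : ℝ) (G : SimpleGraph (Fin n)) :
    signedTriangles p G = ∑ S ∈ Finset.powersetCard 3 (Finset.univ : Finset (Fin n)),
      cliqueWeight (signedEdge p G) S := by
  rw [← sum_ordered_triples_eq]
  simp only [signedTriangles, signedEdge_mk]

/-- The law of the indicator of one pair in the binomial random graph. -/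
noncomputable def pairLaw {V : Type*} (p : unitInterval) (e : Sym2 V) : Measure Prop :=
  unitInterval.toNNReal p • Measure.dirac (e ∈ (Sym2.diagSet : Set (Sym2 V))ᶜ) +
    unitInterval.toNNReal (unitInterval.symm p) • Measure.dirac False

instance {V : Type*} (p : unitInterval) (e : Sym2 V) : IsProbabilityMeasure (pairLaw p e) := by
  unfold pairLaw; infer_instance

/-- On a diagonal pair both Dirac masses sit at `False`, so the pair must be off the diagonal for
the law to be Bernoulli. -/
theorem integral_pairLaw {V : Type*} (p : unitInterval) {e : Sym2 V} (he : ¬ e.IsDiag)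
    (f : Prop → ℝ) : ∫ b, f b ∂(pairLaw p e) = p * f True + (1 - p) * f False := by
  have hf : ∀ μ : Measure Prop, [IsFiniteMeasure μ] → Integrable f μ := fun μ _ => .of_finite
  rw [pairLaw, integral_add_measure (hf _) (hf _), integral_smul_nnreal_measure,
    integral_smul_nnreal_measure, integral_dirac, integral_dirac]
  have : (e ∈ (Sym2.diagSet : Set (Sym2 V))ᶜ) = True := by simpa using he
  rw [this, NNReal.smul_def, NNReal.smul_def]
  simp

instance {n : ℕ} : DiscreteMeasurableSpace (SimpleGraph (Fin n)) := by
  have : MeasurableSingletonClass (SimpleGraph (Fin n)) := ⟨fun G => by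
    have := SimpleGraph.measurable_edgeSet (V := Fin n) (measurableSet_singleton G.edgeSet)
    convert this using 1
    ext H
    simp⟩
  infer_instance

theorem integral_binomialRandom {n : ℕ} (p : unitInterval) (f : SimpleGraph (Fin n) → ℝ) :
    ∫ G, f G ∂(SimpleGraph.binomialRandom (Fin n) p) =
      ∫ ω, f (SimpleGraph.fromEdgeSet {e | ω e}) ∂(Measure.pi fun e => pairLaw p e) := by
  have hm : Measurable fun ω : Sym2 (Fin n) → Prop => ({e | ω e} : Set (Sym2 (Fin n))) :=
    measurable_of_countable _
  have hf : Measurable (SimpleGraph.fromEdgeSet : Set (Sym2 (Fin n)) → SimpleGraph (Fin n)) :=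
    SimpleGraph.measurable_fromEdgeSet
  rw [SimpleGraph.binomialRandom_eq_map, setBernoulli_eq_map, Measure.map_map hf hm,
    Measure.infinitePi_eq_pi, integral_map (hf.comp hm).aemeasurable
      (Measurable.of_discrete).aestronglyMeasurable]
  rfl

section Binomial

variable {n : ℕ} (p : unitInterval)

/-- The centred indicator of a pair, as a function of independent pair indicators. -/
noncomputable def pairWeight (ω : Sym2 (Fin n) → Prop) (e : Sym2 (Fin n)) : ℝ :=
  open Classical in (if ω e then 1 else 0) - (p : ℝ)

theorem pairWeight_update_of_ne (ω : Sym2 (Fin n) → Prop) {e e' : Sym2 (Fin n)} (h : e' ≠ e)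
    (b : Prop) : pairWeight p (Function.update ω e b) e' = pairWeight p ω e' := by
  unfold pairWeight
  rw [Function.update_of_ne h]

theorem cliqueWeight_pairWeight_update (ω : Sym2 (Fin n) → Prop) {S : Finset (Fin n)}
    {a b : Fin n} (h : a ∉ S) (c : Prop) :
    cliqueWeight (pairWeight p (Function.update ω s(a, b) c)) S = cliqueWeight (pairWeight p ω) S :=
  cliqueWeight_congr fun x hx y hy _ => pairWeight_update_of_ne p ω (by
    rw [Ne, Sym2.eq_iff]
    rintro (⟨rfl, rfl⟩ | ⟨rfl, rfl⟩) <;> contradiction) c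

theorem integral_mul_pairWeight {e : Sym2 (Fin n)} (he : ¬ e.IsDiag)
    {f : (Sym2 (Fin n) → Prop) → ℝ} (hf : ∀ ω b, f (Function.update ω e b) = f ω) :
    ∫ ω, f ω * pairWeight p ω e ∂(Measure.pi fun e => pairLaw p e) = 0 := by
  rw [integral_pi_mul_eq _ e .of_finite hf (ψ := fun _ => 0)]
  · simp
  · intro ω
    simp only [pairWeight, Function.update_self]
    rw [integral_pairLaw p he]
    simp
    ring

theorem integral_mul_pairWeight_sq {e : Sym2 (Fin n)} (he : ¬ e.IsDiag)
    {f : (Sym2 (Fin n) → Prop) → ℝ} (hf : ∀ ω b, f (Function.update ω e b) = f ω) :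
    ∫ ω, f ω * pairWeight p ω e ^ 2 ∂(Measure.pi fun e => pairLaw p e) =
      (∫ ω, f ω ∂(Measure.pi fun e => pairLaw p e)) * (p * (1 - p)) := by
  rw [integral_pi_mul_eq _ e .of_finite hf (ψ := fun _ => (p : ℝ) * (1 - p)), integral_mul_const]
  intro ω
  simp only [pairWeight, Function.update_self]
  rw [integral_pairLaw p he]
  simp
  ring

/-- An edge of the triangle at `a` enters neither `f` nor the other two edges, and its centred
indicator integrates to zero. With `f = 1` this gives the mean; with `f` another triangle avoiding
`a` it gives orthogonality. -/
theorem integral_cliqueWeight_mul_eq_zero {S : Finset (Fin n)} (hS : S.card = 3) {a : Fin n}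
    (ha : a ∈ S) {f : (Sym2 (Fin n) → Prop) → ℝ}
    (hf : ∀ ω b c, f (Function.update ω s(a, b) c) = f ω) :
    ∫ ω, cliqueWeight (pairWeight p ω) S * f ω ∂(Measure.pi fun e => pairLaw p e) = 0 := by
  obtain ⟨b, c, hbc, hS'⟩ := Finset.card_eq_two.1
    (by rw [Finset.card_erase_of_mem ha, hS] : (S.erase a).card = 2)
  have hb : b ∈ S.erase a := by simp [hS']
  have hc : c ∈ S.erase a := by simp [hS']
  have hab : a ≠ b := (Finset.ne_of_mem_erase hb).symm
  have hac : a ≠ c := (Finset.ne_of_mem_erase hc).symm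
  have hSe : S = {a, b, c} := by rw [← Finset.insert_erase ha, hS']
  simp only [hSe, cliqueWeight_triple _ hab hbc hac]
  have := integral_mul_pairWeight p (e := s(a, b)) (by simpa using hab)
    (f := fun ω => pairWeight p ω s(b, c) * pairWeight p ω s(a, c) * f ω) ?_
  · rw [← this]
    exact integral_congr_ae (.of_forall fun ω => by ring)
  · intro ω x
    rw [hf, pairWeight_update_of_ne, pairWeight_update_of_ne]
    · rw [Ne, Sym2.eq_iff]; tauto
    · rw [Ne, Sym2.eq_iff]; tauto

theorem integral_cliqueWeight_sq {S : Finset (Fin n)} (hS : S.card = 3) :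
    ∫ ω, cliqueWeight (pairWeight p ω) S * cliqueWeight (pairWeight p ω) S
      ∂(Measure.pi fun e => pairLaw p e) = ((p : ℝ) * (1 - p)) ^ 3 := by
  obtain ⟨a, b, c, hab, hac, hbc, rfl⟩ := Finset.card_eq_three.1 hS
  simp only [cliqueWeight_triple _ hab hbc hac]
  have h1 := integral_mul_pairWeight_sq p (e := s(a, b)) (by simpa using hab)
    (f := fun ω => pairWeight p ω s(b, c) ^ 2 * pairWeight p ω s(a, c) ^ 2) ?_
  · have h2 := integral_mul_pairWeight_sq p (e := s(a, c)) (by simpa using hac)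
      (f := fun ω => pairWeight p ω s(b, c) ^ 2) ?_
    · have h3 := integral_mul_pairWeight_sq p (e := s(b, c)) (by simpa using hbc)
        (f := fun _ => 1) fun _ _ => rfl
      simp only [one_mul, integral_const, probReal_univ, smul_eq_mul] at h3
      rw [h3] at h2
      rw [h2] at h1
      rw [show ((p : ℝ) * (1 - p)) ^ 3 = p * (1 - p) * (p * (1 - p)) * (p * (1 - p)) by ring, ← h1]
      exact integral_congr_ae (.of_forall fun ω => by ring)
    · intro ω x
      rw [pairWeight_update_of_ne]
      rw [Ne, Sym2.eq_iff]; tauto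
  · intro ω x
    rw [pairWeight_update_of_ne, pairWeight_update_of_ne]
    · rw [Ne, Sym2.eq_iff]; tauto
    · rw [Ne, Sym2.eq_iff]; tauto

/-- `fromEdgeSet` discards diagonal pairs, but a clique weight never reads them. -/
theorem cliqueWeight_signedEdge_fromEdgeSet (ω : Sym2 (Fin n) → Prop) (S : Finset (Fin n)) :
    cliqueWeight (signedEdge p (SimpleGraph.fromEdgeSet {e | ω e})) S
      = cliqueWeight (pairWeight p ω) S := by
  refine cliqueWeight_congr fun a _ b _ hab => ?_
  have : (s(a, b) ∈ (SimpleGraph.fromEdgeSet {e | ω e}).edgeSet) = ω s(a, b) := by simp [hab]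
  unfold signedEdge pairWeight
  congr 1
  by_cases h : ω s(a, b)
  · rw [if_pos h, if_pos (this.mpr h)]
  · rw [if_neg h, if_neg fun h' => h (this.mp h')]

theorem integral_cliqueWeight_binomialRandom {S : Finset (Fin n)} (hS : S.card = 3) :
    ∫ G, cliqueWeight (signedEdge p G) S ∂(SimpleGraph.binomialRandom (Fin n) p) = 0 := by
  rw [integral_binomialRandom]
  simp only [cliqueWeight_signedEdge_fromEdgeSet]
  obtain ⟨a, ha⟩ : S.Nonempty := Finset.card_pos.1 (by omega)
  simpa using integral_cliqueWeight_mul_eq_zero p hS ha (f := fun _ => 1) fun _ _ _ => rfl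

theorem integral_signedTriangles_binomialRandom :
    ∫ G, signedTriangles (p : ℝ) G ∂(SimpleGraph.binomialRandom (Fin n) p) = 0 := by
  simp only [signedTriangles_eq_sum]
  rw [integral_finsetSum _ fun _ _ => .of_finite]
  exact Finset.sum_eq_zero fun S hS =>
    integral_cliqueWeight_binomialRandom p (Finset.mem_powersetCard.1 hS).2

theorem variance_signedTriangles_binomialRandom_le :
    variance (signedTriangles (p : ℝ)) (SimpleGraph.binomialRandom (Fin n) p)
      ≤ n.choose 3 * ((p : ℝ) * (1 - p)) ^ 3 := by
  have hne : ∀ S S' : Finset (Fin n), S.card = 3 → S'.card = 3 → (S ∩ S').card ≤ 2 →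
      ∫ G, cliqueWeight (signedEdge p G) S * cliqueWeight (signedEdge p G) S'
        ∂(SimpleGraph.binomialRandom (Fin n) p) = 0 := by
    intro S S' hS hS' hSS
    obtain ⟨a, ha⟩ : (S \ S').Nonempty := Finset.card_pos.1 (by
      have := Finset.card_sdiff_add_card_inter S S'
      omega)
    rw [Finset.mem_sdiff] at ha
    rw [integral_binomialRandom]
    simp only [cliqueWeight_signedEdge_fromEdgeSet]
    exact integral_cliqueWeight_mul_eq_zero p hS ha.1 fun ω b c =>
      cliqueWeight_pairWeight_update p ω ha.2 c
  have hfun : signedTriangles (n := n) (p : ℝ) = fun G =>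
      ∑ S ∈ Finset.powersetCard 3 (Finset.univ : Finset (Fin n)),
        cliqueWeight (signedEdge p G) S := funext fun G => signedTriangles_eq_sum _ _
  rw [hfun]
  refine (variance_sum_triples_le (m := 0) (Q := 0) (V := ((p : ℝ) * (1 - p)) ^ 3)
    (fun S => .of_discrete) ?_ ?_ ?_ ?_ le_rfl).trans_eq (by ring)
  · exact fun S hS => integral_cliqueWeight_binomialRandom p hS
  · intro S hS
    rw [integral_binomialRandom]
    simp only [cliqueWeight_signedEdge_fromEdgeSet]
    exact (integral_cliqueWeight_sq p hS).le
  · exact fun S S' hS hS' h => (hne S S' hS hS' h.le).le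
  · exact fun S S' hS hS' h => by rw [hne S S' hS hS' (by omega)]; norm_num

end Binomial

end RandomGeometric

/-! ### Triangle sums of a centred kernel on a probability space -/

namespace RandomGeometric

section Kernel

variable {X : Type*} [MeasurableSpace X] {σ : Measure X} [IsProbabilityMeasure σ]

/-- A symmetric, bounded, measurable kernel all of whose sections have mean zero. -/
structure IsCentredKernel (σ : Measure X) (κ : X → X → ℝ) : Prop where
  symm : ∀ u v, κ u v = κ v u
  measurable : Measurable fun x : X × X => κ x.1 x.2
  abs_le : ∀ u v, |κ u v| ≤ 1
  integral_eq_zero : ∀ u, ∫ w, κ u w ∂σ = 0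

/-- The square of an integral operator, as a kernel. -/
noncomputable def kernelSq (σ : Measure X) (κ : X → X → ℝ) (u v : X) : ℝ :=
  ∫ w, κ u w * κ v w ∂σ

variable {κ : X → X → ℝ}

theorem integrable_of_abs_le_one {Y : Type*} [MeasurableSpace Y] {μ : Measure Y}
    [IsFiniteMeasure μ] {f : Y → ℝ} (hf : Measurable f) (h : ∀ y, |f y| ≤ 1) : Integrable f μ :=
  .of_bound hf.aestronglyMeasurable 1 (.of_forall h)

theorem abs_mul_le_one {a b : ℝ} (ha : |a| ≤ 1) (hb : |b| ≤ 1) : |a * b| ≤ 1 := by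
  rw [abs_mul]; exact mul_le_one₀ ha (abs_nonneg _) hb

theorem abs_integral_le_one {Y : Type*} [MeasurableSpace Y] {μ : Measure Y}
    [IsProbabilityMeasure μ] {f : Y → ℝ} (h : ∀ y, |f y| ≤ 1) : |∫ y, f y ∂μ| ≤ 1 := by
  simpa using norm_integral_le_of_norm_le_const (μ := μ) (f := f) (C := 1) (.of_forall h)

theorem integral_linear_combination {Y : Type*} [MeasurableSpace Y] {μ : Measure Y}
    [IsProbabilityMeasure μ] {f g h : Y → ℝ} (hf : Integrable f μ) (hg : Integrable g μ)
    (hh : Integrable h μ) (a b c d : ℝ) :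
    ∫ y, a * f y + (b * g y + (c * h y + d)) ∂μ =
      a * ∫ y, f y ∂μ + (b * ∫ y, g y ∂μ + (c * ∫ y, h y ∂μ + d)) := by
  have h1 : Integrable (fun y => c * h y + d) μ := (hh.const_mul c).add (integrable_const d)
  have h2 : Integrable (fun y => b * g y + (c * h y + d)) μ := (hg.const_mul b).add h1
  rw [integral_add (hf.const_mul a) h2, integral_add (hg.const_mul b) h1,
    integral_add (hh.const_mul c) (integrable_const d)]
  simp [integral_const_mul]

namespace IsCentredKernel

variable (hκ : IsCentredKernel σ κ)

include hκ

theorem measurable_left (u : X) : Measurable (κ u) := hκ.measurable.comp measurable_prodMk_left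

theorem integrable_left (u : X) : Integrable (κ u) σ :=
  integrable_of_abs_le_one (hκ.measurable_left u) (hκ.abs_le u)

theorem abs_kernelSq_le (u v : X) : |kernelSq σ κ u v| ≤ 1 :=
  abs_integral_le_one fun w => abs_mul_le_one (hκ.abs_le u w) (hκ.abs_le v w)

theorem measurable_kernelSq : Measurable fun x : X × X => kernelSq σ κ x.1 x.2 := by
  have h : Measurable fun x : (X × X) × X => κ x.1.1 x.2 * κ x.1.2 x.2 :=
    (hκ.measurable.comp ((measurable_fst.comp measurable_fst).prodMk measurable_snd)).mul
      (hκ.measurable.comp ((measurable_snd.comp measurable_fst).prodMk measurable_snd))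
  exact (h.stronglyMeasurable.integral_prod_right (ν := σ)).measurable

theorem integral_kernelSq (u : X) : ∫ v, kernelSq σ κ u v ∂σ = 0 := by
  unfold kernelSq
  rw [integral_integral_swap]
  · have : ∀ w, ∫ v, κ u w * κ v w ∂σ = 0 := fun w => by
      rw [integral_const_mul]
      simp_rw [fun v => hκ.symm v w]
      rw [hκ.integral_eq_zero, mul_zero]
    simp [this]
  · refine integrable_of_abs_le_one ?_ fun y => abs_mul_le_one (hκ.abs_le _ _) (hκ.abs_le _ _)
    exact ((hκ.measurable_left u).comp measurable_snd).mul hκ.measurable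

end IsCentredKernel

variable {n : ℕ}

/-- The weight which a kernel gives to a pair of points. -/
def kernelWeight (hsymm : ∀ u v, κ u v = κ v u) (v : Fin n → X) : Sym2 (Fin n) → ℝ :=
  Sym2.lift ⟨fun i j => κ (v i) (v j), fun _ _ => hsymm _ _⟩

theorem kernelWeight_mk (hsymm : ∀ u v, κ u v = κ v u) (v : Fin n → X) (i j : Fin n) :
    kernelWeight hsymm v s(i, j) = κ (v i) (v j) := rfl

theorem cliqueWeight_kernelWeight_update (hsymm : ∀ u v, κ u v = κ v u) (v : Fin n → X)
    {S : Finset (Fin n)} {c : Fin n} (hc : c ∉ S) (x : X) :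
    cliqueWeight (kernelWeight hsymm (Function.update v c x)) S =
      cliqueWeight (kernelWeight hsymm v) S :=
  cliqueWeight_congr fun a ha b hb _ => by
    rw [kernelWeight_mk, kernelWeight_mk, Function.update_of_ne, Function.update_of_ne]
    · rintro rfl; contradiction
    · rintro rfl; contradiction

theorem measurable_pair_apply {Φ : X → X → ℝ} (hΦ : Measurable fun x : X × X => Φ x.1 x.2)
    (i j : Fin n) : Measurable fun v : Fin n → X => Φ (v i) (v j) := by
  have := hΦ.comp (f := fun v : Fin n → X => (v i, v j))
    ((measurable_pi_apply i).prodMk (measurable_pi_apply j))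
  exact this

namespace IsCentredKernel

variable (hκ : IsCentredKernel σ κ)

include hκ

theorem measurable_apply (i j : Fin n) : Measurable fun v : Fin n → X => κ (v i) (v j) :=
  measurable_pair_apply hκ.measurable i j

theorem measurable_kernelSq_apply (i j : Fin n) :
    Measurable fun v : Fin n → X => kernelSq σ κ (v i) (v j) :=
  measurable_pair_apply hκ.measurable_kernelSq i j

theorem measurable_cliqueWeight (S : Finset (Fin n)) :
    Measurable fun v : Fin n → X => cliqueWeight (kernelWeight hκ.symm v) S := by
  refine Finset.measurable_fun_prod _ fun e _ => ?_
  induction e with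
  | _ i j => exact hκ.measurable_apply i j

theorem abs_cliqueWeight_le (S : Finset (Fin n)) (v : Fin n → X) :
    |cliqueWeight (kernelWeight hκ.symm v) S| ≤ 1 := by
  rw [cliqueWeight, Finset.abs_prod]
  refine Finset.prod_le_one (fun _ _ => abs_nonneg _) fun e _ => ?_
  induction e with
  | _ i j => exact hκ.abs_le _ _

/-- Only the two edges at `c` depend on the point `v c`; their average over it is the squared kernel
at the opposite pair. -/
theorem integral_mul_triangle {a b c : Fin n} (hbc : b ≠ c) (hac : a ≠ c)
    {f : (Fin n → X) → ℝ} (hf : Measurable f) (hf1 : ∀ v, |f v| ≤ 1)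
    (hfc : ∀ v x, f (Function.update v c x) = f v) :
    ∫ v, f v * (κ (v b) (v c) * κ (v a) (v c)) ∂(Measure.pi fun _ => σ) =
      ∫ v, f v * kernelSq σ κ (v a) (v b) ∂(Measure.pi fun _ => σ) := by
  refine integral_pi_mul_eq (fun _ => σ) c ?_ hfc fun v => ?_
  · exact integrable_of_abs_le_one
      (hf.mul ((hκ.measurable_apply b c).mul (hκ.measurable_apply a c)))
      fun v => abs_mul_le_one (hf1 v) (abs_mul_le_one (hκ.abs_le _ _) (hκ.abs_le _ _))
  · simp only [Function.update_self, Function.update_of_ne hbc, Function.update_of_ne hac]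
    exact integral_congr_ae (.of_forall fun w => mul_comm _ _)

theorem integral_mul_cliqueWeight {a b c : Fin n} (hab : a ≠ b) (hbc : b ≠ c) (hac : a ≠ c)
    {f : (Fin n → X) → ℝ} (hf : Measurable f) (hf1 : ∀ v, |f v| ≤ 1)
    (hfc : ∀ v x, f (Function.update v c x) = f v) :
    ∫ v, f v * cliqueWeight (kernelWeight hκ.symm v) {a, b, c} ∂(Measure.pi fun _ => σ) =
      ∫ v, f v * (κ (v a) (v b) * kernelSq σ κ (v a) (v b)) ∂(Measure.pi fun _ => σ) := by
  have := hκ.integral_mul_triangle hbc hac (f := fun v => f v * κ (v a) (v b))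
    (hf.mul (hκ.measurable_apply a b)) (fun v => abs_mul_le_one (hf1 v) (hκ.abs_le _ _))
    fun v x => by rw [hfc, Function.update_of_ne hac, Function.update_of_ne hbc]
  simp only [cliqueWeight_triple _ hab hbc hac, kernelWeight_mk, mul_assoc] at this ⊢
  exact this

theorem integral_mul_edge {a b : Fin n} (hab : a ≠ b) {Φ : X → X → ℝ} {s : ℝ}
    (hΦ : Measurable fun x : X × X => Φ x.1 x.2) (hΦ1 : ∀ u v, |Φ u v| ≤ 1)
    (hs : ∀ u, ∫ w, Φ u w ∂σ = s)
    {f : (Fin n → X) → ℝ} (hf : Measurable f) (hf1 : ∀ v, |f v| ≤ 1)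
    (hfb : ∀ v x, f (Function.update v b x) = f v) :
    ∫ v, f v * Φ (v a) (v b) ∂(Measure.pi fun _ => σ) =
      (∫ v, f v ∂(Measure.pi fun _ => σ)) * s := by
  rw [← integral_mul_const]
  refine integral_pi_mul_eq (fun _ => σ) b ?_ hfb fun v => ?_
  · exact integrable_of_abs_le_one
      (hf.mul (measurable_pair_apply hΦ a b))
      fun v => abs_mul_le_one (hf1 v) (hΦ1 _ _)
  · simp only [Function.update_self, Function.update_of_ne hab]
    exact hs _

variable {Δ Q : ℝ} (hΔ : ∀ u, ∫ w, κ u w * kernelSq σ κ u w ∂σ = Δ)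

include hΔ

/-- Here `T` contains every vertex on which `f` depends. At least two vertices `b`, `c` of `S` are
free: integrating out `c` and then `b` leaves `Δ`, because `hΔ` makes the result independent of
where the third vertex lies. -/
theorem integral_mul_cliqueWeight_of_notMem {S : Finset (Fin n)} (hS : S.card = 3)
    {f : (Fin n → X) → ℝ} (hf : Measurable f) (hf1 : ∀ v, |f v| ≤ 1) {T : Finset (Fin n)}
    (hST : (T ∩ S).card ≤ 1) (hfT : ∀ c ∉ T, ∀ v x, f (Function.update v c x) = f v) :
    ∫ v, f v * cliqueWeight (kernelWeight hκ.symm v) S ∂(Measure.pi fun _ => σ) =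
      (∫ v, f v ∂(Measure.pi fun _ => σ)) * Δ := by
  obtain ⟨b, hb, c, hc, hbc⟩ : ∃ b ∈ S \ T, ∃ c ∈ S \ T, b ≠ c := by
    refine Finset.one_lt_card.1 ?_
    have := Finset.card_sdiff_add_card_inter S T
    rw [Finset.inter_comm] at this
    omega
  rw [Finset.mem_sdiff] at hb hc
  obtain ⟨a, ha⟩ : (S \ {b, c}).Nonempty := by
    refine Finset.card_pos.1 ?_
    have := Finset.le_card_sdiff {b, c} S
    rw [Finset.card_pair hbc] at this
    omega
  simp only [Finset.mem_sdiff, Finset.mem_insert, Finset.mem_singleton, not_or] at ha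
  have hSe : S = {a, b, c} := by
    refine (Finset.eq_of_subset_of_card_le ?_ ?_).symm
    · simp [Finset.insert_subset_iff, ha.1, hb.1, hc.1]
    · rw [hS, Finset.card_eq_three.2 ⟨a, b, c, ha.2.1, ha.2.2, hbc, rfl⟩]
  rw [hSe, hκ.integral_mul_cliqueWeight ha.2.1 hbc ha.2.2 hf hf1 (hfT c hc.2)]
  exact hκ.integral_mul_edge ha.2.1 (Φ := fun u v => κ u v * kernelSq σ κ u v)
    (hκ.measurable.mul hκ.measurable_kernelSq)
    (fun u v => abs_mul_le_one (hκ.abs_le _ _) (hκ.abs_kernelSq_le _ _)) hΔ hf hf1 (hfT b hb.2)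

theorem integral_cliqueWeight {S : Finset (Fin n)} (hS : S.card = 3) :
    ∫ v, cliqueWeight (kernelWeight hκ.symm v) S ∂(Measure.pi fun _ => σ) = Δ := by
  simpa using hκ.integral_mul_cliqueWeight_of_notMem hΔ hS (f := fun _ => 1) measurable_const
    (by simp) (T := ∅) (by simp) fun _ _ _ _ => rfl

theorem integral_cliqueWeight_mul_of_card_inter_le_one {S S' : Finset (Fin n)} (hS : S.card = 3)
    (hS' : S'.card = 3) (h : (S ∩ S').card ≤ 1) :
    ∫ v, cliqueWeight (kernelWeight hκ.symm v) S * cliqueWeight (kernelWeight hκ.symm v) S'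
      ∂(Measure.pi fun _ => σ) = Δ ^ 2 := by
  rw [hκ.integral_mul_cliqueWeight_of_notMem hΔ hS' (hκ.measurable_cliqueWeight S)
    (hκ.abs_cliqueWeight_le S) h fun c hc v x => cliqueWeight_kernelWeight_update hκ.symm v hc x,
    hκ.integral_cliqueWeight hΔ hS, pow_two]

-- Given the common pair `a`, `b`, the two remaining vertices are independent. Integrating out each
-- of them turns the product into the square of `κ * kernelSq` at that pair.
omit hΔ in
theorem integral_cliqueWeight_mul_of_card_inter_eq_two
    (hQ : ∀ u, ∫ w, (κ u w * kernelSq σ κ u w) ^ 2 ∂σ = Q) {S S' : Finset (Fin n)}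
    (hS : S.card = 3) (hS' : S'.card = 3) (h : (S ∩ S').card = 2) :
    ∫ v, cliqueWeight (kernelWeight hκ.symm v) S * cliqueWeight (kernelWeight hκ.symm v) S'
      ∂(Measure.pi fun _ => σ) = Q := by
  obtain ⟨a, b, hab, hinter⟩ := Finset.card_eq_two.1 h
  obtain ⟨c, hc⟩ : (S \ S').Nonempty := by
    refine Finset.card_pos.1 ?_
    have := Finset.card_sdiff_add_card_inter S S'
    omega
  obtain ⟨c', hc'⟩ : (S' \ S).Nonempty := by
    refine Finset.card_pos.1 ?_
    have := Finset.card_sdiff_add_card_inter S' S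
    rw [Finset.inter_comm] at this
    omega
  rw [Finset.mem_sdiff] at hc hc'
  have ha : a ∈ S ∩ S' := by simp [hinter]
  have hb : b ∈ S ∩ S' := by simp [hinter]
  rw [Finset.mem_inter] at ha hb
  have ne : ∀ {x y : Fin n} {U : Finset (Fin n)}, x ∈ U → y ∉ U → x ≠ y := by
    rintro x y U hx hy rfl; contradiction
  have hSe : S = {a, b, c} := by
    refine (Finset.eq_of_subset_of_card_le ?_ ?_).symm
    · simp [Finset.insert_subset_iff, ha.1, hb.1, hc.1]
    · rw [hS, Finset.card_eq_three.2 ⟨a, b, c, hab, ne ha.2 hc.2, ne hb.2 hc.2, rfl⟩]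
  have hSe' : S' = {a, b, c'} := by
    refine (Finset.eq_of_subset_of_card_le ?_ ?_).symm
    · simp [Finset.insert_subset_iff, ha.2, hb.2, hc'.1]
    · rw [hS', Finset.card_eq_three.2 ⟨a, b, c', hab, ne ha.1 hc'.2, ne hb.1 hc'.2, rfl⟩]
  have hΦ : Measurable fun x : X × X => κ x.1 x.2 * kernelSq σ κ x.1 x.2 :=
    hκ.measurable.mul hκ.measurable_kernelSq
  have hΦ1 : ∀ u v, |κ u v * kernelSq σ κ u v| ≤ 1 := fun u v =>
    abs_mul_le_one (hκ.abs_le _ _) (hκ.abs_kernelSq_le _ _)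
  conv_lhs =>
    enter [2, v]
    rw [hSe']
  rw [hκ.integral_mul_cliqueWeight hab (ne hb.1 hc'.2) (ne ha.1 hc'.2)
    (hκ.measurable_cliqueWeight S) (hκ.abs_cliqueWeight_le S)
    fun v x => cliqueWeight_kernelWeight_update hκ.symm v hc'.2 x]
  simp_rw [mul_comm (cliqueWeight _ S)]
  rw [hSe, hκ.integral_mul_cliqueWeight hab (ne hb.2 hc.2) (ne ha.2 hc.2)
    (f := fun v => κ (v a) (v b) * kernelSq σ κ (v a) (v b))
    (measurable_pair_apply (Φ := fun u v => κ u v * kernelSq σ κ u v) hΦ a b)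
    (fun v => hΦ1 _ _)
    fun v x => by rw [Function.update_of_ne (ne ha.2 hc.2), Function.update_of_ne (ne hb.2 hc.2)]]
  have := hκ.integral_mul_edge hab (Φ := fun u v => (κ u v * kernelSq σ κ u v) ^ 2)
    (hΦ.pow_const 2) (fun u v => by rw [abs_pow]; exact pow_le_one₀ (abs_nonneg _) (hΦ1 u v)) hQ
    (f := fun _ => 1) measurable_const (by simp) fun _ _ => rfl
  simpa [pow_two] using this

/-- When the product of the three factors `α κ + q` is expanded, terms with one or two edges vanish
because some vertex then has exactly one edge, of mean zero. The full triangle and the constant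
survive. -/
theorem integral_cliqueWeight_sq_of_sq_eq {α q : ℝ} (hsq : ∀ u v, κ u v ^ 2 = α * κ u v + q)
    {S : Finset (Fin n)} (hS : S.card = 3) :
    ∫ v, cliqueWeight (kernelWeight hκ.symm v) S * cliqueWeight (kernelWeight hκ.symm v) S
      ∂(Measure.pi fun _ => σ) = α ^ 3 * Δ + q ^ 3 := by
  obtain ⟨a, b, c, hab, hac, hbc, rfl⟩ := Finset.card_eq_three.1 hS
  have hsq1 : ∀ u v, |κ u v ^ 2| ≤ 1 := fun u v => by
    rw [abs_pow]; exact pow_le_one₀ (abs_nonneg _) (hκ.abs_le u v)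
  have hm : ∀ i j : Fin n, Measurable fun v : Fin n → X => κ (v i) (v j) ^ 2 := fun i j =>
    (hκ.measurable_apply i j).pow_const 2
  have hmix : ∀ u v, ∫ w, κ u w ^ 2 * κ v w ^ 2 ∂σ = α ^ 2 * kernelSq σ κ u v + q ^ 2 := by
    intro u v
    have hi : Integrable (fun w => κ u w * κ v w) σ := integrable_of_abs_le_one
      ((hκ.measurable_left u).mul (hκ.measurable_left v))
      fun w => abs_mul_le_one (hκ.abs_le u w) (hκ.abs_le v w)
    have : ∀ w, κ u w ^ 2 * κ v w ^ 2
        = α ^ 2 * (κ u w * κ v w) + (α * q * κ u w + (α * q * κ v w + q ^ 2)) := fun w => by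
      rw [hsq, hsq]; ring
    simp_rw [this]
    rw [integral_linear_combination hi (hκ.integrable_left u) (hκ.integrable_left v),
      hκ.integral_eq_zero, hκ.integral_eq_zero]
    simp [kernelSq]
  have hlast : ∀ u, ∫ w, κ u w ^ 2 * (α ^ 2 * kernelSq σ κ u w + q ^ 2) ∂σ
      = α ^ 3 * Δ + q ^ 3 := by
    intro u
    have hmH : Measurable (kernelSq σ κ u) := hκ.measurable_kernelSq.comp measurable_prodMk_left
    have hi : Integrable (fun w => κ u w * kernelSq σ κ u w) σ :=
      integrable_of_abs_le_one ((hκ.measurable_left u).mul hmH)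
        fun w => abs_mul_le_one (hκ.abs_le u w) (hκ.abs_kernelSq_le u w)
    have hiH := integrable_of_abs_le_one (μ := σ) hmH (hκ.abs_kernelSq_le u)
    have : ∀ w, κ u w ^ 2 * (α ^ 2 * kernelSq σ κ u w + q ^ 2)
        = α ^ 3 * (κ u w * kernelSq σ κ u w) + (α * q ^ 2 * κ u w
          + (α ^ 2 * q * kernelSq σ κ u w + q ^ 3)) := fun w => by
      rw [hsq]; ring
    simp_rw [this]
    rw [integral_linear_combination hi (hκ.integrable_left u) hiH, hκ.integral_eq_zero,
      hκ.integral_kernelSq]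
    simp [hΔ]
  have step1 := integral_pi_mul_eq (fun _ => σ) c (f := fun v : Fin n → X => κ (v a) (v b) ^ 2)
    (φ := fun v => κ (v a) (v c) ^ 2 * κ (v b) (v c) ^ 2)
    (ψ := fun v => α ^ 2 * kernelSq σ κ (v a) (v b) + q ^ 2)
    (integrable_of_abs_le_one ((hm a b).mul ((hm a c).mul (hm b c)))
      fun v => abs_mul_le_one (hsq1 _ _) (abs_mul_le_one (hsq1 _ _) (hsq1 _ _)))
    (fun v x => by rw [Function.update_of_ne hac, Function.update_of_ne hbc])
    (fun v => by
      simp only [Function.update_self, Function.update_of_ne hbc, Function.update_of_ne hac]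
      exact hmix _ _)
  have step2 := integral_pi_mul_eq (fun _ => σ) b (f := fun _ : Fin n → X => (1 : ℝ))
    (φ := fun v => κ (v a) (v b) ^ 2 * (α ^ 2 * kernelSq σ κ (v a) (v b) + q ^ 2))
    (ψ := fun _ => α ^ 3 * Δ + q ^ 3) ?_ (fun _ _ => rfl)
    (fun v => by
      simp only [Function.update_self, Function.update_of_ne hab]
      exact hlast _)
  · simp only [one_mul, integral_const, probReal_univ, smul_eq_mul] at step2
    rw [← step2, ← step1]
    refine integral_congr_ae (.of_forall fun v => ?_)
    simp only [cliqueWeight_triple _ hab hbc hac, kernelWeight_mk]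
    ring
  · refine Integrable.of_bound (C := α ^ 2 + q ^ 2) ?_ (.of_forall fun v => ?_)
    · exact (((hm a b).mul (((hκ.measurable_kernelSq_apply a b).const_mul _).add_const
        _)).const_mul _).aestronglyMeasurable
    · have h1 := hsq1 (v a) (v b)
      have h2 := hκ.abs_kernelSq_le (v a) (v b)
      rw [Real.norm_eq_abs, one_mul, abs_mul]
      have h3 : |α ^ 2 * kernelSq σ κ (v a) (v b) + q ^ 2| ≤ α ^ 2 + q ^ 2 := by
        refine (abs_add_le _ _).trans ?_
        rw [abs_mul, abs_of_nonneg (sq_nonneg α), abs_of_nonneg (sq_nonneg q)]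
        nlinarith [sq_nonneg α]
      calc _ ≤ 1 * (α ^ 2 + q ^ 2) := by gcongr
        _ = _ := one_mul _

/-- The mean and a variance bound for the triangle sum of a centred kernel. -/
theorem variance_sum_cliqueWeight_le {α q : ℝ} (hsq : ∀ u v, κ u v ^ 2 = α * κ u v + q)
    (hQ : ∀ u, ∫ w, (κ u w * kernelSq σ κ u w) ^ 2 ∂σ = Q) (hQ0 : 0 ≤ Q) :
    variance (fun v : Fin n → X => ∑ S ∈ Finset.powersetCard 3 (Finset.univ : Finset (Fin n)),
        cliqueWeight (kernelWeight hκ.symm v) S) (Measure.pi fun _ => σ)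
      ≤ n.choose 3 * (α ^ 3 * Δ + q ^ 3 + 3 * n * Q) := by
  refine variance_sum_triples_le (m := Δ)
    (X := fun S v => cliqueWeight (kernelWeight hκ.symm v) S)
    (fun S => ?_) ?_ ?_ ?_ ?_ hQ0
  · exact .of_bound (hκ.measurable_cliqueWeight S).aestronglyMeasurable 1
      (.of_forall (hκ.abs_cliqueWeight_le S))
  · exact fun S hS => hκ.integral_cliqueWeight hΔ hS
  · exact fun S hS => (hκ.integral_cliqueWeight_sq_of_sq_eq hΔ hsq hS).le
  · exact fun S S' hS hS' h => (hκ.integral_cliqueWeight_mul_of_card_inter_eq_two hQ hS hS' h).le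
  · exact fun S S' hS hS' h => hκ.integral_cliqueWeight_mul_of_card_inter_le_one hΔ hS hS' h

theorem integral_sum_cliqueWeight :
    ∫ v : Fin n → X, ∑ S ∈ Finset.powersetCard 3 (Finset.univ : Finset (Fin n)),
        cliqueWeight (kernelWeight hκ.symm v) S ∂(Measure.pi fun _ => σ) = n.choose 3 * Δ := by
  rw [integral_finsetSum _ fun S _ => integrable_of_abs_le_one (hκ.measurable_cliqueWeight S)
    (hκ.abs_cliqueWeight_le S), Finset.sum_congr rfl fun S hS =>
      hκ.integral_cliqueWeight hΔ (Finset.mem_powersetCard.1 hS).2]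
  simp

end IsCentredKernel

end Kernel

end RandomGeometric

/-! ### From the sphere to Gaussian integrals -/

namespace RandomGeometric

open scoped ENNReal

theorem lintegral_exp_neg_mul_sq_norm {V : Type*} [NormedAddCommGroup V] [InnerProductSpace ℝ V]
    [FiniteDimensional ℝ V] [MeasurableSpace V] [BorelSpace V] {b : ℝ} (hb : 0 < b) :
    ∫⁻ v : V, ENNReal.ofReal (Real.exp (-b * ‖v‖ ^ 2)) =
      ENNReal.ofReal ((Real.pi / b) ^ (Module.finrank ℝ V / 2 : ℝ)) := by
  have h := GaussianFourier.integral_rexp_neg_mul_sq_norm (V := V) hb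
  have hpos : (0 : ℝ) < (Real.pi / b) ^ (Module.finrank ℝ V / 2 : ℝ) :=
    Real.rpow_pos_of_pos (div_pos Real.pi_pos hb) _
  rw [← h, ofReal_integral_eq_lintegral_ofReal]
  · by_contra hc
    rw [integral_undef hc] at h
    exact hpos.ne h
  · exact .of_forall fun _ => (Real.exp_pos _).le

theorem lintegral_mul_exp_neg_sq {c : ℝ} (hc : 0 ≤ c) :
    ∫⁻ r in Set.Ioi c, ENNReal.ofReal (r * Real.exp (-r ^ 2)) =
      ENNReal.ofReal (Real.exp (-c ^ 2) / 2) := by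
  have hderiv : ∀ x ∈ Set.Ici c,
      HasDerivAt (fun r : ℝ => -(Real.exp (-r ^ 2) / 2)) (x * Real.exp (-x ^ 2)) x := by
    intro x _
    have := (((hasDerivAt_pow 2 x).neg.exp).div_const 2).neg
    refine this.congr_deriv ?_
    simp only [Pi.neg_apply, Nat.cast_ofNat]
    ring
  have hlim : Tendsto (fun r : ℝ => -(Real.exp (-r ^ 2) / 2)) atTop (𝓝 0) := by
    have h1 : Tendsto (fun r : ℝ => -r ^ 2) atTop atBot :=
      tendsto_neg_atTop_atBot.comp (tendsto_pow_atTop (by norm_num))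
    have := ((Real.tendsto_exp_atBot.comp h1).div_const 2).neg
    simpa using this
  have hnn : ∀ x ∈ Set.Ioi c, 0 ≤ x * Real.exp (-x ^ 2) := fun x hx =>
    mul_nonneg (hc.trans (le_of_lt hx)) (Real.exp_pos _).le
  have hint := integrableOn_Ioi_deriv_of_nonneg' hderiv hnn hlim
  rw [← ofReal_integral_eq_lintegral_ofReal hint
    ((ae_restrict_mem measurableSet_Ioi).mono hnn),
    integral_Ioi_of_hasDerivAt_of_tendsto' hderiv hint hlim]
  simp

/-- Integrals of homogeneous functions against a radial density factor through the sphere. -/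
theorem lintegral_mul_exp_neg_sq_norm_eq_toSphere {d : ℕ} (hd : 1 ≤ d)
    {f : EuclideanSpace ℝ (Fin d) → ℝ≥0∞} (hf : Measurable f)
    (hcone : ∀ r : ℝ, 0 < r → ∀ x, f (r • x) = f x) :
    ∫⁻ y, f y * ENNReal.ofReal (Real.exp (-‖y‖ ^ 2)) =
      (∫⁻ r, ENNReal.ofReal (Real.exp (-(r : ℝ) ^ 2)) ∂(Measure.volumeIoiPow (d - 1))) *
      ∫⁻ x, f (x : EuclideanSpace ℝ (Fin d))
        ∂(volume : Measure (EuclideanSpace ℝ (Fin d))).toSphere := by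
  have hn : Nontrivial (EuclideanSpace ℝ (Fin d)) := by
    have : Nonempty (Fin d) := ⟨⟨0, hd⟩⟩
    infer_instance
  have hmp := (volume : Measure (EuclideanSpace ℝ (Fin d))).measurePreserving_homeomorphUnitSphereProd
  rw [finrank_euclideanSpace_fin] at hmp
  set g : EuclideanSpace ℝ (Fin d) → ℝ≥0∞ :=
    fun y => f y * ENNReal.ofReal (Real.exp (-‖y‖ ^ 2)) with hg
  have hgm : Measurable g := hf.mul (by fun_prop)
  have h1 : ∫⁻ y, g y = ∫⁻ y : ({0}ᶜ : Set (EuclideanSpace ℝ (Fin d))), g y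
      ∂(Measure.comap Subtype.val volume) := by
    rw [lintegral_subtype_comap (measurableSet_singleton _).compl, restrict_compl_singleton]
  have h2 : ∀ y : ({0}ᶜ : Set (EuclideanSpace ℝ (Fin d))), g y =
      (fun z : Sphere d × Set.Ioi (0 : ℝ) =>
        ENNReal.ofReal (Real.exp (-(z.2 : ℝ) ^ 2)) * f (z.1 : EuclideanSpace ℝ (Fin d)))
        (homeomorphUnitSphereProd _ y) := by
    intro y
    have hy : 0 < ‖(y : EuclideanSpace ℝ (Fin d))‖ := norm_pos_iff.2 y.2
    simp only [hg, homeomorphUnitSphereProd_apply_fst_coe, homeomorphUnitSphereProd_apply_snd_coe]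
    rw [hcone _ (inv_pos.2 hy), mul_comm]
  have hm : Measurable fun z : Sphere d × Set.Ioi (0 : ℝ) =>
      ENNReal.ofReal (Real.exp (-(z.2 : ℝ) ^ 2)) * f (z.1 : EuclideanSpace ℝ (Fin d)) :=
    Measurable.mul (by fun_prop) (hf.comp (measurable_subtype_coe.comp measurable_fst))
  rw [h1, lintegral_congr h2, hmp.lintegral_comp hm, lintegral_prod_symm _ hm.aemeasurable]
  simp only
  rw [← lintegral_mul_const _ (by fun_prop)]
  refine lintegral_congr fun r => ?_
  exact lintegral_const_mul _ (hf.comp measurable_subtype_coe)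

/-- Polar coordinates for `f` and for the constant `1` have the same radial factor; the constant,
whose Gaussian mass is `π ^ (d / 2)`, fixes the normalization. -/
theorem lintegral_uniformSphere {d : ℕ} (hd : 1 ≤ d)
    {f : EuclideanSpace ℝ (Fin d) → ℝ≥0∞} (hf : Measurable f)
    (hcone : ∀ r : ℝ, 0 < r → ∀ x, f (r • x) = f x) :
    ENNReal.ofReal (Real.pi ^ (d / 2 : ℝ)) *
        ∫⁻ x, f (x : EuclideanSpace ℝ (Fin d)) ∂(uniformSphere d) =
      ∫⁻ y, f y * ENNReal.ofReal (Real.exp (-‖y‖ ^ 2)) := by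
  have hn : Nontrivial (EuclideanSpace ℝ (Fin d)) := by
    have : Nonempty (Fin d) := ⟨⟨0, hd⟩⟩
    infer_instance
  have h1 := lintegral_mul_exp_neg_sq_norm_eq_toSphere hd (f := fun _ => 1) measurable_const
    fun _ _ _ => rfl
  have h2 := lintegral_exp_neg_mul_sq_norm (V := EuclideanSpace ℝ (Fin d)) one_pos
  simp only [one_mul, neg_mul, div_one, finrank_euclideanSpace_fin] at h1 h2
  rw [h2, lintegral_one] at h1
  rw [lintegral_mul_exp_neg_sq_norm_eq_toSphere hd hf hcone, h1, uniformSphere,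
    lintegral_smul_measure, smul_eq_mul]
  have hne : (volume : Measure (EuclideanSpace ℝ (Fin d))).toSphere Set.univ ≠ 0 :=
    Measure.measure_univ_ne_zero.2 (Measure.toSphere_ne_zero _)
  rw [mul_assoc, ← mul_assoc (_ : ℝ≥0∞) (_)⁻¹, ENNReal.mul_inv_cancel hne (measure_ne_top _ _),
    one_mul]

/-- Splitting off the first two coordinates with respect to an orthonormal basis. -/
theorem lintegral_orthonormalBasis_split {k : ℕ} {E : Type*} [NormedAddCommGroup E]
    [InnerProductSpace ℝ E] [FiniteDimensional ℝ E] [MeasurableSpace E] [BorelSpace E]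
    (b : OrthonormalBasis (Fin (k + 2)) ℝ E) {F : ℝ → ℝ → ℝ → ℝ≥0∞}
    (hF : Measurable fun x : ℝ × ℝ × ℝ => F x.1 x.2.1 x.2.2) :
    ∫⁻ y : E, F (inner ℝ (b 0) y) (inner ℝ (b 1) y) (‖y‖ ^ 2) =
      ∫⁻ a : ℝ × ℝ, ∫⁻ z : EuclideanSpace ℝ (Fin k), F a.1 a.2 (a.1 ^ 2 + a.2 ^ 2 + ‖z‖ ^ 2) := by
  have hG : Measurable fun x : Fin (k + 2) → ℝ => F (x 0) (x 1) (∑ i, x i ^ 2) :=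
    hF.comp (g := fun x : ℝ × ℝ × ℝ => F x.1 x.2.1 x.2.2)
      (f := fun x : Fin (k + 2) → ℝ => (x 0, x 1, ∑ i, x i ^ 2)) (by fun_prop)
  have h1 : ∫⁻ y : E, F (inner ℝ (b 0) y) (inner ℝ (b 1) y) (‖y‖ ^ 2) =
      ∫⁻ x : Fin (k + 2) → ℝ, F (x 0) (x 1) (∑ i, x i ^ 2) := by
    rw [← (PiLp.volume_preserving_ofLp (Fin (k + 2))).lintegral_comp hG,
      ← (b.measurePreserving_repr).lintegral_comp
        (f := fun x => F (x.ofLp 0) (x.ofLp 1) (∑ i, x.ofLp i ^ 2))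
        (hG.comp (PiLp.volume_preserving_ofLp (Fin (k + 2))).measurable)]
    refine lintegral_congr fun y => ?_
    simp only [OrthonormalBasis.repr_apply_apply]
    congr 1
    rw [← b.sum_sq_norm_inner_right y]
    simp
  have hG1 : Measurable fun x : ℝ × (Fin (k + 1) → ℝ) =>
      F x.1 (x.2 0) (x.1 ^ 2 + ∑ i, x.2 i ^ 2) :=
    hF.comp (g := fun x : ℝ × ℝ × ℝ => F x.1 x.2.1 x.2.2)
      (f := fun x : ℝ × (Fin (k + 1) → ℝ) => (x.1, x.2 0, x.1 ^ 2 + ∑ i, x.2 i ^ 2))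
      (by fun_prop)
  have h2 : ∫⁻ x : Fin (k + 2) → ℝ, F (x 0) (x 1) (∑ i, x i ^ 2) =
      ∫⁻ x : ℝ × (Fin (k + 1) → ℝ), F x.1 (x.2 0) (x.1 ^ 2 + ∑ i, x.2 i ^ 2) := by
    rw [← (volume_preserving_piFinSuccAbove (fun _ : Fin (k + 2) => ℝ) 0).lintegral_comp hG1]
    refine lintegral_congr fun x => ?_
    simp [Fin.sum_univ_succ, MeasurableEquiv.piFinSuccAbove, Fin.tail]
  have h3 : ∀ a : ℝ, ∫⁻ x : Fin (k + 1) → ℝ, F a (x 0) (a ^ 2 + ∑ i, x i ^ 2) =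
      ∫⁻ c : ℝ, ∫⁻ z : EuclideanSpace ℝ (Fin k), F a c (a ^ 2 + c ^ 2 + ‖z‖ ^ 2) := by
    intro a
    have hG2 : Measurable fun x : ℝ × (Fin k → ℝ) =>
        F a x.1 (a ^ 2 + x.1 ^ 2 + ∑ i, x.2 i ^ 2) :=
      hF.comp (g := fun x : ℝ × ℝ × ℝ => F x.1 x.2.1 x.2.2)
        (f := fun x : ℝ × (Fin k → ℝ) => (a, x.1, a ^ 2 + x.1 ^ 2 + ∑ i, x.2 i ^ 2))
        (by fun_prop)
    have h4 : ∫⁻ x : Fin (k + 1) → ℝ, F a (x 0) (a ^ 2 + ∑ i, x i ^ 2) =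
        ∫⁻ x : ℝ × (Fin k → ℝ), F a x.1 (a ^ 2 + x.1 ^ 2 + ∑ i, x.2 i ^ 2) := by
      rw [← (volume_preserving_piFinSuccAbove (fun _ : Fin (k + 1) => ℝ) 0).lintegral_comp hG2]
      refine lintegral_congr fun x => ?_
      simp [Fin.sum_univ_succ, MeasurableEquiv.piFinSuccAbove, Fin.tail, add_assoc]
    rw [h4, Measure.volume_eq_prod, lintegral_prod _ hG2.aemeasurable]
    refine lintegral_congr fun c => ?_
    rw [← (PiLp.volume_preserving_ofLp (Fin k)).lintegral_comp
      (f := fun z : Fin k → ℝ => F a c (a ^ 2 + c ^ 2 + ∑ i, z i ^ 2))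
      (hG2.comp (measurable_prodMk_left (x := c)))]
    simp [EuclideanSpace.norm_sq_eq]
  have hG5 : Measurable fun x : (ℝ × ℝ) × EuclideanSpace ℝ (Fin k) =>
      F x.1.1 x.1.2 (x.1.1 ^ 2 + x.1.2 ^ 2 + ‖x.2‖ ^ 2) :=
    hF.comp (g := fun x : ℝ × ℝ × ℝ => F x.1 x.2.1 x.2.2)
      (f := fun x : (ℝ × ℝ) × EuclideanSpace ℝ (Fin k) =>
        (x.1.1, x.1.2, x.1.1 ^ 2 + x.1.2 ^ 2 + ‖x.2‖ ^ 2)) (by fun_prop)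
  rw [h1, h2, Measure.volume_eq_prod, lintegral_prod _ hG1.aemeasurable, Measure.volume_eq_prod ℝ ℝ,
    lintegral_prod _ hG5.lintegral_prod_right'.aemeasurable]
  exact lintegral_congr h3

end RandomGeometric

/-! ### The Gaussian measure of the intersection of two circular cones -/

namespace RandomGeometric

open scoped ENNReal

/-- The probability that a random point whose projection to a plane makes an angle `ψ` with a
given direction in that plane has inner product at least `t` with this direction. -/
noncomputable def arcDensity (m t ψ : ℝ) : ℝ :=
  if t < Real.cos ψ then (1 - t ^ 2 / Real.cos ψ ^ 2) ^ m else 0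

/-- If `t < M`, the condition is `√a ‖z‖ ≤ r` with `a = t²/(M² - t²)`. The radial integral then
gives `exp(-(1+a)‖z‖²)/2`, and integration over `z` gives `(π/(1+a))^{k/2}/2`, where `1/(1+a) = 1 -
t²/M²`. If `M < t`, no positive `r` satisfies it. -/
theorem lintegral_radial_condition {k : ℕ} {t M : ℝ} (ht : 0 ≤ t) (hM : t ≠ M) :
    ∫⁻ z : EuclideanSpace ℝ (Fin k), ∫⁻ r in Set.Ioi (0 : ℝ),
      (if t * √(r ^ 2 + ‖z‖ ^ 2) ≤ r * M then
        ENNReal.ofReal (r * Real.exp (-(r ^ 2 + ‖z‖ ^ 2))) else 0) =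
      ENNReal.ofReal (Real.pi ^ (k / 2 : ℝ) / 2 *
        if t < M then (1 - t ^ 2 / M ^ 2) ^ (k / 2 : ℝ) else 0) := by
  by_cases htM : t < M
  · have hM0 : 0 < M := ht.trans_lt htM
    have hD : 0 < M ^ 2 - t ^ 2 := by nlinarith
    set a : ℝ := t ^ 2 / (M ^ 2 - t ^ 2) with ha
    have ha0 : 0 ≤ a := by positivity
    have hz : ∀ z : EuclideanSpace ℝ (Fin k), ∫⁻ r in Set.Ioi (0 : ℝ),
        (if t * √(r ^ 2 + ‖z‖ ^ 2) ≤ r * M then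
          ENNReal.ofReal (r * Real.exp (-(r ^ 2 + ‖z‖ ^ 2))) else 0) =
        ENNReal.ofReal (1 / 2) * ENNReal.ofReal (Real.exp (-(1 + a) * ‖z‖ ^ 2)) := by
      intro z
      set c : ℝ := √a * ‖z‖ with hc
      have hc0 : 0 ≤ c := by positivity
      have hc2 : c ^ 2 = a * ‖z‖ ^ 2 := by rw [hc, mul_pow, Real.sq_sqrt ha0]
      have hiff : ∀ r : ℝ, 0 < r → (t * √(r ^ 2 + ‖z‖ ^ 2) ≤ r * M ↔ c ≤ r) := by
        intro r hr
        have hs0 := Real.sqrt_nonneg (r ^ 2 + ‖z‖ ^ 2)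
        rw [← pow_le_pow_iff_left₀ (mul_nonneg ht hs0) (by positivity) two_ne_zero,
          ← pow_le_pow_iff_left₀ hc0 hr.le two_ne_zero, hc2, mul_pow, mul_pow,
          Real.sq_sqrt (by positivity), ha, div_mul_eq_mul_div, div_le_iff₀ hD]
        constructor <;> intro h <;> nlinarith
      have h1 : ∫⁻ r in Set.Ioi (0 : ℝ),
          (if t * √(r ^ 2 + ‖z‖ ^ 2) ≤ r * M then
            ENNReal.ofReal (r * Real.exp (-(r ^ 2 + ‖z‖ ^ 2))) else 0) =
          ∫⁻ r in Set.Ioi c, ENNReal.ofReal (Real.exp (-‖z‖ ^ 2)) *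
            ENNReal.ofReal (r * Real.exp (-r ^ 2)) := by
        rw [← setLIntegral_congr (Ioi_ae_eq_Ici (a := c) (μ := volume)).symm]
        rw [← lintegral_indicator measurableSet_Ioi, ← lintegral_indicator measurableSet_Ici]
        refine lintegral_congr_ae ?_
        -- When `c = 0`, the point `0` lies in `Ici c` but not in `Ioi 0`.
        filter_upwards [Measure.ae_ne volume (0 : ℝ)] with r hr0
        by_cases hr : 0 < r
        · rw [Set.indicator_of_mem (Set.mem_Ioi.2 hr)]
          by_cases hcr : c ≤ r
          · rw [if_pos ((hiff r hr).2 hcr), Set.indicator_of_mem (Set.mem_Ici.2 hcr),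
              ← ENNReal.ofReal_mul (Real.exp_pos _).le]
            congr 1
            rw [neg_add, Real.exp_add]
            ring
          · rw [if_neg (mt (hiff r hr).1 hcr), Set.indicator_of_notMem (by simpa using hcr)]
        · have hr' : r < 0 := lt_of_le_of_ne (not_lt.1 hr) hr0
          rw [Set.indicator_of_notMem (by simpa using hr), Set.indicator_of_notMem]
          simpa using hr'.trans_le hc0
      rw [h1, lintegral_const_mul _ (by fun_prop), lintegral_mul_exp_neg_sq hc0,
        ← ENNReal.ofReal_mul (Real.exp_pos _).le, ← ENNReal.ofReal_mul (by norm_num), hc2]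
      congr 1
      rw [show -(1 + a) * ‖z‖ ^ 2 = -‖z‖ ^ 2 + -(a * ‖z‖ ^ 2) by ring, Real.exp_add]
      ring
    rw [lintegral_congr hz, lintegral_const_mul _ (by fun_prop),
      lintegral_exp_neg_mul_sq_norm (by positivity), ← ENNReal.ofReal_mul (by norm_num),
      if_pos htM, finrank_euclideanSpace_fin]
    congr 1
    rw [show (1 : ℝ) - t ^ 2 / M ^ 2 = (1 + a)⁻¹ by rw [ha]; field_simp; ring,
      div_eq_mul_inv Real.pi, Real.mul_rpow Real.pi_pos.le (by positivity)]
    ring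
  · have hMt : M < t := lt_of_le_of_ne (not_lt.1 htM) hM.symm
    rw [if_neg htM, mul_zero, ENNReal.ofReal_zero]
    have hz : ∀ z : EuclideanSpace ℝ (Fin k), ∫⁻ r in Set.Ioi (0 : ℝ),
        (if t * √(r ^ 2 + ‖z‖ ^ 2) ≤ r * M then
          ENNReal.ofReal (r * Real.exp (-(r ^ 2 + ‖z‖ ^ 2))) else 0) = 0 := by
      intro z
      rw [setLIntegral_congr_fun measurableSet_Ioi (g := fun _ => 0)]
      · simp
      · intro r hr
        have hr' : 0 < r := hr
        have h1 : r ≤ √(r ^ 2 + ‖z‖ ^ 2) := Real.le_sqrt_of_sq_le (by nlinarith [sq_nonneg ‖z‖])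
        exact if_neg (not_le.2 (by nlinarith [mul_le_mul_of_nonneg_left h1 ht]))
    rw [lintegral_congr hz, lintegral_zero]

theorem measurable_arcDensity (m t : ℝ) : Measurable (arcDensity m t) := by
  unfold arcDensity
  refine Measurable.ite (measurableSet_lt measurable_const Real.measurable_cos) ?_ measurable_const
  fun_prop

theorem arcDensity_base_mem {t ψ : ℝ} (ht : 0 ≤ t) (h : t < Real.cos ψ) :
    0 < 1 - t ^ 2 / Real.cos ψ ^ 2 ∧ 1 - t ^ 2 / Real.cos ψ ^ 2 ≤ 1 := by
  have hc : 0 < Real.cos ψ := ht.trans_lt h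
  constructor
  · rw [sub_pos, div_lt_one (by positivity)]
    exact pow_lt_pow_left₀ h ht two_ne_zero
  · have : 0 ≤ t ^ 2 / Real.cos ψ ^ 2 := by positivity
    linarith

theorem arcDensity_nonneg {m t : ℝ} (ht : 0 ≤ t) (ψ : ℝ) : 0 ≤ arcDensity m t ψ := by
  unfold arcDensity
  split_ifs with h
  · exact Real.rpow_nonneg (arcDensity_base_mem ht h).1.le _
  · exact le_rfl

theorem arcDensity_le_one {m t : ℝ} (hm : 0 ≤ m) (ht : 0 ≤ t) (ψ : ℝ) :
    arcDensity m t ψ ≤ 1 := by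
  unfold arcDensity
  split_ifs with h
  · exact Real.rpow_le_one (arcDensity_base_mem ht h).1.le (arcDensity_base_mem ht h).2 hm
  · exact zero_le_one

theorem intervalIntegrable_arcDensity {m t : ℝ} (hm : 0 ≤ m) (ht : 0 ≤ t) (a b : ℝ) :
    IntervalIntegrable (arcDensity m t) volume a b := by
  rw [intervalIntegrable_iff]
  refine IntegrableOn.of_bound measure_Ioc_lt_top
    (measurable_arcDensity m t).aestronglyMeasurable 1 (.of_forall fun ψ => ?_)
  rw [Real.norm_eq_abs, abs_of_nonneg (arcDensity_nonneg ht ψ)]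
  exact arcDensity_le_one hm ht ψ

/-- The integrand is even in `φ`. Past `π/2` the shifted angle stays below `3π/2`, where the cosine
is nonpositive and the density vanishes. -/
theorem integral_arcDensity_abs_add {m t ψ₀ : ℝ} (hm : 0 ≤ m) (ht : 0 ≤ t) (h0 : 0 ≤ ψ₀)
    (h1 : ψ₀ ≤ Real.pi / 2) :
    ∫ φ in -Real.pi..Real.pi, arcDensity m t (|φ| + ψ₀) =
      2 * ∫ ψ in ψ₀..Real.pi / 2, arcDensity m t ψ := by
  have hpi := Real.pi_pos
  have hi : ∀ a b, IntervalIntegrable (fun φ => arcDensity m t (|φ| + ψ₀)) volume a b := by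
    intro a b
    rw [intervalIntegrable_iff]
    refine IntegrableOn.of_bound measure_Ioc_lt_top
      ((measurable_arcDensity m t).comp (by fun_prop)).aestronglyMeasurable 1
      (.of_forall fun ψ => ?_)
    rw [Real.norm_eq_abs, abs_of_nonneg (arcDensity_nonneg ht _)]
    exact arcDensity_le_one hm ht _
  have hpos : ∫ φ in (0 : ℝ)..Real.pi, arcDensity m t (|φ| + ψ₀) =
      ∫ ψ in ψ₀..Real.pi / 2, arcDensity m t ψ := by
    have e1 : ∫ φ in (0 : ℝ)..Real.pi, arcDensity m t (|φ| + ψ₀) =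
        ∫ φ in (0 : ℝ)..Real.pi, arcDensity m t (φ + ψ₀) := by
      refine intervalIntegral.integral_congr fun φ hφ => ?_
      rw [Set.uIcc_of_le hpi.le] at hφ
      simp only [abs_of_nonneg hφ.1]
    rw [e1, intervalIntegral.integral_comp_add_right (fun x => arcDensity m t x), zero_add,
      ← intervalIntegral.integral_add_adjacent_intervals
        (intervalIntegrable_arcDensity hm ht ψ₀ (Real.pi / 2))
        (intervalIntegrable_arcDensity hm ht (Real.pi / 2) (Real.pi + ψ₀))]
    have e2 : ∫ ψ in (Real.pi / 2)..(Real.pi + ψ₀), arcDensity m t ψ = 0 := by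
      rw [intervalIntegral.integral_congr (g := fun _ => 0)]
      · simp
      · intro ψ hψ
        rw [Set.uIcc_of_le (by linarith)] at hψ
        refine if_neg (not_lt.2 (le_trans ?_ ht))
        exact Real.cos_nonpos_of_pi_div_two_le_of_le hψ.1 (by linarith [hψ.2])
    rw [e2, add_zero]
  have hneg : ∫ φ in -Real.pi..0, arcDensity m t (|φ| + ψ₀) =
      ∫ φ in (0 : ℝ)..Real.pi, arcDensity m t (|φ| + ψ₀) := by
    have := intervalIntegral.integral_comp_neg (a := -Real.pi) (b := 0)
      (fun φ => arcDensity m t (|φ| + ψ₀))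
    simpa using this
  rw [← intervalIntegral.integral_add_adjacent_intervals (hi (-Real.pi) 0) (hi 0 Real.pi), hneg,
    hpos, two_mul]

/-- The two quantities are `r cos(φ - ψ₀)` and `r cos(φ + ψ₀)`; the smaller of them is `r cos(|φ| +
ψ₀)`. -/
theorem le_inner_both_iff {M t r φ ψ₀ : ℝ} (hr : 0 < r) (hφ : |φ| ≤ Real.pi) (h0 : 0 ≤ ψ₀)
    (h1 : ψ₀ ≤ Real.pi / 2) (hM : M = Real.cos (|φ| + ψ₀)) :
    (t ≤ Real.cos ψ₀ * (r * Real.cos φ) + Real.sin ψ₀ * (r * Real.sin φ) ∧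
      t ≤ Real.cos ψ₀ * (r * Real.cos φ) - Real.sin ψ₀ * (r * Real.sin φ)) ↔ t ≤ r * M := by
  have hs0 : 0 ≤ Real.sin ψ₀ := Real.sin_nonneg_of_nonneg_of_le_pi h0
    (by linarith [Real.pi_pos])
  have hs1 : 0 ≤ Real.sin |φ| := Real.sin_nonneg_of_nonneg_of_le_pi (abs_nonneg _) hφ
  have hprod : 0 ≤ Real.sin ψ₀ * (r * Real.sin |φ|) := by positivity
  rw [hM, Real.cos_add, Real.cos_abs]
  rcases abs_cases φ with ⟨h, _⟩ | ⟨h, _⟩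
  · rw [h] at hprod ⊢
    constructor
    · rintro ⟨_, h2⟩; linarith
    · intro h2; constructor <;> linarith
  · rw [h, Real.sin_neg] at hprod ⊢
    constructor
    · rintro ⟨h2, _⟩; linarith
    · intro h2; constructor <;> linarith

/-- Polar coordinates in the plane of the two centres merge both conditions into one. For fixed
angle, the radius and the orthogonal component integrate to a multiple of `arcDensity`, leaving only
the angle. -/
theorem lintegral_two_caps {k : ℕ} {t ψ₀ : ℝ} (ht : 0 ≤ t) (h0 : 0 ≤ ψ₀)
    (h1 : ψ₀ ≤ Real.pi / 2) :
    ∫⁻ a : ℝ × ℝ, ∫⁻ z : EuclideanSpace ℝ (Fin k),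
      (if t * √(a.1 ^ 2 + a.2 ^ 2 + ‖z‖ ^ 2) ≤ Real.cos ψ₀ * a.1 + Real.sin ψ₀ * a.2 ∧
          t * √(a.1 ^ 2 + a.2 ^ 2 + ‖z‖ ^ 2) ≤ Real.cos ψ₀ * a.1 - Real.sin ψ₀ * a.2 then
        ENNReal.ofReal (Real.exp (-(a.1 ^ 2 + a.2 ^ 2 + ‖z‖ ^ 2))) else 0) =
      ENNReal.ofReal (Real.pi ^ (k / 2 : ℝ) *
        ∫ ψ in ψ₀..Real.pi / 2, arcDensity (k / 2) t ψ) := by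
  have hpi := Real.pi_pos
  have hmeas : ∀ {Y : Type} [MeasurableSpace Y] {N f g w : Y → ℝ}, Measurable N → Measurable f →
      Measurable g → Measurable w → Measurable fun y => (if t * √(N y) ≤ f y ∧ t * √(N y) ≤ g y then
        ENNReal.ofReal (w y) else 0) := by
    intro Y _ N f g w hN hf hg hw
    refine Measurable.ite ?_ hw.ennreal_ofReal measurable_const
    exact (measurableSet_le (hN.sqrt.const_mul t) hf).inter
      (measurableSet_le (hN.sqrt.const_mul t) hg)
  rw [← lintegral_comp_polarCoord_symm]
  have hstep : ∀ p ∈ polarCoord.target, ENNReal.ofReal p.1 •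
      (∫⁻ z : EuclideanSpace ℝ (Fin k),
      (if t * √((polarCoord.symm p).1 ^ 2 + (polarCoord.symm p).2 ^ 2 + ‖z‖ ^ 2) ≤
            Real.cos ψ₀ * (polarCoord.symm p).1 + Real.sin ψ₀ * (polarCoord.symm p).2 ∧
          t * √((polarCoord.symm p).1 ^ 2 + (polarCoord.symm p).2 ^ 2 + ‖z‖ ^ 2) ≤
            Real.cos ψ₀ * (polarCoord.symm p).1 - Real.sin ψ₀ * (polarCoord.symm p).2 then
        ENNReal.ofReal (Real.exp (-((polarCoord.symm p).1 ^ 2 + (polarCoord.symm p).2 ^ 2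
          + ‖z‖ ^ 2))) else 0)) =
      ∫⁻ z : EuclideanSpace ℝ (Fin k),
        (if t * √(p.1 ^ 2 + ‖z‖ ^ 2) ≤ p.1 * Real.cos (|p.2| + ψ₀) then
          ENNReal.ofReal (p.1 * Real.exp (-(p.1 ^ 2 + ‖z‖ ^ 2))) else 0) := by
    rintro ⟨r, φ⟩ hp
    rw [polarCoord_target, Set.mem_prod] at hp
    have hr : 0 < r := hp.1
    have hφ : |φ| ≤ Real.pi := abs_le.2 ⟨hp.2.1.le, hp.2.2.le⟩
    simp only [polarCoord_symm_apply, smul_eq_mul]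
    rw [← lintegral_const_mul _ (hmeas (by fun_prop) (by fun_prop) (by fun_prop) (by fun_prop))]
    refine lintegral_congr fun z => ?_
    have hsq : (r * Real.cos φ) ^ 2 + (r * Real.sin φ) ^ 2 = r ^ 2 := by
      rw [mul_pow, mul_pow, ← mul_add, Real.cos_sq_add_sin_sq, mul_one]
    rw [hsq, mul_ite, mul_zero, ← ENNReal.ofReal_mul hr.le]
    exact if_congr (le_inner_both_iff hr hφ h0 h1 rfl) rfl rfl
  rw [setLIntegral_congr_fun polarCoord.open_target.measurableSet hstep, polarCoord_target,
    Measure.volume_eq_prod, ← Measure.prod_restrict]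
  have hm2 : ∀ {Y : Type} [MeasurableSpace Y] {N f w : Y → ℝ}, Measurable N → Measurable f →
      Measurable w → Measurable fun y => (if t * √(N y) ≤ f y then
        ENNReal.ofReal (w y) else 0) := by
    intro Y _ N f w hN hf hw
    exact Measurable.ite (measurableSet_le (hN.sqrt.const_mul t) hf) hw.ennreal_ofReal
      measurable_const
  have hmz : Measurable fun x : (ℝ × ℝ) × EuclideanSpace ℝ (Fin k) =>
      (if t * √(x.1.1 ^ 2 + ‖x.2‖ ^ 2) ≤ x.1.1 * Real.cos (|x.1.2| + ψ₀) then
          ENNReal.ofReal (x.1.1 * Real.exp (-(x.1.1 ^ 2 + ‖x.2‖ ^ 2))) else 0) :=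
    hm2 (by fun_prop) (by fun_prop) (by fun_prop)
  rw [lintegral_prod_symm _ hmz.lintegral_prod_right'.aemeasurable]
  have hinner : ∀ φ : ℝ, t ≠ Real.cos (|φ| + ψ₀) →
      ∫⁻ r in Set.Ioi (0 : ℝ), ∫⁻ z : EuclideanSpace ℝ (Fin k),
        (if t * √(r ^ 2 + ‖z‖ ^ 2) ≤ r * Real.cos (|φ| + ψ₀) then
          ENNReal.ofReal (r * Real.exp (-(r ^ 2 + ‖z‖ ^ 2))) else 0) =
      ENNReal.ofReal (Real.pi ^ (k / 2 : ℝ) / 2 * arcDensity (k / 2) t (|φ| + ψ₀)) := by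
    intro φ hφ
    rw [arcDensity, ← lintegral_radial_condition ht hφ, lintegral_lintegral_swap]
    exact (hm2 (by fun_prop) (by fun_prop) (by fun_prop)).aemeasurable
  -- The boundary case excluded from the radial computation occurs for at most four angles.
  have hcount : {φ : ℝ | t = Real.cos (|φ| + ψ₀)} ∩ Set.Ioo (-Real.pi) Real.pi ⊆
      {Real.arccos t - ψ₀, -(Real.arccos t - ψ₀), 2 * Real.pi - Real.arccos t - ψ₀,
        -(2 * Real.pi - Real.arccos t - ψ₀)} := by
    rintro φ ⟨hφ, hφ1, hφ2⟩
    have hφ' : |φ| < Real.pi := abs_lt.2 ⟨hφ1, hφ2⟩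
    have key : |φ| = Real.arccos t - ψ₀ ∨ |φ| = 2 * Real.pi - Real.arccos t - ψ₀ := by
      have hφ0 := abs_nonneg φ
      rcases le_total (|φ| + ψ₀) Real.pi with h | h
      · left
        have : Real.arccos t = |φ| + ψ₀ := by
          rw [show t = _ from hφ, Real.arccos_cos (by linarith) h]
        linarith
      · right
        have : Real.arccos t = 2 * Real.pi - (|φ| + ψ₀) := by
          rw [show t = _ from hφ, ← Real.cos_two_pi_sub,
            Real.arccos_cos (by linarith) (by linarith)]
        linarith
    simp only [Set.mem_insert_iff, Set.mem_singleton_iff]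
    rcases abs_choice φ with h | h <;> rw [h] at key
    · tauto
    · rcases key with h | h
      · right; left; linarith
      · right; right; right; linarith
  have hae : ∀ᵐ φ ∂(volume.restrict (Set.Ioo (-Real.pi) Real.pi)), t ≠ Real.cos (|φ| + ψ₀) := by
    rw [ae_iff, Measure.restrict_apply' measurableSet_Ioo]
    refine measure_mono_null (t := {Real.arccos t - ψ₀, -(Real.arccos t - ψ₀),
      2 * Real.pi - Real.arccos t - ψ₀, -(2 * Real.pi - Real.arccos t - ψ₀)}) ?_ ?_
    · simpa using hcount
    · exact Set.Finite.measure_zero (Set.toFinite _) _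
  have hfin : ∫⁻ φ in Set.Ioo (-Real.pi) Real.pi,
      ENNReal.ofReal (Real.pi ^ (k / 2 : ℝ) / 2 * arcDensity (k / 2) t (|φ| + ψ₀)) =
      ENNReal.ofReal (Real.pi ^ (k / 2 : ℝ) *
        ∫ ψ in ψ₀..Real.pi / 2, arcDensity (k / 2) t ψ) := by
    have hk : (0 : ℝ) ≤ k / 2 := by positivity
    have hpk : (0 : ℝ) ≤ Real.pi ^ (k / 2 : ℝ) / 2 := by positivity
    rw [← ofReal_integral_eq_lintegral_ofReal]
    · rw [integral_const_mul, ← integral_Ioc_eq_integral_Ioo,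
        ← intervalIntegral.integral_of_le (by linarith), integral_arcDensity_abs_add hk ht h0 h1]
      congr 1; ring
    · refine Integrable.const_mul ?_ _
      refine IntegrableOn.of_bound measure_Ioo_lt_top
        ((measurable_arcDensity _ t).comp (by fun_prop)).aestronglyMeasurable 1
        (.of_forall fun ψ => ?_)
      rw [Real.norm_eq_abs, abs_of_nonneg (arcDensity_nonneg ht _)]
      exact arcDensity_le_one hk ht _
    · exact .of_forall fun φ => mul_nonneg hpk (arcDensity_nonneg ht _)
  rw [← hfin]
  refine lintegral_congr_ae ?_
  filter_upwards [hae] with φ hφ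
  exact hinner φ hφ

end RandomGeometric

/-! ### The measure of two caps, and null level sets -/

namespace RandomGeometric

open scoped ENNReal

theorem measurableSet_le_and_le {Y : Type*} [MeasurableSpace Y] {f₁ g₁ f₂ g₂ : Y → ℝ}
    (hf₁ : Measurable f₁) (hg₁ : Measurable g₁) (hf₂ : Measurable f₂) (hg₂ : Measurable g₂) :
    MeasurableSet {y | f₁ y ≤ g₁ y ∧ f₂ y ≤ g₂ y} :=
  (measurableSet_le hf₁ hg₁).inter (measurableSet_le hf₂ hg₂)

/-- The vectors `u + v` and `u - v` are orthogonal, of lengths `2 cos ψ` and `2 sin ψ` when `u` and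
`v` make the angle `2ψ`; their directions start the basis. -/
theorem exists_orthonormalBasis_bisecting {k : ℕ} (u v : Sphere (k + 2)) :
    ∃ b : OrthonormalBasis (Fin (k + 2)) ℝ (EuclideanSpace ℝ (Fin (k + 2))),
      (u : EuclideanSpace ℝ (Fin (k + 2))) =
          Real.cos (Real.arccos (inner ℝ u.1 v.1) / 2) • b 0 +
            Real.sin (Real.arccos (inner ℝ u.1 v.1) / 2) • b 1 ∧
        (v : EuclideanSpace ℝ (Fin (k + 2))) =
          Real.cos (Real.arccos (inner ℝ u.1 v.1) / 2) • b 0 -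
            Real.sin (Real.arccos (inner ℝ u.1 v.1) / 2) • b 1 := by
  have hu : ‖u.1‖ = 1 := norm_eq_of_mem_sphere u
  have hv : ‖v.1‖ = 1 := norm_eq_of_mem_sphere v
  set s : ℝ := inner ℝ u.1 v.1 with hs
  set ψ : ℝ := Real.arccos s / 2 with hψ
  have hs1 : |s| ≤ 1 := by
    have := abs_real_inner_le_norm u.1 v.1
    rwa [hu, hv, one_mul] at this
  have hcos : s = Real.cos (2 * ψ) := by
    rw [hψ, mul_div_cancel₀ _ two_ne_zero, Real.cos_arccos (abs_le.1 hs1).1 (abs_le.1 hs1).2]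
  have hψ0 : 0 ≤ ψ := div_nonneg (Real.arccos_nonneg _) two_pos.le
  have hψ1 : ψ ≤ Real.pi / 2 := by
    rw [hψ]; gcongr; exact Real.arccos_le_pi _
  have hc : 0 ≤ Real.cos ψ := Real.cos_nonneg_of_neg_pi_div_two_le_of_le
    (by linarith [Real.pi_pos]) hψ1
  have hsn : 0 ≤ Real.sin ψ := Real.sin_nonneg_of_nonneg_of_le_pi hψ0 (by linarith [Real.pi_pos])
  have hadd : ‖u.1 + v.1‖ = 2 * Real.cos ψ := by
    rw [← sq_eq_sq₀ (norm_nonneg _) (by positivity), norm_add_sq_real, hu, hv, ← hs, hcos,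
      Real.cos_two_mul]
    ring
  have hsub : ‖u.1 - v.1‖ = 2 * Real.sin ψ := by
    rw [← sq_eq_sq₀ (norm_nonneg _) (by positivity), norm_sub_sq_real, hu, hv, ← hs, hcos,
      Real.cos_two_mul, mul_pow, Real.sin_sq]
    ring
  have horth : inner ℝ (u.1 + v.1) (u.1 - v.1) = 0 := by
    rw [real_inner_add_sub_eq_zero_iff, hu, hv]
  set f : Fin (k + 2) → EuclideanSpace ℝ (Fin (k + 2)) :=
    fun i => if i = 0 then u.1 + v.1 else if i = 1 then u.1 - v.1 else 0 with hf
  have h10 : (1 : Fin (k + 2)) ≠ 0 := by simp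
  have hf0 : f 0 = u.1 + v.1 := by simp [hf]
  have hf1 : f 1 = u.1 - v.1 := by simp [hf]
  have hfo : Pairwise fun i j => inner ℝ (f i) (f j) = 0 := by
    intro i j hij
    simp only [hf]
    split_ifs with h1 h2 h3 h4 h5 h6 <;> first
      | exact horth
      | (rw [real_inner_comm]; exact horth)
      | exact inner_zero_left _
      | exact inner_zero_right _
      | exact absurd (h1.trans h2.symm) hij
      | exact absurd (h4.trans h6.symm) hij
  have hcard : Module.finrank ℝ (EuclideanSpace ℝ (Fin (k + 2))) = Fintype.card (Fin (k + 2)) := by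
    simp
  set b := InnerProductSpace.gramSchmidtOrthonormalBasis hcard f with hb
  -- This holds trivially where `f i = 0`, which covers `u = v` and `u = -v`.
  have hbf : ∀ i, f i = ‖f i‖ • b i := by
    intro i
    by_cases hi : f i = 0
    · simp [hi]
    · rw [hb, InnerProductSpace.gramSchmidtOrthonormalBasis_apply_of_orthogonal hcard hfo hi,
        smul_smul]
      simp [hi]
  have e0 := hbf 0
  have e1 := hbf 1
  rw [hf0, hadd] at e0
  rw [hf1, hsub] at e1
  refine ⟨b, ?_, ?_⟩
  · have : (2 : ℝ) • u.1 = (2 : ℝ) • (Real.cos ψ • b 0 + Real.sin ψ • b 1) := by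
      rw [smul_add, smul_smul, smul_smul, ← e0, ← e1, two_smul]; abel
    exact smul_right_injective _ (two_ne_zero (α := ℝ)) this
  · have : (2 : ℝ) • v.1 = (2 : ℝ) • (Real.cos ψ • b 0 - Real.sin ψ • b 1) := by
      rw [smul_sub, smul_smul, smul_smul, ← e0, ← e1, two_smul]; abel
    exact smul_right_injective _ (two_ne_zero (α := ℝ)) this

/-- The measure of the intersection of two caps `{t ≤ ⟨u, w⟩}` whose centres make an
angle `2ψ`. -/
noncomputable def twoCaps (k : ℕ) (t ψ : ℝ) : ℝ :=
  Real.pi⁻¹ * ∫ x in ψ..Real.pi / 2, arcDensity (k / 2) t x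

/-- The caps are sections of cones with degree-zero homogeneous indicators, so the Gaussian
computation applies. Of the normalizing `π ^ (k/2 + 1)` one factor `π` remains. -/
theorem uniformSphere_real_two_caps {k : ℕ} {t : ℝ} (ht : 0 ≤ t) (u v : Sphere (k + 2)) :
    (uniformSphere (k + 2)).real {w | t ≤ inner ℝ u.1 w.1 ∧ t ≤ inner ℝ v.1 w.1} =
      twoCaps k t (Real.arccos (inner ℝ u.1 v.1) / 2) := by
  obtain ⟨b, hu, hv⟩ := exists_orthonormalBasis_bisecting u v
  set ψ : ℝ := Real.arccos (inner ℝ u.1 v.1) / 2 with hψ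
  have hψ0 : 0 ≤ ψ := div_nonneg (Real.arccos_nonneg _) two_pos.le
  have hψ1 : ψ ≤ Real.pi / 2 := by
    rw [hψ]; gcongr; exact Real.arccos_le_pi _
  set f : EuclideanSpace ℝ (Fin (k + 2)) → ℝ≥0∞ := fun y =>
    if t * ‖y‖ ≤ inner ℝ u.1 y ∧ t * ‖y‖ ≤ inner ℝ v.1 y then 1 else 0 with hf
  have hfm : Measurable f := by
    refine Measurable.ite ?_ measurable_const measurable_const
    exact measurableSet_le_and_le (by fun_prop) (by fun_prop) (by fun_prop) (by fun_prop)
  have hcone : ∀ r : ℝ, 0 < r → ∀ x, f (r • x) = f x := by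
    intro r hr x
    simp only [hf, norm_smul, Real.norm_eq_abs, abs_of_pos hr, inner_smul_right]
    refine if_congr (and_congr ?_ ?_) rfl rfl
    · rw [mul_left_comm, mul_le_mul_iff_right₀ hr]
    · rw [mul_left_comm, mul_le_mul_iff_right₀ hr]
  have h1 := lintegral_uniformSphere (d := k + 2) (by omega) hfm hcone
  have hset : MeasurableSet {w : Sphere (k + 2) | t ≤ inner ℝ u.1 w.1 ∧ t ≤ inner ℝ v.1 w.1} :=
    measurableSet_le_and_le (by fun_prop) (by fun_prop) (by fun_prop) (by fun_prop)
  have h2 : ∫⁻ x : Sphere (k + 2), f (x : EuclideanSpace ℝ (Fin (k + 2)))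
      ∂(uniformSphere (k + 2)) =
      uniformSphere (k + 2) {w | t ≤ inner ℝ u.1 w.1 ∧ t ≤ inner ℝ v.1 w.1} := by
    rw [← lintegral_indicator_one hset]
    refine lintegral_congr fun x => ?_
    simp only [hf, norm_eq_of_mem_sphere, mul_one, Set.indicator_apply, Pi.one_apply,
      Set.mem_ofPred_eq]
  have h3 : ∫⁻ y, f y * ENNReal.ofReal (Real.exp (-‖y‖ ^ 2)) =
      ENNReal.ofReal (Real.pi ^ (k / 2 : ℝ) *
        ∫ x in ψ..Real.pi / 2, arcDensity (k / 2) t x) := by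
    rw [← lintegral_two_caps ht hψ0 hψ1,
      ← lintegral_orthonormalBasis_split b (F := fun a c N =>
        if t * √N ≤ Real.cos ψ * a + Real.sin ψ * c ∧ t * √N ≤ Real.cos ψ * a - Real.sin ψ * c then
          ENNReal.ofReal (Real.exp (-N)) else 0)]
    · refine lintegral_congr fun y => ?_
      have eu : inner ℝ u.1 y = Real.cos ψ * inner ℝ (b 0) y + Real.sin ψ * inner ℝ (b 1) y := by
        rw [hu, inner_add_left, real_inner_smul_left, real_inner_smul_left]
      have ev : inner ℝ v.1 y = Real.cos ψ * inner ℝ (b 0) y - Real.sin ψ * inner ℝ (b 1) y := by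
        rw [hv, inner_sub_left, real_inner_smul_left, real_inner_smul_left]
      simp only [hf, Real.sqrt_sq (norm_nonneg y), ← eu, ← ev, ite_mul, one_mul, zero_mul]
    · refine Measurable.ite ?_ (by fun_prop) measurable_const
      exact measurableSet_le_and_le (by fun_prop) (by fun_prop) (by fun_prop) (by fun_prop)
  rw [h2, h3] at h1
  have h4 := congrArg ENNReal.toReal h1
  have hnn : 0 ≤ ∫ x in ψ..Real.pi / 2, arcDensity (k / 2) t x :=
    intervalIntegral.integral_nonneg hψ1 fun x _ => arcDensity_nonneg ht x
  rw [ENNReal.toReal_mul, ENNReal.toReal_ofReal (by positivity),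
    ENNReal.toReal_ofReal (by positivity)] at h4
  have hpk : (0 : ℝ) < Real.pi ^ (k / 2 : ℝ) := Real.rpow_pos_of_pos Real.pi_pos _
  rw [show ((k + 2 : ℕ) : ℝ) / 2 = k / 2 + 1 by push_cast; ring, Real.rpow_add Real.pi_pos,
    Real.rpow_one, mul_assoc] at h4
  have h5 := mul_left_cancel₀ hpk.ne' h4
  rw [twoCaps, ← h5, inv_mul_cancel_left₀ Real.pi_pos.ne']
  rfl

theorem uniformSphere_inner_eq_null {k : ℕ} (t : ℝ) (u : Sphere (k + 2)) :
    uniformSphere (k + 2) {w | inner ℝ u.1 w.1 = t} = 0 := by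
  obtain ⟨b, hu, -⟩ := exists_orthonormalBasis_bisecting u u
  have hu1 : inner ℝ u.1 u.1 = (1 : ℝ) := by
    rw [real_inner_self_eq_norm_sq, norm_eq_of_mem_sphere u, one_pow]
  rw [hu1, Real.arccos_one, zero_div, Real.cos_zero, Real.sin_zero, one_smul, zero_smul,
    add_zero] at hu
  set f : EuclideanSpace ℝ (Fin (k + 2)) → ℝ≥0∞ := fun y =>
    if inner ℝ u.1 y = t * ‖y‖ then 1 else 0 with hf
  have hfm : Measurable f := by
    refine Measurable.ite ?_ measurable_const measurable_const
    exact measurableSet_eq_fun (by fun_prop) (by fun_prop)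
  have hcone : ∀ r : ℝ, 0 < r → ∀ x, f (r • x) = f x := by
    intro r hr x
    simp only [hf, norm_smul, Real.norm_eq_abs, abs_of_pos hr, inner_smul_right]
    refine if_congr ?_ rfl rfl
    rw [mul_left_comm, mul_right_inj' hr.ne']
  have h1 := lintegral_uniformSphere (d := k + 2) (by omega) hfm hcone
  have hset : MeasurableSet {w : Sphere (k + 2) | inner ℝ u.1 w.1 = t} :=
    measurableSet_eq_fun (by fun_prop) (by fun_prop)
  have h2 : ∫⁻ x : Sphere (k + 2), f (x : EuclideanSpace ℝ (Fin (k + 2)))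
      ∂(uniformSphere (k + 2)) = uniformSphere (k + 2) {w | inner ℝ u.1 w.1 = t} := by
    rw [← lintegral_indicator_one hset]
    refine lintegral_congr fun x => ?_
    simp only [hf, norm_eq_of_mem_sphere, mul_one, Set.indicator_apply, Pi.one_apply,
      Set.mem_ofPred_eq]
  have h3 : ∫⁻ y, f y * ENNReal.ofReal (Real.exp (-‖y‖ ^ 2)) = 0 := by
    have hFm : Measurable fun x : ℝ × ℝ × ℝ => if x.1 = t * √x.2.2 then
        ENNReal.ofReal (Real.exp (-x.2.2)) else 0 :=
      Measurable.ite (measurableSet_eq_fun (by fun_prop) (by fun_prop)) (by fun_prop)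
        measurable_const
    have hsplit := lintegral_orthonormalBasis_split b (F := fun a _ N =>
        if a = t * √N then ENNReal.ofReal (Real.exp (-N)) else 0) hFm
    have hlhs : ∫⁻ y, f y * ENNReal.ofReal (Real.exp (-‖y‖ ^ 2)) =
        ∫⁻ y, (if inner ℝ (b 0) y = t * √(‖y‖ ^ 2) then
          ENNReal.ofReal (Real.exp (-‖y‖ ^ 2)) else 0) := by
      refine lintegral_congr fun y => ?_
      simp only [hf, Real.sqrt_sq (norm_nonneg y), ← hu, ite_mul, one_mul, zero_mul]
    rw [hlhs, hsplit]
    have hm3 : Measurable fun x : (ℝ × ℝ) × EuclideanSpace ℝ (Fin k) =>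
        (if x.1.1 = t * √(x.1.1 ^ 2 + x.1.2 ^ 2 + ‖x.2‖ ^ 2) then
          ENNReal.ofReal (Real.exp (-(x.1.1 ^ 2 + x.1.2 ^ 2 + ‖x.2‖ ^ 2))) else 0) :=
      hFm.comp (f := fun x : (ℝ × ℝ) × EuclideanSpace ℝ (Fin k) =>
        (x.1.1, x.1.2, x.1.1 ^ 2 + x.1.2 ^ 2 + ‖x.2‖ ^ 2)) (by fun_prop)
    rw [Measure.volume_eq_prod, lintegral_prod _ hm3.lintegral_prod_right'.aemeasurable]
    rw [lintegral_congr_ae (g := fun _ => 0), lintegral_zero]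
    filter_upwards [Measure.ae_ne volume (0 : ℝ)] with a ha
    rw [lintegral_lintegral_swap (f := fun (y : ℝ) (z : EuclideanSpace ℝ (Fin k)) =>
      if a = t * √(a ^ 2 + y ^ 2 + ‖z‖ ^ 2) then
          ENNReal.ofReal (Real.exp (-(a ^ 2 + y ^ 2 + ‖z‖ ^ 2))) else 0)
      (hm3.comp (f := fun x : ℝ × EuclideanSpace ℝ (Fin k) => ((a, x.1), x.2))
        (by fun_prop)).aemeasurable]
    rw [lintegral_congr (g := fun _ => 0), lintegral_zero]
    intro z
    rw [lintegral_congr_ae (g := fun _ => 0), lintegral_zero]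
    -- Solving `a = t √(a² + y² + ‖z‖²)` for `y` gives `y² = c`. For `t = 0` there is no solution,
    -- since `a ≠ 0`.
    set c : ℝ := a ^ 2 / t ^ 2 - a ^ 2 - ‖z‖ ^ 2 with hc
    filter_upwards [Measure.ae_ne volume (√c), Measure.ae_ne volume (-√c)] with y hy1 hy2
    refine if_neg fun h => ?_
    have ht : t ≠ 0 := by
      rintro rfl
      rw [zero_mul] at h
      exact ha h
    have hyc : y ^ 2 = c := by
      have h2 := congrArg (· ^ 2) h
      simp only [mul_pow] at h2
      rw [Real.sq_sqrt (by positivity)] at h2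
      have h3 : a ^ 2 / t ^ 2 = a ^ 2 + y ^ 2 + ‖z‖ ^ 2 := by
        rw [div_eq_iff (by positivity)]; linarith
      rw [hc, h3]
      ring
    have : |y| = √c := by rw [← hyc, Real.sqrt_sq_eq_abs]
    rcases abs_choice y with h' | h' <;> rw [h'] at this
    · exact hy1 this
    · exact hy2 (by linarith)
  rw [h2, h3] at h1
  refine (mul_eq_zero.1 h1).resolve_left ?_
  rw [ENNReal.ofReal_eq_zero, not_le]
  exact Real.rpow_pos_of_pos Real.pi_pos _

end RandomGeometric

/-! ### The law of an inner product, and the threshold -/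

namespace RandomGeometric

open scoped ENNReal

section InnerLaw

variable {k : ℕ}

instance : IsProbabilityMeasure (uniformSphere (k + 2)) :=
  isProbabilityMeasure_uniformSphere (by omega)

/-- The law of the first coordinate of a uniform point of the sphere. -/
noncomputable def innerLaw (k : ℕ) : Measure ℝ :=
  (uniformSphere (k + 2)).map fun w => inner ℝ (EuclideanSpace.single (0 : Fin (k + 2)) (1 : ℝ)) w.1

theorem measurable_inner_left (u : EuclideanSpace ℝ (Fin (k + 2))) :
    Measurable fun w : Sphere (k + 2) => inner ℝ u w.1 := by fun_prop

instance : IsProbabilityMeasure (innerLaw k) :=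
  Measure.isProbabilityMeasure_map (measurable_inner_left _).aemeasurable

theorem abs_inner_le_one (u v : Sphere (k + 2)) : |inner ℝ u.1 v.1| ≤ 1 := by
  have := abs_real_inner_le_norm u.1 v.1
  rwa [norm_eq_of_mem_sphere u, norm_eq_of_mem_sphere v, one_mul] at this

theorem inner_self_sphere (u : Sphere (k + 2)) : inner ℝ u.1 u.1 = (1 : ℝ) := by
  rw [real_inner_self_eq_norm_sq, norm_eq_of_mem_sphere u, one_pow]

theorem uniformSphere_real_cap {t : ℝ} (ht : 0 ≤ t) (u : Sphere (k + 2)) :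
    (uniformSphere (k + 2)).real {w | t ≤ inner ℝ u.1 w.1} = twoCaps k t 0 := by
  have := uniformSphere_real_two_caps ht u u
  rw [inner_self_sphere, Real.arccos_one, zero_div] at this
  simpa using this

/-- Opposite caps are complementary up to their null common boundary. This is what reduces negative
heights to nonnegative ones. -/
theorem ae_le_inner_neg_iff (t : ℝ) (u : Sphere (k + 2)) :
    ∀ᵐ w ∂(uniformSphere (k + 2)), (t ≤ inner ℝ (-u).1 w.1 ↔ ¬ (-t ≤ inner ℝ u.1 w.1)) := by
  have h0 := uniformSphere_inner_eq_null (-t) u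
  have : ∀ᵐ w ∂(uniformSphere (k + 2)), inner ℝ u.1 w.1 ≠ -t := by
    rw [ae_iff]; simpa using h0
  filter_upwards [this] with w hw
  have e : inner ℝ (-u).1 w.1 = -inner ℝ u.1 w.1 := by
    rw [show (-u).1 = -u.1 from rfl, inner_neg_left]
  rw [e, not_le]
  constructor
  · intro h
    exact lt_of_le_of_ne (by linarith) hw
  · intro h; linarith

theorem uniformSphere_real_cap_neg (t : ℝ) (u : Sphere (k + 2)) :
    (uniformSphere (k + 2)).real {w | -t ≤ inner ℝ u.1 w.1} =
      1 - (uniformSphere (k + 2)).real {w | t ≤ inner ℝ (-u).1 w.1} := by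
  have hm : MeasurableSet {w : Sphere (k + 2) | -t ≤ inner ℝ u.1 w.1} :=
    measurableSet_le measurable_const (measurable_inner_left _)
  have h := probReal_compl_eq_one_sub (μ := uniformSphere (k + 2)) hm
  have h2 : (uniformSphere (k + 2)).real {w | t ≤ inner ℝ (-u).1 w.1} =
      (uniformSphere (k + 2)).real {w | -t ≤ inner ℝ u.1 w.1}ᶜ := by
    refine measureReal_congr ?_
    filter_upwards [ae_le_inner_neg_iff t u] with w hw
    exact propext hw
  rw [h2, h]
  ring

/-- The needed rotation invariance is read off from the explicit cap formula, which does not mention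
the centre. -/
theorem uniformSphere_real_cap_eq (t : ℝ) (u v : Sphere (k + 2)) :
    (uniformSphere (k + 2)).real {w | t ≤ inner ℝ u.1 w.1} =
      (uniformSphere (k + 2)).real {w | t ≤ inner ℝ v.1 w.1} := by
  rcases le_total 0 t with ht | ht
  · rw [uniformSphere_real_cap ht, uniformSphere_real_cap ht]
  · have h : 0 ≤ -t := by linarith
    have hu := uniformSphere_real_cap_neg (-t) u
    have hv := uniformSphere_real_cap_neg (-t) v
    rw [neg_neg, uniformSphere_real_cap h] at hu hv
    rw [hu, hv]

/-- The first coordinate vector as a point of the sphere. -/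
noncomputable def northPole (k : ℕ) : Sphere (k + 2) :=
  ⟨EuclideanSpace.single (0 : Fin (k + 2)) (1 : ℝ), by simp⟩

theorem map_inner_uniformSphere (u : Sphere (k + 2)) :
    (uniformSphere (k + 2)).map (fun w => inner ℝ u.1 w.1) = innerLaw k := by
  have : IsProbabilityMeasure ((uniformSphere (k + 2)).map fun w => inner ℝ u.1 w.1) :=
    Measure.isProbabilityMeasure_map (measurable_inner_left _).aemeasurable
  refine Measure.ext_of_Ici _ _ fun t => ?_
  rw [innerLaw, Measure.map_apply (measurable_inner_left _) measurableSet_Ici,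
    Measure.map_apply (measurable_inner_left _) measurableSet_Ici]
  exact (measureReal_eq_measureReal_iff).1 (uniformSphere_real_cap_eq t u (northPole k))

theorem innerLaw_real_Ici_eq (t : ℝ) (u : Sphere (k + 2)) :
    (innerLaw k).real (Set.Ici t) = (uniformSphere (k + 2)).real {w | t ≤ inner ℝ u.1 w.1} := by
  rw [← map_inner_uniformSphere u, map_measureReal_apply (measurable_inner_left _)
    measurableSet_Ici]
  rfl

theorem innerLaw_real_Ici {t : ℝ} (ht : 0 ≤ t) :
    (innerLaw k).real (Set.Ici t) = twoCaps k t 0 := by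
  rw [innerLaw_real_Ici_eq t (northPole k), uniformSphere_real_cap ht]

theorem innerLaw_real_Ici_neg (t : ℝ) :
    (innerLaw k).real (Set.Ici (-t)) = 1 - (innerLaw k).real (Set.Ici t) := by
  rw [innerLaw_real_Ici_eq (-t) (northPole k), uniformSphere_real_cap_neg,
    innerLaw_real_Ici_eq t (-northPole k)]

instance : NullSingletonClass (innerLaw k) := ⟨fun t => by
  rw [← map_inner_uniformSphere (northPole k), Measure.map_apply (measurable_inner_left _)
    (measurableSet_singleton _)]
  exact uniformSphere_inner_eq_null t _⟩

theorem integral_innerLaw (u : Sphere (k + 2)) {f : ℝ → ℝ} (hf : Measurable f) :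
    ∫ w, f (inner ℝ u.1 w.1) ∂(uniformSphere (k + 2)) = ∫ s, f s ∂(innerLaw k) := by
  rw [← map_inner_uniformSphere u, integral_map (measurable_inner_left _).aemeasurable
    hf.aestronglyMeasurable]

theorem ae_innerLaw_mem_Icc : ∀ᵐ s ∂(innerLaw k), s ∈ Set.Icc (-1 : ℝ) 1 := by
  rw [← map_inner_uniformSphere (northPole k),
    ae_map_iff (p := fun s => s ∈ Set.Icc (-1 : ℝ) 1) (measurable_inner_left _).aemeasurable
      measurableSet_Icc]
  exact .of_forall fun w => Set.mem_Icc.2 (abs_le.1 (abs_inner_le_one _ _))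

/-- The squares of the `k + 2` coordinates sum to one and have equal means. -/
theorem integral_sq_innerLaw : ∫ s, s ^ 2 ∂(innerLaw k) = 1 / ((k : ℝ) + 2) := by
  have hpt : ∀ w : Sphere (k + 2), ∑ i : Fin (k + 2),
      (inner ℝ (EuclideanSpace.single i (1 : ℝ)) w.1) ^ 2 = 1 := by
    intro w
    have := norm_eq_of_mem_sphere w
    rw [← sq_eq_sq₀ (norm_nonneg _) zero_le_one, EuclideanSpace.norm_sq_eq] at this
    simpa [EuclideanSpace.inner_single_left] using this
  have h1 : ∫ w, ∑ i : Fin (k + 2), (inner ℝ (EuclideanSpace.single i (1 : ℝ)) w.1) ^ 2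
      ∂(uniformSphere (k + 2)) = 1 := by simp [hpt]
  have hi : ∀ i : Fin (k + 2), ∫ w, (inner ℝ (EuclideanSpace.single i (1 : ℝ)) w.1) ^ 2
      ∂(uniformSphere (k + 2)) = ∫ s, s ^ 2 ∂(innerLaw k) := fun i =>
    integral_innerLaw (⟨EuclideanSpace.single i (1 : ℝ), by simp⟩ : Sphere (k + 2))
      (f := fun s => s ^ 2) (by fun_prop)
  rw [integral_finsetSum] at h1
  · simp only [hi, Finset.sum_const, Finset.card_univ, Fintype.card_fin, nsmul_eq_mul] at h1
    push_cast at h1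
    field_simp
    linarith
  · intro i _
    refine integrable_of_abs_le_one (by fun_prop) fun w => ?_
    rw [abs_pow]
    exact pow_le_one₀ (abs_nonneg _)
      (abs_inner_le_one (⟨EuclideanSpace.single i (1 : ℝ), by simp⟩ : Sphere (k + 2)) w)

theorem capProb_eq (t : ℝ) : capProb (k + 2) t = (innerLaw k).real (Set.Ici t) := by
  have hm : MeasurableSet {x : Sphere (k + 2) × Sphere (k + 2) |
      t ≤ inner ℝ (x.1 : EuclideanSpace ℝ (Fin (k + 2))) (x.2 : EuclideanSpace ℝ (Fin (k + 2)))} :=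
    measurableSet_le measurable_const (by fun_prop)
  rw [capProb, measureReal_def, Measure.prod_apply hm]
  have : ∀ u : Sphere (k + 2), uniformSphere (k + 2) (Prod.mk u ⁻¹' {x | t ≤ inner ℝ
      (x.1 : EuclideanSpace ℝ (Fin (k + 2))) (x.2 : EuclideanSpace ℝ (Fin (k + 2)))}) =
      innerLaw k (Set.Ici t) := by
    intro u
    rw [← map_inner_uniformSphere u, Measure.map_apply (measurable_inner_left _) measurableSet_Ici]
    rfl
  rw [lintegral_congr this]
  simp [measureReal_def]

theorem continuous_innerLaw_real_Ici : Continuous fun t => (innerLaw k).real (Set.Ici t) := by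
  have h1 : ∀ t, (innerLaw k).real (Set.Ici t) = 1 - cdf (innerLaw k) t := by
    intro t
    rw [cdf_eq_real, ← measureReal_congr (Iio_ae_eq_Iic (μ := innerLaw k) (a := t)),
      ← Set.compl_Iio, probReal_compl_eq_one_sub measurableSet_Iio]
  simp_rw [h1]
  refine continuous_const.sub (continuous_iff_continuousAt.2 fun t => ?_)
  rw [(monotone_cdf _).continuousAt_iff_leftLim_eq_rightLim, StieltjesFunction.rightLim_eq]
  have h2 := (cdf (innerLaw k)).measure_singleton t
  rw [measure_cdf, measure_singleton, eq_comm, ENNReal.ofReal_eq_zero] at h2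
  exact le_antisymm ((monotone_cdf _).leftLim_le le_rfl) (by linarith)

theorem innerLaw_real_Ici_one : (innerLaw k).real (Set.Ici 1) = 0 := by
  have : innerLaw k (Set.Ici 1) = 0 := by
    have h := ae_innerLaw_mem_Icc (k := k)
    refine measure_mono_null (t := (Set.Icc (-1 : ℝ) 1)ᶜ ∪ {1}) ?_ ?_
    · intro s hs
      by_cases h1 : s = 1
      · right; exact h1
      · left
        intro hc
        exact h1 (le_antisymm hc.2 hs)
    · rw [measure_union_null_iff]
      exact ⟨h, measure_singleton _⟩
  simp [measureReal_def, this]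

/-- The supremum is attained by compactness, so its cap probability is at least `p`. The
intermediate value theorem gives a point with probability exactly `p`, which lies below the
supremum, and monotonicity gives the other inequality. -/
theorem threshold_spec {p : ℝ} (hp0 : 0 ≤ p) (hp1 : p ≤ 1) :
    threshold (k + 2) p ∈ Set.Icc (-1 : ℝ) 1 ∧
      (0 < p → (innerLaw k).real (Set.Ici (threshold (k + 2) p)) = p) := by
  set P : ℝ → ℝ := fun t => (innerLaw k).real (Set.Ici t) with hP
  have hcont : Continuous P := continuous_innerLaw_real_Ici
  have hanti : Antitone P := fun a b hab => measureReal_mono (Set.Ici_subset_Ici.2 hab)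
  have h1 : P 1 = 0 := innerLaw_real_Ici_one
  have hm1 : P (-1) = 1 := by
    change (innerLaw k).real (Set.Ici (-1)) = 1
    rw [innerLaw_real_Ici_neg, innerLaw_real_Ici_one, sub_zero]
  set A : Set ℝ := {t | t ∈ Set.Icc (-1 : ℝ) 1 ∧ p ≤ capProb (k + 2) t} with hA
  have hAeq : A = Set.Icc (-1 : ℝ) 1 ∩ P ⁻¹' Set.Ici p := by
    ext t; simp [hA, hP, capProb_eq]
  have hcomp : IsCompact A := by
    rw [hAeq]; exact isCompact_Icc.inter_right (isClosed_Ici.preimage hcont)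
  have hne : A.Nonempty := ⟨-1, by rw [hAeq]; exact ⟨by simp, by simpa [hm1] using hp1⟩⟩
  have hmem : sSup A ∈ A := hcomp.sSup_mem hne
  have hthr : threshold (k + 2) p = sSup A := rfl
  rw [hthr]
  refine ⟨hmem.1, fun hp => le_antisymm ?_ ?_⟩
  · obtain ⟨t, ht, hPt⟩ : p ∈ P '' Set.Icc (-1) 1 :=
      intermediate_value_Icc' (by norm_num) hcont.continuousOn (by rw [h1, hm1]; exact ⟨hp0, hp1⟩)
    have htA : t ∈ A := by rw [hAeq]; exact ⟨ht, hPt.ge⟩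
    exact (hanti (le_csSup hcomp.bddAbove htA)).trans hPt.le
  · rw [hAeq] at hmem ⊢
    exact hmem.2

end InnerLaw

end RandomGeometric

/-! ### The cap kernel, and the signed triangle count of the geometric graph -/

namespace RandomGeometric

/-- The centred indicator of `τ ≤ s`. -/
noncomputable def centredStep (τ p s : ℝ) : ℝ := (if τ ≤ s then 1 else 0) - p

/-- The covariance of the indicators of two caps `{t ≤ ⟨·, w⟩}` whose centres have
inner product `s`. -/
noncomputable def overlap (k : ℕ) (t s : ℝ) : ℝ :=
  twoCaps k t (Real.arccos s / 2) - twoCaps k t 0 ^ 2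

theorem continuous_twoCaps {k : ℕ} {t : ℝ} (ht : 0 ≤ t) : Continuous (twoCaps k t) := by
  have h := intervalIntegral.continuous_primitive
    (intervalIntegrable_arcDensity (m := k / 2) (by positivity) ht) (Real.pi / 2)
  have h2 : twoCaps k t = fun ψ => Real.pi⁻¹ * -∫ x in Real.pi / 2..ψ, arcDensity (k / 2) t x := by
    ext ψ
    rw [twoCaps, intervalIntegral.integral_symm]
  rw [h2]
  exact continuous_const.mul h.neg

theorem continuous_overlap {k : ℕ} {t : ℝ} (ht : 0 ≤ t) : Continuous (overlap k t) :=
  ((continuous_twoCaps ht).comp (Real.continuous_arccos.div_const 2)).sub continuous_const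

theorem measurable_centredStep (τ p : ℝ) : Measurable (centredStep τ p) :=
  (Measurable.ite measurableSet_Ici measurable_const measurable_const).sub_const p

theorem abs_centredStep_le {τ p : ℝ} (hp0 : 0 ≤ p) (hp1 : p ≤ 1) (s : ℝ) :
    |centredStep τ p s| ≤ 1 := by
  unfold centredStep
  split_ifs <;> rw [abs_le] <;> constructor <;> linarith

theorem centredStep_sq (τ p s : ℝ) :
    centredStep τ p s ^ 2 = (1 - 2 * p) * centredStep τ p s + p * (1 - p) := by
  unfold centredStep
  split_ifs <;> ring

/-- The centred edge indicator of the random geometric graph, as a kernel on the sphere. -/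
noncomputable def capKernel {k : ℕ} (τ p : ℝ) (u v : Sphere (k + 2)) : ℝ :=
  centredStep τ p (inner ℝ u.1 v.1)

variable {k : ℕ}

theorem measurable_capKernel (τ p : ℝ) :
    Measurable fun x : Sphere (k + 2) × Sphere (k + 2) => capKernel τ p x.1 x.2 :=
  (measurable_centredStep τ p).comp
    (f := fun x : Sphere (k + 2) × Sphere (k + 2) => (inner ℝ x.1.1 x.2.1 : ℝ)) (by fun_prop)

theorem integral_step_innerLaw (τ : ℝ) :
    ∫ s, (if τ ≤ s then 1 else 0 : ℝ) ∂(innerLaw k) = (innerLaw k).real (Set.Ici τ) := by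
  rw [← integral_indicator_one measurableSet_Ici]
  rfl

theorem integral_centredStep {τ p : ℝ} (hτ : (innerLaw k).real (Set.Ici τ) = p) :
    ∫ s, centredStep τ p s ∂(innerLaw k) = 0 := by
  have hi : Integrable (fun s : ℝ => (if τ ≤ s then 1 else 0 : ℝ)) (innerLaw k) :=
    integrable_of_abs_le_one (Measurable.ite measurableSet_Ici measurable_const measurable_const)
      fun s => by split_ifs <;> simp
  unfold centredStep
  rw [integral_sub hi (integrable_const p), integral_step_innerLaw, hτ]
  simp

theorem isCentredKernel_capKernel {τ p : ℝ} (hτ : (innerLaw k).real (Set.Ici τ) = p) :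
    IsCentredKernel (uniformSphere (k + 2)) (capKernel τ p) where
  symm u v := by unfold capKernel; rw [real_inner_comm]
  measurable := measurable_capKernel τ p
  abs_le u v := abs_centredStep_le (hτ ▸ measureReal_nonneg) (hτ ▸ measureReal_le_one) _
  integral_eq_zero u := by
    unfold capKernel
    rw [integral_innerLaw u (measurable_centredStep τ p), integral_centredStep hτ]

theorem kernelSq_capKernel_of_nonneg {t p : ℝ} (ht : 0 ≤ t) (hp : twoCaps k t 0 = p)
    (u v : Sphere (k + 2)) :
    kernelSq (uniformSphere (k + 2)) (capKernel t p) u v = overlap k t (inner ℝ u.1 v.1) := by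
  set A : Set (Sphere (k + 2)) := {w | t ≤ inner ℝ u.1 w.1 ∧ t ≤ inner ℝ v.1 w.1} with hA
  have hmA : MeasurableSet A :=
    measurableSet_le_and_le measurable_const (measurable_inner_left _) measurable_const
      (measurable_inner_left _)
  have hκ := isCentredKernel_capKernel (k := k) (τ := t) (p := p) (by rw [innerLaw_real_Ici ht, hp])
  have hpt : ∀ w, capKernel t p u w * capKernel t p v w =
      1 * A.indicator (fun _ => (1 : ℝ)) w + (-p * capKernel t p u w +
        (-p * capKernel t p v w + -p ^ 2)) := by
    intro w
    simp only [hA, Set.indicator_apply, Set.mem_ofPred_eq, capKernel, centredStep]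
    by_cases h1 : t ≤ inner ℝ u.1 w.1 <;> by_cases h2 : t ≤ inner ℝ v.1 w.1 <;>
      simp only [h1, h2, and_self, and_true, and_false, if_true, if_false] <;> ring
  rw [kernelSq, integral_congr_ae (.of_forall hpt), integral_linear_combination
    ((integrable_const _).indicator hmA) (hκ.integrable_left u) (hκ.integrable_left v),
    hκ.integral_eq_zero, hκ.integral_eq_zero, integral_indicator_const _ hmA,
    uniformSphere_real_two_caps ht u v, overlap, hp]
  simp
  ring

/-- For `τ ≤ 0`, replacing both centres by their antipodes and `p` by `1 - p` changes the sign of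
both centred indicators almost everywhere. Their product and the inner product of the centres are
unchanged. -/
theorem kernelSq_capKernel {τ p : ℝ} (hτ : (innerLaw k).real (Set.Ici τ) = p)
    (u v : Sphere (k + 2)) :
    kernelSq (uniformSphere (k + 2)) (capKernel τ p) u v = overlap k |τ| (inner ℝ u.1 v.1) := by
  rcases le_total 0 τ with h | h
  · rw [abs_of_nonneg h]
    exact kernelSq_capKernel_of_nonneg h (by rw [← innerLaw_real_Ici h, hτ]) u v
  · have h' : 0 ≤ -τ := by linarith
    have hq : twoCaps k (-τ) 0 = 1 - p := by
      rw [← innerLaw_real_Ici h', innerLaw_real_Ici_neg, hτ]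
    have hinner : inner ℝ (-u).1 (-v).1 = inner ℝ u.1 v.1 := by
      rw [show (-u).1 = -u.1 from rfl, show (-v).1 = -v.1 from rfl, inner_neg_neg]
    rw [abs_of_nonpos h, ← hinner, ← kernelSq_capKernel_of_nonneg h' hq, kernelSq, kernelSq]
    refine integral_congr_ae ?_
    have hu := ae_le_inner_neg_iff (-τ) u
    have hv := ae_le_inner_neg_iff (-τ) v
    rw [neg_neg] at hu hv
    filter_upwards [hu, hv] with w hu hv
    simp only [capKernel, centredStep, hu, hv]
    by_cases h1 : τ ≤ inner ℝ u.1 w.1 <;> by_cases h2 : τ ≤ inner ℝ v.1 w.1 <;>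
      simp only [h1, h2, if_true, if_false, not_true, not_false_eq_true] <;> ring

theorem integral_overlap {τ p : ℝ} (hτ : (innerLaw k).real (Set.Ici τ) = p) :
    ∫ s, overlap k |τ| s ∂(innerLaw k) = 0 := by
  rw [← integral_innerLaw (northPole k) (continuous_overlap (abs_nonneg τ)).measurable,
    ← (isCentredKernel_capKernel hτ).integral_kernelSq (northPole k)]
  simp only [kernelSq_capKernel hτ]

/-- The mean of the signed indicator of one triangle of the random geometric graph. -/
noncomputable def triangleMean (k : ℕ) (τ p : ℝ) : ℝ :=
  ∫ s, centredStep τ p s * overlap k |τ| s ∂(innerLaw k)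

/-- The second moment of the conditional mean of a signed triangle, given two of its vertices. -/
noncomputable def wedgeMoment (k : ℕ) (τ p : ℝ) : ℝ :=
  ∫ s, (centredStep τ p s * overlap k |τ| s) ^ 2 ∂(innerLaw k)

theorem signedTriangles_geometricGraph {n : ℕ} (τ p : ℝ) (v : Fin n → Sphere (k + 2))
    (hsymm : ∀ u v : Sphere (k + 2), capKernel τ p u v = capKernel τ p v u) :
    signedTriangles p (geometricGraph τ v) =
      ∑ S ∈ Finset.powersetCard 3 (Finset.univ : Finset (Fin n)),
        cliqueWeight (kernelWeight hsymm v) S := by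
  rw [signedTriangles_eq_sum]
  refine Finset.sum_congr rfl fun S _ => cliqueWeight_congr fun a _ b _ hab => ?_
  rw [signedEdge_mk, kernelWeight_mk, capKernel, centredStep, edgeInd]
  congr 1
  simp [geometricGraph, hab]

variable {n : ℕ} {p : ℝ} (hp0 : 0 < p) (hp1 : p < 1)

include hp0 hp1

theorem integral_signedTriangles_geo :
    ∫ G, signedTriangles p G ∂(geo (k + 2) n p) =
      n.choose 3 * triangleMean k (threshold (k + 2) p) p := by
  have hτ := (threshold_spec (k := k) hp0.le hp1.le).2 hp0
  have hκ := isCentredKernel_capKernel hτ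
  rw [geo, integral_map (measurable_geometricGraph _).aemeasurable
    Measurable.of_discrete.aestronglyMeasurable]
  simp_rw [signedTriangles_geometricGraph _ _ _ hκ.symm]
  refine hκ.integral_sum_cliqueWeight fun u => ?_
  simp only [kernelSq_capKernel hτ]
  exact integral_innerLaw u ((measurable_centredStep _ p).mul
    (continuous_overlap (abs_nonneg _)).measurable)

theorem variance_signedTriangles_geo_le :
    variance (signedTriangles p) (geo (k + 2) n p) ≤ n.choose 3 *
      ((1 - 2 * p) ^ 3 * triangleMean k (threshold (k + 2) p) p + (p * (1 - p)) ^ 3 +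
        3 * n * wedgeMoment k (threshold (k + 2) p) p) := by
  have hτ := (threshold_spec (k := k) hp0.le hp1.le).2 hp0
  have hκ := isCentredKernel_capKernel hτ
  rw [geo, variance_map Measurable.of_discrete.aemeasurable
    (measurable_geometricGraph _).aemeasurable]
  have hfun : signedTriangles p ∘ geometricGraph (threshold (k + 2) p) =
      fun v : Fin n → Sphere (k + 2) =>
        ∑ S ∈ Finset.powersetCard 3 (Finset.univ : Finset (Fin n)),
          cliqueWeight (kernelWeight hκ.symm v) S := by
    ext v
    exact signedTriangles_geometricGraph _ _ v hκ.symm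
  rw [hfun]
  have hm := (measurable_centredStep (threshold (k + 2) p) p).mul
    (continuous_overlap (k := k) (abs_nonneg (threshold (k + 2) p))).measurable
  refine hκ.variance_sum_cliqueWeight_le (fun u => ?_) (fun u v => centredStep_sq _ _ _)
    (fun u => ?_) (integral_nonneg fun s => sq_nonneg _)
  · simp only [kernelSq_capKernel hτ]
    exact integral_innerLaw u hm
  · simp only [kernelSq_capKernel hτ]
    exact integral_innerLaw u (hm.pow_const 2)

end RandomGeometric

/-! ### Correlation of a centred step with an increasing function -/

namespace RandomGeometric

section Monotone

variable {ν : Measure ℝ} [IsProbabilityMeasure ν] {h : ℝ → ℝ} {τ p : ℝ}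

theorem integrable_centredStep_mul (hp0 : 0 ≤ p) (hp1 : p ≤ 1) (hi : Integrable h ν) :
    Integrable (fun s => centredStep τ p s * h s) ν :=
  hi.bdd_mul (c := 1) (measurable_centredStep τ p).aestronglyMeasurable
    (.of_forall fun s => abs_centredStep_le hp0 hp1 s)

theorem integrable_centredStep (hp0 : 0 ≤ p) (hp1 : p ≤ 1) : Integrable (centredStep τ p) ν :=
  integrable_of_abs_le_one (measurable_centredStep τ p) (abs_centredStep_le hp0 hp1)

theorem integral_centredStep_mul_sub (hp0 : 0 ≤ p) (hp1 : p ≤ 1) (hi : Integrable h ν)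
    (hk : ∫ s, centredStep τ p s ∂ν = 0) (c : ℝ) :
    ∫ s, centredStep τ p s * h s ∂ν = ∫ s, centredStep τ p s * (h s - c) ∂ν := by
  simp_rw [mul_sub]
  rw [integral_sub (integrable_centredStep_mul hp0 hp1 hi)
    ((integrable_centredStep hp0 hp1).mul_const c), integral_mul_const, hk]
  ring

/-- Since the step has mean zero, `h` may be replaced by `h - h τ`, which has the same sign as the
step. The integrand is then nonnegative, and only the tails beyond `a` and `b` are kept. -/
theorem integral_centredStep_mul_ge (hp0 : 0 ≤ p) (hp1 : p ≤ 1) (hi : Integrable h ν)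
    (hk : ∫ s, centredStep τ p s ∂ν = 0) (hh : Monotone h) {a b : ℝ} (ha : a ≤ τ) (hb : τ ≤ b) :
    (1 - p) * ν.real (Set.Ici b) * (h b - h τ) + p * ν.real (Set.Iic a) * (h τ - h a) ≤
      ∫ s, centredStep τ p s * h s ∂ν := by
  rw [integral_centredStep_mul_sub hp0 hp1 hi hk (h τ)]
  have h1 : (1 - p) * ν.real (Set.Ici b) * (h b - h τ) + p * ν.real (Set.Iic a) * (h τ - h a) =
      ∫ s, ((Set.Ici b).indicator (fun _ => (1 - p) * (h b - h τ)) s +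
        (Set.Iic a).indicator (fun _ => p * (h τ - h a)) s) ∂ν := by
    rw [integral_add ((integrable_const _).indicator measurableSet_Ici)
      ((integrable_const _).indicator measurableSet_Iic),
      integral_indicator_const _ measurableSet_Ici, integral_indicator_const _ measurableSet_Iic]
    simp only [smul_eq_mul]
    ring
  rw [h1]
  refine integral_mono (((integrable_const _).indicator measurableSet_Ici).add
    ((integrable_const _).indicator measurableSet_Iic)) ?_ fun s => ?_
  · exact integrable_centredStep_mul hp0 hp1 (hi.sub (integrable_const (h τ)))
  · simp only [Set.indicator_apply, Set.mem_Ici, Set.mem_Iic, centredStep]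
    have hbτ := hh hb
    have haτ := hh ha
    by_cases hs : τ ≤ s
    · have hsτ := hh hs
      rw [if_pos hs]
      have e2 : (if s ≤ a then p * (h τ - h a) else 0) = 0 := by
        split_ifs with hsa
        · rw [le_antisymm ha (hs.trans hsa), sub_self, mul_zero]
        · rfl
      rw [e2, add_zero]
      split_ifs with hbs
      · have := hh hbs
        exact mul_le_mul_of_nonneg_left (by linarith) (by linarith)
      · exact mul_nonneg (by linarith) (by linarith)
    · have hsτ := hh (not_le.1 hs).le
      rw [if_neg hs, if_neg (by intro hbs; exact hs (hb.trans hbs)), zero_add]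
      split_ifs with hsa
      · have := hh hsa
        nlinarith
      · nlinarith

theorem integral_centredStep_mul_nonneg (hp0 : 0 ≤ p) (hp1 : p ≤ 1) (hi : Integrable h ν)
    (hk : ∫ s, centredStep τ p s ∂ν = 0) (hh : Monotone h) :
    0 ≤ ∫ s, centredStep τ p s * h s ∂ν := by
  simpa using integral_centredStep_mul_ge hp0 hp1 hi hk hh le_rfl le_rfl

/-- A second moment bound for a monotone function with mean zero, weighted by a step. -/
theorem integral_sq_centredStep_mul_le (hp0 : 0 ≤ p) (hp1 : p < 1) (hm : Measurable h)
    (hb : ∀ s, |h s| ≤ p) (hτ : ν.real (Set.Ici τ) = p) (h0 : ∫ s, h s ∂ν = 0)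
    (hh : Monotone h) :
    ∫ s, (centredStep τ p s * h s) ^ 2 ∂ν ≤
      2 * p / (1 - p) * ∫ s, centredStep τ p s * h s ∂ν + p ^ 2 * ∫ s, h s ^ 2 ∂ν := by
  have hb1 : ∀ s, |h s| ≤ 1 := fun s => (hb s).trans hp1.le
  have hi : Integrable h ν := integrable_of_abs_le_one hm hb1
  have hi2 : Integrable (fun s => h s ^ 2) ν :=
    integrable_of_abs_le_one (hm.pow_const 2) fun s => by
      rw [abs_pow]; exact pow_le_one₀ (abs_nonneg _) (hb1 s)
  set H : ℝ → ℝ := (Set.Ici τ).indicator h with hH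
  have hHi : Integrable H ν := hi.indicator measurableSet_Ici
  have hΔ : ∫ s, centredStep τ p s * h s ∂ν = ∫ s, H s ∂ν := by
    have : ∀ s, centredStep τ p s * h s = H s - p * h s := by
      intro s
      simp only [hH, centredStep, Set.indicator_apply, Set.mem_Ici]
      split_ifs <;> ring
    simp_rw [this]
    rw [integral_sub hHi (hi.const_mul p), integral_const_mul, h0]
    ring
  set Δ := ∫ s, H s ∂ν with hΔdef
  -- As `h` has mean zero, `Δ` is minus the integral of `h` below `τ`, where `h ≤ h τ`. So `h τ`
  -- cannot be very negative unless `Δ` is large.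
  have hneg : (1 - p) * (-h τ) ≤ Δ := by
    have h1 : Δ = -∫ s, (Set.Iio τ).indicator h s ∂ν := by
      have : ∫ s, (H s + (Set.Iio τ).indicator h s) ∂ν = 0 := by
        rw [← h0]
        refine integral_congr_ae (.of_forall fun s => ?_)
        simp only [hH, Set.indicator_apply, Set.mem_Ici, Set.mem_Iio]
        by_cases hs : τ ≤ s
        · simp [hs, not_lt.2 hs]
        · simp [hs, not_le.1 hs]
      rw [integral_add hHi (hi.indicator measurableSet_Iio)] at this
      linarith
    have h2 : ∫ s, (Set.Iio τ).indicator h s ∂ν ≤ ∫ s, (Set.Iio τ).indicator (fun _ => h τ) s ∂ν := by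
      refine integral_mono (hi.indicator measurableSet_Iio)
        ((integrable_const _).indicator measurableSet_Iio) fun s => ?_
      by_cases hs : s < τ
      · simpa [Set.indicator_apply, hs] using hh hs.le
      · simp [hs]
    have h3 : ν.real (Set.Iio τ) = 1 - p := by
      rw [← Set.compl_Ici, probReal_compl_eq_one_sub measurableSet_Ici, hτ]
    rw [integral_indicator_const _ measurableSet_Iio, h3, smul_eq_mul] at h2
    rw [h1]
    linarith
  have hk : ∫ s, centredStep τ p s ∂ν = 0 := by
    have hstep : Integrable (fun s : ℝ => (if τ ≤ s then 1 else 0 : ℝ)) ν :=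
      integrable_of_abs_le_one (Measurable.ite measurableSet_Ici measurable_const
        measurable_const) fun s => by split_ifs <;> simp
    have : ∫ s, (if τ ≤ s then 1 else 0 : ℝ) ∂ν = p := by
      rw [← hτ, ← integral_indicator_one measurableSet_Ici]
      rfl
    unfold centredStep
    rw [integral_sub hstep (integrable_const p), this]
    simp
  have hΔ0 : 0 ≤ Δ := hΔ ▸ integral_centredStep_mul_nonneg hp0 hp1.le hi hk hh
  set N : ℝ := max 0 (-h τ) with hN
  have hN1 : (1 - p) * N ≤ Δ := by
    rcases max_cases (0 : ℝ) (-h τ) with ⟨h, _⟩ | ⟨h, _⟩ <;> rw [hN, h]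
    · simpa using hΔ0
    · exact hneg
  -- Above `τ`, `-N ≤ h` gives `|h| ≤ h + 2N`, and `|h| ≤ p` gives `h² ≤ p(h + 2N)`. Below `τ` the
  -- step equals `-p`.
  have hpt : ∀ s, (centredStep τ p s * h s) ^ 2 ≤
      p * H s + (2 * p * N * (Set.Ici τ).indicator (fun _ => (1 : ℝ)) s + p ^ 2 * h s ^ 2) := by
    intro s
    simp only [hH, centredStep, Set.indicator_apply, Set.mem_Ici]
    by_cases hs : τ ≤ s
    · simp only [hs, if_true]
      have h1 := hh hs
      have h2 : -h τ ≤ N := le_max_right _ _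
      have h3 : 0 ≤ N := le_max_left _ _
      have h4 : |h s| ≤ h s + 2 * N := abs_le.2 ⟨by linarith, by linarith⟩
      have h5 : h s ^ 2 ≤ p * (h s + 2 * N) := by
        rw [← sq_abs, pow_two]
        exact mul_le_mul (hb s) h4 (abs_nonneg _) hp0
      have h6 : (1 - p) ^ 2 ≤ 1 := pow_le_one₀ (by linarith) (by linarith)
      nlinarith [sq_nonneg (h s), sq_nonneg (p * h s)]
    · simp only [hs, if_false]
      nlinarith
  have hint : Integrable (fun s => (centredStep τ p s * h s) ^ 2) ν := by
    refine integrable_of_abs_le_one (((measurable_centredStep τ p).mul hm).pow_const 2) fun s => ?_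
    rw [abs_pow]
    exact pow_le_one₀ (abs_nonneg _) (abs_mul_le_one (abs_centredStep_le hp0 hp1.le s) (hb1 s))
  have hone : Integrable (fun s => (Set.Ici τ).indicator (fun _ => (1 : ℝ)) s) ν :=
    (integrable_const _).indicator measurableSet_Ici
  have hrest : Integrable (fun s => 2 * p * N * (Set.Ici τ).indicator (fun _ => (1 : ℝ)) s +
      p ^ 2 * h s ^ 2) ν := (hone.const_mul _).add (hi2.const_mul _)
  have hfinal : ∫ s, (centredStep τ p s * h s) ^ 2 ∂ν ≤ ∫ s, (p * H s + (2 * p * N *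
      (Set.Ici τ).indicator (fun _ => (1 : ℝ)) s + p ^ 2 * h s ^ 2)) ∂ν :=
    integral_mono hint ((hHi.const_mul p).add hrest) hpt
  have hsplit : ∫ s, (p * H s + (2 * p * N *
      (Set.Ici τ).indicator (fun _ => (1 : ℝ)) s + p ^ 2 * h s ^ 2)) ∂ν =
      p * Δ + (2 * p * N * p + p ^ 2 * ∫ s, h s ^ 2 ∂ν) := by
    rw [integral_add (hHi.const_mul p) hrest, integral_add (hone.const_mul _) (hi2.const_mul _),
      integral_const_mul, integral_const_mul, integral_const_mul,
      integral_indicator_const _ measurableSet_Ici, hτ]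
    simp [hΔdef]
  rw [hsplit] at hfinal
  rw [hΔ]
  refine hfinal.trans ?_
  have hq : 0 < 1 - p := by linarith
  have hN2 : N ≤ Δ / (1 - p) := by rw [le_div_iff₀ hq]; linarith
  have e : 2 * p / (1 - p) * Δ = p * Δ + (2 * p * (Δ / (1 - p)) * p + p * Δ) := by
    field_simp
    ring
  rw [e]
  have : 2 * p * N * p ≤ 2 * p * (Δ / (1 - p)) * p := by gcongr
  nlinarith [mul_nonneg hp0 hΔ0]

end Monotone

end RandomGeometric

/-! ### Monotonicity, increments and second moment of the overlap -/

namespace RandomGeometric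

theorem arcDensity_antitoneOn {m t : ℝ} (hm : 0 ≤ m) (ht : 0 ≤ t) :
    AntitoneOn (arcDensity m t) (Set.Icc 0 (Real.pi / 2)) := by
  intro x hx y hy hxy
  have hcos : Real.cos y ≤ Real.cos x :=
    Real.cos_le_cos_of_nonneg_of_le_pi hx.1 (by linarith [hy.2, Real.pi_pos]) hxy
  unfold arcDensity
  split_ifs with h1 h2
  · have hc : 0 < Real.cos y := ht.trans_lt h1
    refine Real.rpow_le_rpow (arcDensity_base_mem ht h1).1.le ?_ hm
    gcongr
  · exact absurd (h1.trans_le hcos) h2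
  · exact Real.rpow_nonneg (arcDensity_base_mem ht ‹_›).1.le _
  · exact le_rfl

theorem arcDensity_zero {m t : ℝ} (ht : t < 1) : arcDensity m t 0 = (1 - t ^ 2) ^ m := by
  simp [arcDensity, ht]

/-- The half-angle formula `cos²(arccos s / 2) = (1 + s)/2`. -/
theorem arcDensity_half_arccos {m t s : ℝ} (hs0 : -1 ≤ s) (hs1 : s ≤ 1)
    (h : 2 * t ^ 2 < 1 + s) :
    arcDensity m t (Real.arccos s / 2) = (1 - 2 * t ^ 2 / (1 + s)) ^ m := by
  have hc : 0 ≤ Real.cos (Real.arccos s / 2) :=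
    Real.cos_nonneg_of_neg_pi_div_two_le_of_le
      (by linarith [Real.arccos_nonneg s, Real.pi_pos]) (by linarith [Real.arccos_le_pi s])
  have hsq : Real.cos (Real.arccos s / 2) ^ 2 = (1 + s) / 2 := by
    rw [Real.cos_sq, mul_div_cancel₀ _ two_ne_zero, Real.cos_arccos hs0 hs1]
    ring
  have hlt : t < Real.cos (Real.arccos s / 2) := by
    refine lt_of_pow_lt_pow_left₀ 2 hc ?_
    rw [hsq]; linarith
  rw [arcDensity, if_pos hlt, hsq]
  congr 2
  rw [div_div_eq_mul_div, mul_comm]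

theorem half_arccos_mem (s : ℝ) : Real.arccos s / 2 ∈ Set.Icc 0 (Real.pi / 2) :=
  ⟨div_nonneg (Real.arccos_nonneg _) two_pos.le, by gcongr; exact Real.arccos_le_pi _⟩

theorem twoCaps_pi_div_two (k : ℕ) (t : ℝ) : twoCaps k t (Real.pi / 2) = 0 := by
  simp [twoCaps]

section

variable {k : ℕ} {t : ℝ} (ht : 0 ≤ t)

include ht

theorem intervalIntegrable_arcDensity_nat (a b : ℝ) :
    IntervalIntegrable (arcDensity (k / 2) t) volume a b :=
  intervalIntegrable_arcDensity (by positivity) ht a b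

theorem twoCaps_sub (a b : ℝ) :
    twoCaps k t a - twoCaps k t b = Real.pi⁻¹ * ∫ x in a..b, arcDensity (k / 2) t x := by
  rw [twoCaps, twoCaps, ← mul_sub, intervalIntegral.integral_interval_sub_interval_comm' _ _
    (intervalIntegrable_arcDensity_nat ht _ _)]
  · simp [intervalIntegral.integral_symm b a]
  · exact intervalIntegrable_arcDensity_nat ht _ _
  · exact intervalIntegrable_arcDensity_nat ht _ _

theorem twoCaps_antitone : Antitone (twoCaps k t) := by
  intro a b hab
  rw [← sub_nonneg, twoCaps_sub ht]
  exact mul_nonneg (by positivity)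
    (intervalIntegral.integral_nonneg hab fun x _ => arcDensity_nonneg ht x)

theorem twoCaps_nonneg {ψ : ℝ} (h : ψ ≤ Real.pi / 2) : 0 ≤ twoCaps k t ψ :=
  mul_nonneg (by positivity)
    (intervalIntegral.integral_nonneg h fun x _ => arcDensity_nonneg ht x)

theorem twoCaps_sub_ge {a b : ℝ} (ha : 0 ≤ a) (hab : a ≤ b) (hb : b ≤ Real.pi / 2) :
    Real.pi⁻¹ * ((b - a) * arcDensity (k / 2) t b) ≤ twoCaps k t a - twoCaps k t b := by
  rw [twoCaps_sub ht]
  gcongr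
  rw [← smul_eq_mul, ← intervalIntegral.integral_const]
  refine intervalIntegral.integral_mono_on hab (by simp)
    (intervalIntegrable_arcDensity_nat ht _ _) fun x hx => ?_
  exact arcDensity_antitoneOn (by positivity) ht ⟨ha.trans hx.1, hx.2.trans hb⟩
    ⟨ha.trans hab, hb⟩ hx.2

theorem twoCaps_sub_le {a b : ℝ} (ha : 0 ≤ a) (hab : a ≤ b) (hb : b ≤ Real.pi / 2) :
    twoCaps k t a - twoCaps k t b ≤ Real.pi⁻¹ * ((b - a) * arcDensity (k / 2) t 0) := by
  rw [twoCaps_sub ht]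
  gcongr
  rw [← smul_eq_mul, ← intervalIntegral.integral_const]
  refine intervalIntegral.integral_mono_on hab (intervalIntegrable_arcDensity_nat ht _ _)
    (by simp) fun x hx => ?_
  exact arcDensity_antitoneOn (by positivity) ht ⟨le_rfl, by positivity⟩
    ⟨ha.trans hx.1, hx.2.trans hb⟩ (ha.trans hx.1)

theorem twoCaps_zero_le : twoCaps k t 0 ≤ arcDensity (k / 2) t 0 / 2 := by
  have h := twoCaps_sub_le (k := k) ht le_rfl Real.pi_div_two_pos.le le_rfl
  rw [twoCaps_pi_div_two, sub_zero, sub_zero] at h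
  refine h.trans_eq ?_
  field_simp

theorem twoCaps_zero_le_arccos : twoCaps k t 0 ≤ Real.pi⁻¹ * (Real.arccos t *
    arcDensity (k / 2) t 0) := by
  have h1 : Real.arccos t ≤ Real.pi / 2 := Real.arccos_le_pi_div_two.2 ht
  have h := twoCaps_sub_le (k := k) ht le_rfl (Real.arccos_nonneg t) h1
  have h2 : twoCaps k t (Real.arccos t) = 0 := by
    rw [twoCaps, intervalIntegral.integral_congr (g := fun _ => 0)]
    · simp
    · intro x hx
      rw [Set.uIcc_of_le h1] at hx
      refine if_neg (not_lt.2 ?_)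
      rcases le_total t 1 with ht1 | ht1
      · rw [← Real.cos_arccos (by linarith) ht1]
        exact Real.cos_le_cos_of_nonneg_of_le_pi (Real.arccos_nonneg t)
          (by linarith [hx.2, Real.pi_pos]) hx.1
      · exact (Real.cos_le_one x).trans ht1
  rwa [h2, sub_zero, sub_zero] at h

theorem overlap_monotone : Monotone (overlap k t) := by
  intro s s' h
  unfold overlap
  gcongr
  exact twoCaps_antitone ht (by gcongr)

theorem overlap_sub_ge {s₀ s : ℝ} (h : s₀ ≤ s) :
    Real.pi⁻¹ * ((Real.arccos s₀ - Real.arccos s) / 2 *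
      arcDensity (k / 2) t (Real.arccos s₀ / 2)) ≤ overlap k t s - overlap k t s₀ := by
  have h1 := twoCaps_sub_ge (k := k) ht (half_arccos_mem s).1
    (by gcongr : Real.arccos s / 2 ≤ Real.arccos s₀ / 2)
    (half_arccos_mem s₀).2
  rw [sub_div]
  unfold overlap
  linarith

/-- The arc density is largest at `0`, and Jordan's inequality gives `|arcsin s| ≤ (π/2)|s|`. -/
theorem abs_overlap_sub_zero_le {s : ℝ} (hs : s ∈ Set.Icc (-1 : ℝ) 1) :
    |overlap k t s - overlap k t 0| ≤ arcDensity (k / 2) t 0 * |s| / 4 := by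
  have hg0 := arcDensity_nonneg (m := k / 2) ht 0
  have hasin : |Real.arcsin s| ≤ Real.pi / 2 * |s| := by
    have key : ∀ y : ℝ, 0 ≤ y → y ≤ 1 → Real.arcsin y ≤ Real.pi / 2 * y := by
      intro y hy0 hy1
      have := Real.mul_le_sin (Real.arcsin_nonneg.2 hy0) (Real.arcsin_le_pi_div_two y)
      rw [Real.sin_arcsin (by linarith) hy1] at this
      have h2 : Real.arcsin y = Real.pi / 2 * (2 / Real.pi * Real.arcsin y) := by
        field_simp
      rw [h2]
      gcongr
    rcases le_total 0 s with h | h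
    · rw [abs_of_nonneg h, abs_of_nonneg (Real.arcsin_nonneg.2 h)]
      exact key s h hs.2
    · rw [abs_of_nonpos h, abs_of_nonpos (Real.arcsin_nonpos.2 h), ← Real.arcsin_neg]
      exact key (-s) (by linarith) (by linarith [hs.1])
  have hdiff : |overlap k t s - overlap k t 0| ≤
      Real.pi⁻¹ * (|Real.arcsin s| / 2 * arcDensity (k / 2) t 0) := by
    have e : Real.arccos s = Real.pi / 2 - Real.arcsin s := rfl
    have e0 : Real.arccos 0 = Real.pi / 2 := Real.arccos_zero
    rcases le_total 0 s with h | h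
    · have h1 := twoCaps_sub_le (k := k) ht (half_arccos_mem s).1
        (by gcongr : Real.arccos s / 2 ≤ Real.arccos 0 / 2)
        (half_arccos_mem 0).2
      rw [abs_of_nonneg (sub_nonneg.2 (overlap_monotone ht h)),
        abs_of_nonneg (Real.arcsin_nonneg.2 h)]
      unfold overlap
      rw [show Real.arcsin s / 2 = Real.arccos 0 / 2 - Real.arccos s / 2 by rw [e, e0]; ring]
      linarith
    · have h1 := twoCaps_sub_le (k := k) ht (half_arccos_mem 0).1
        (by gcongr : Real.arccos 0 / 2 ≤ Real.arccos s / 2)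
        (half_arccos_mem s).2
      rw [abs_of_nonpos (sub_nonpos.2 (overlap_monotone ht h)),
        abs_of_nonpos (Real.arcsin_nonpos.2 h)]
      unfold overlap
      rw [show -Real.arcsin s / 2 = Real.arccos s / 2 - Real.arccos 0 / 2 by rw [e, e0]; ring]
      linarith
  refine hdiff.trans ?_
  calc Real.pi⁻¹ * (|Real.arcsin s| / 2 * arcDensity (k / 2) t 0)
      ≤ Real.pi⁻¹ * (Real.pi / 2 * |s| / 2 * arcDensity (k / 2) t 0) := by gcongr
    _ = _ := by field_simp; ring

theorem abs_overlap_le_one (s : ℝ) : |overlap k t s| ≤ 1 := by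
  have h0 : twoCaps k t 0 ≤ 1 := by
    rw [← innerLaw_real_Ici ht]; exact measureReal_le_one
  have h1 := twoCaps_nonneg (k := k) ht (half_arccos_mem s).2
  have h2 := twoCaps_antitone (k := k) ht (half_arccos_mem s).1
  have h3 := twoCaps_nonneg (k := k) ht Real.pi_div_two_pos.le
  unfold overlap
  rw [abs_le]
  constructor <;> nlinarith

theorem abs_overlap_le (s : ℝ) : |overlap k t s| ≤ twoCaps k t 0 := by
  have h0 : twoCaps k t 0 ≤ 1 := by
    rw [← innerLaw_real_Ici ht]; exact measureReal_le_one
  have h1 := twoCaps_nonneg (k := k) ht (half_arccos_mem s).2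
  have h2 := twoCaps_antitone (k := k) ht (half_arccos_mem s).1
  have h3 := twoCaps_nonneg (k := k) ht Real.pi_div_two_pos.le
  unfold overlap
  rw [abs_le]
  constructor <;> nlinarith

theorem integrable_overlap : Integrable (overlap k t) (innerLaw k) :=
  integrable_of_abs_le_one (continuous_overlap ht).measurable (abs_overlap_le_one ht)

theorem integrable_overlap_sq : Integrable (fun s => overlap k t s ^ 2) (innerLaw k) :=
  integrable_of_abs_le_one ((continuous_overlap ht).measurable.pow_const 2) fun s => by
    rw [abs_pow]; exact pow_le_one₀ (abs_nonneg _) (abs_overlap_le_one ht s)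

theorem integral_overlap_of_nonneg : ∫ s, overlap k t s ∂(innerLaw k) = 0 := by
  have := integral_overlap (k := k) (τ := t) rfl
  rwa [abs_of_nonneg ht] at this

/-- From `h ≥ -q²` and `|h| ≤ q` follows `h² ≤ q(h + 2q²)`, and `h` has mean zero. This is the bound
for thresholds near one. -/
theorem integral_overlap_sq_le_cube :
    ∫ s, overlap k t s ^ 2 ∂(innerLaw k) ≤ 2 * twoCaps k t 0 ^ 3 := by
  set q := twoCaps k t 0 with hq
  have hq0 : 0 ≤ q := twoCaps_nonneg ht Real.pi_div_two_pos.le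
  have hpt : ∀ s, overlap k t s ^ 2 ≤ q * (overlap k t s + 2 * q ^ 2) := by
    intro s
    have h1 := twoCaps_nonneg (k := k) ht (half_arccos_mem s).2
    have h2 : |overlap k t s| ≤ overlap k t s + 2 * q ^ 2 := by
      have : overlap k t s = twoCaps k t (Real.arccos s / 2) - q ^ 2 := rfl
      rw [this]
      exact abs_le.2 ⟨by linarith, by nlinarith⟩
    rw [← sq_abs, pow_two]
    exact mul_le_mul (abs_overlap_le ht s) h2 (abs_nonneg _) hq0
  have hi : Integrable (fun s => q * (overlap k t s + 2 * q ^ 2)) (innerLaw k) :=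
    ((integrable_overlap ht).add (integrable_const _)).const_mul q
  refine (integral_mono (integrable_overlap_sq ht) hi hpt).trans_eq ?_
  rw [integral_const_mul, integral_add (integrable_overlap ht) (integrable_const _),
    integral_overlap_of_nonneg ht]
  simp
  ring

/-- A mean-zero function has its least second moment about zero, so `h` may be recentred at `h 0`.
There it is Lipschitz, and `s²` has mean `1/(k+2)`. -/
theorem integral_overlap_sq_le :
    ∫ s, overlap k t s ^ 2 ∂(innerLaw k) ≤ arcDensity (k / 2) t 0 ^ 2 / (16 * (k + 2)) := by
  set c := overlap k t 0
  set g := arcDensity (k / 2) t 0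
  have h1 : ∫ s, overlap k t s ^ 2 ∂(innerLaw k) ≤
      ∫ s, (overlap k t s - c) ^ 2 ∂(innerLaw k) := by
    have hpt : ∀ s, (overlap k t s - c) ^ 2 = overlap k t s ^ 2 + (-2 * c * overlap k t s + c ^ 2) :=
      fun s => by ring
    have hi : Integrable (fun s => -2 * c * overlap k t s + c ^ 2) (innerLaw k) :=
      ((integrable_overlap ht).const_mul _).add (integrable_const _)
    simp_rw [hpt]
    rw [integral_add (integrable_overlap_sq ht) hi,
      integral_add ((integrable_overlap ht).const_mul _) (integrable_const _),
      integral_const_mul, integral_overlap_of_nonneg ht]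
    simp
    positivity
  have h2 : ∫ s, (overlap k t s - c) ^ 2 ∂(innerLaw k) ≤
      ∫ s, g ^ 2 / 16 * s ^ 2 ∂(innerLaw k) := by
    have hsq : Integrable (fun s : ℝ => s ^ 2) (innerLaw k) := by
      refine Integrable.of_bound (by fun_prop) 1 ?_
      filter_upwards [ae_innerLaw_mem_Icc] with s hs
      rw [Real.norm_eq_abs, abs_pow]
      exact pow_le_one₀ (abs_nonneg _) (abs_le.2 hs)
    refine integral_mono_ae ?_ (hsq.const_mul _) ?_
    · refine Integrable.of_bound (C := 4)
        (((continuous_overlap ht).sub continuous_const).pow 2).aestronglyMeasurable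
        (.of_forall fun s => ?_)
      have h3 := abs_overlap_le_one (k := k) ht s
      have h4 := abs_overlap_le_one (k := k) ht 0
      rw [abs_le] at h3 h4
      rw [Real.norm_eq_abs, abs_of_nonneg (sq_nonneg _)]
      have : |overlap k t s - c| ≤ 2 := abs_le.2 ⟨by linarith, by linarith⟩
      calc (overlap k t s - c) ^ 2 = |overlap k t s - c| ^ 2 := (sq_abs _).symm
        _ ≤ 2 ^ 2 := by gcongr
        _ = 4 := by norm_num
    · filter_upwards [ae_innerLaw_mem_Icc] with s hs
      have := abs_overlap_sub_zero_le (k := k) ht hs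
      calc (overlap k t s - c) ^ 2 = |overlap k t s - c| ^ 2 := (sq_abs _).symm
        _ ≤ (g * |s| / 4) ^ 2 := by gcongr
        _ = _ := by rw [div_pow, mul_pow, sq_abs]; ring
  refine h1.trans (h2.trans_eq ?_)
  rw [integral_const_mul, integral_sq_innerLaw]
  field_simp

end

end RandomGeometric

/-! ### Comparing the cap measure with the arc density at zero -/

namespace RandomGeometric

/-- Bernoulli's inequality needs an exponent at least one, so it is applied to `m + 1`. -/
theorem one_sub_mul_le_rpow {m z : ℝ} (hm : 0 ≤ m) (hz0 : 0 ≤ z) (hz1 : z ≤ 1) :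
    1 - (m + 1) * z ≤ (1 - z) ^ m := by
  have h1 := one_add_mul_self_le_rpow_one_add (s := -z) (by linarith) (p := m + 1) (by linarith)
  rw [← sub_eq_add_neg] at h1
  have h2 : (1 - z) ^ (m + 1) ≤ (1 - z) ^ m := by
    rcases hm.eq_or_lt with rfl | hm'
    · simpa using hz0
    · exact Real.rpow_le_rpow_of_exponent_ge' (by linarith) (by linarith) hm (by linarith)
  linarith

theorem one_add_mul_le_mul_rpow {m z : ℝ} (hm : 0 ≤ m) (hz0 : 0 ≤ z) :
    1 + (m + 1) * z ≤ (1 + z) * (1 + z) ^ m := by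
  have h1 := one_add_mul_self_le_rpow_one_add (s := z) (by linarith) (p := m + 1) (by linarith)
  rwa [Real.rpow_add_one (by positivity), mul_comm _ (1 + z)] at h1

section

variable {k : ℕ} {t : ℝ} (ht : 0 ≤ t)

include ht

/-- The density decays on the angular scale `1/(1 + t√(k+2))`; within a ninth of it at most half is
lost. -/
theorem arcDensity_ge_half (h8 : t ^ 2 ≤ 8 / 9) {ψ : ℝ} (hψ0 : 0 ≤ ψ)
    (hψ : 9 * (1 + t * √(k + 2)) * ψ ≤ 1) :
    arcDensity (k / 2) t 0 / 2 ≤ arcDensity (k / 2) t ψ := by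
  have hu : 0 ≤ t * √(k + 2 : ℝ) := by positivity
  have hψ1 : ψ ≤ 1 / 9 := by nlinarith
  have hsin : Real.sin ψ ^ 2 ≤ ψ ^ 2 := by
    have := Real.abs_sin_le_abs (x := ψ)
    exact sq_le_sq.2 this
  have hcs := Real.sin_sq_add_cos_sq ψ
  have hc2 : 80 / 81 ≤ Real.cos ψ ^ 2 := by nlinarith
  have hc0 : 0 ≤ Real.cos ψ :=
    Real.cos_nonneg_of_neg_pi_div_two_le_of_le (by linarith [Real.pi_pos])
      (by linarith [Real.pi_gt_three])
  have htc : t < Real.cos ψ := lt_of_pow_lt_pow_left₀ 2 hc0 (by linarith)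
  have ht1 : t < 1 := by nlinarith
  rw [arcDensity_zero ht1, arcDensity, if_pos htc]
  -- The factor `10` exceeds `9 · 81/80`: `9` bounds `1/(1 - t²)` and `81/80` bounds `1/cos² ψ`.
  set z : ℝ := 10 * t ^ 2 * ψ ^ 2 with hz
  have hdz : (k + 2 : ℝ) * z ≤ 10 / 81 := by
    have h1 : 9 * (t * √(k + 2) * ψ) ≤ 1 := by nlinarith
    have h2 : (9 * (t * √(k + 2) * ψ)) ^ 2 ≤ 1 := pow_le_one₀ (by positivity) h1
    have h3 : √(k + 2 : ℝ) ^ 2 = k + 2 := Real.sq_sqrt (by positivity)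
    rw [mul_pow, mul_pow, mul_pow, h3] at h2
    rw [hz]; linarith
  have hz0 : 0 ≤ z := by positivity
  have hz1 : z ≤ 1 := by
    have : 0 ≤ (k : ℝ) * z := by positivity
    linarith
  have hbase : (1 - t ^ 2) * (1 - z) ≤ 1 - t ^ 2 / Real.cos ψ ^ 2 := by
    have h1 : t ^ 2 / Real.cos ψ ^ 2 = t ^ 2 + t ^ 2 * (Real.sin ψ ^ 2 / Real.cos ψ ^ 2) := by
      have hc : Real.cos ψ ≠ 0 := fun h => by norm_num [h] at hc2
      field_simp
      rw [add_comm (Real.cos ψ ^ 2), hcs, mul_one]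
    have h2 : Real.sin ψ ^ 2 / Real.cos ψ ^ 2 ≤ 81 / 80 * ψ ^ 2 := by
      rw [div_le_iff₀ (by linarith)]
      nlinarith [sq_nonneg ψ]
    have h3 : t ^ 2 * (Real.sin ψ ^ 2 / Real.cos ψ ^ 2) ≤ t ^ 2 * (81 / 80 * ψ ^ 2) := by gcongr
    have h4 : t ^ 2 * (81 / 80 * ψ ^ 2) ≤ (1 - t ^ 2) * z := by
      rw [hz]
      nlinarith [mul_nonneg (sq_nonneg t) (sq_nonneg ψ)]
    rw [h1]; linarith
  calc (1 - t ^ 2) ^ (k / 2 : ℝ) / 2 = (1 - t ^ 2) ^ (k / 2 : ℝ) * (1 / 2) := by ring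
    _ ≤ (1 - t ^ 2) ^ (k / 2 : ℝ) * (1 - z) ^ (k / 2 : ℝ) := by
        have := one_sub_mul_le_rpow (m := k / 2) (by positivity) hz0 hz1
        have h0 : 0 ≤ (1 - t ^ 2) ^ (k / 2 : ℝ) := Real.rpow_nonneg (by linarith) _
        gcongr
        linarith
    _ = ((1 - t ^ 2) * (1 - z)) ^ (k / 2 : ℝ) :=
        (Real.mul_rpow (by linarith) (by linarith)).symm
    _ ≤ _ := Real.rpow_le_rpow (mul_nonneg (by linarith) (by linarith)) hbase (by positivity)

theorem arcDensity_zero_le_twoCaps (h8 : t ^ 2 ≤ 8 / 9) :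
    arcDensity (k / 2) t 0 ≤ 18 * Real.pi * (1 + t * √(k + 2)) * twoCaps k t 0 := by
  have hu : 0 ≤ t * √(k + 2 : ℝ) := by positivity
  set ψ : ℝ := (9 * (1 + t * √(k + 2)))⁻¹ with hψ
  have hψ0 : 0 < ψ := by positivity
  have hψe : 9 * (1 + t * √(k + 2)) * ψ = 1 := mul_inv_cancel₀ (by positivity)
  have hψ2 : ψ ≤ Real.pi / 2 := by nlinarith [Real.pi_gt_three]
  have h1 := twoCaps_sub_ge (k := k) ht le_rfl hψ0.le hψ2
  have h2 := arcDensity_ge_half (k := k) ht h8 hψ0.le hψe.le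
  have h3 := twoCaps_nonneg (k := k) ht hψ2
  have h4 : Real.pi⁻¹ * (ψ * (arcDensity (k / 2) t 0 / 2)) ≤ twoCaps k t 0 := by
    rw [sub_zero] at h1
    have : Real.pi⁻¹ * (ψ * (arcDensity (k / 2) t 0 / 2)) ≤
      Real.pi⁻¹ * (ψ * arcDensity (k / 2) t ψ) := by gcongr
    linarith
  calc arcDensity (k / 2) t 0
      = 18 * Real.pi * (1 + t * √(k + 2)) *
        (Real.pi⁻¹ * (ψ * (arcDensity (k / 2) t 0 / 2))) := by
        have : 18 * Real.pi * (1 + t * √(k + 2)) *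
            (Real.pi⁻¹ * (ψ * (arcDensity (k / 2) t 0 / 2))) =
            (Real.pi * Real.pi⁻¹) * (9 * (1 + t * √(k + 2)) * ψ) * arcDensity (k / 2) t 0 := by
          ring
        rw [this, hψe, mul_inv_cancel₀ Real.pi_ne_zero, one_mul, one_mul]
    _ ≤ _ := by gcongr

/-- Write `1 - t²/cos² ψ = 1 - t² - t² tan² ψ` and use `tan ψ ≥ ψ` and `1 - x ≤ exp(-x)`. -/
theorem arcDensity_le_gaussian (ht1 : t < 1) {ψ : ℝ} (h0 : 0 ≤ ψ) (h2 : ψ ≤ Real.pi / 2) :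
    arcDensity (k / 2) t ψ ≤
      arcDensity (k / 2) t 0 * Real.exp (-(k / 2 * t ^ 2) * ψ ^ 2) := by
  rw [arcDensity_zero ht1]
  have hg0 : 0 ≤ (1 - t ^ 2) ^ (k / 2 : ℝ) := Real.rpow_nonneg (by nlinarith) _
  unfold arcDensity
  split_ifs with h
  · have hc : 0 < Real.cos ψ := ht.trans_lt h
    have hψ : ψ < Real.pi / 2 := by
      refine lt_of_le_of_ne h2 fun e => ?_
      rw [e, Real.cos_pi_div_two] at hc
      exact hc.false
    have htan : ψ ^ 2 ≤ Real.tan ψ ^ 2 := by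
      have := Real.le_tan h0 hψ
      gcongr
    have hb : 1 - t ^ 2 / Real.cos ψ ^ 2 ≤ (1 - t ^ 2) * Real.exp (-(t ^ 2) * ψ ^ 2) := by
      have h1 : t ^ 2 / Real.cos ψ ^ 2 = t ^ 2 + t ^ 2 * Real.tan ψ ^ 2 := by
        rw [Real.tan_eq_sin_div_cos, div_pow]
        have := Real.sin_sq_add_cos_sq ψ
        field_simp
        rw [add_comm (Real.cos ψ ^ 2), this, mul_one]
      have h3 := Real.add_one_le_exp (-(t ^ 2) * ψ ^ 2)
      have h4 : 0 ≤ 1 - t ^ 2 := by nlinarith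
      have h5 : (1 - t ^ 2) * (-(t ^ 2) * ψ ^ 2 + 1) ≤
        (1 - t ^ 2) * Real.exp (-(t ^ 2) * ψ ^ 2) := by gcongr
      have h6 : t ^ 2 * ψ ^ 2 ≤ t ^ 2 * Real.tan ψ ^ 2 := by gcongr
      have h7 : 0 ≤ t ^ 2 * (t ^ 2 * ψ ^ 2) := by positivity
      rw [h1]; nlinarith
    refine (Real.rpow_le_rpow (arcDensity_base_mem ht h).1.le hb (by positivity)).trans_eq ?_
    rw [Real.mul_rpow (by nlinarith) (Real.exp_pos _).le, ← Real.exp_mul]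
    ring_nf
  · positivity

/-- The Gaussian majorant has width of order `1/(t√k)`, which gives the converse to
`arcDensity_zero_le_twoCaps`. The majorant is flat for `k = 0` or `t = 0`, where the trivial bound
suffices. -/
theorem twoCaps_mul_le (ht1 : t < 1) :
    twoCaps k t 0 * (1 + t * √(k + 2)) ≤ 2 * arcDensity (k / 2) t 0 := by
  have hg0 := arcDensity_nonneg (m := k / 2) ht 0
  have hhalf := twoCaps_zero_le (k := k) ht
  have hq := twoCaps_nonneg (k := k) ht Real.pi_div_two_pos.le
  rcases Nat.eq_zero_or_pos k with hk | hk
  · have : t * √(k + 2 : ℝ) ≤ 2 := by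
      have h2 : √(k + 2 : ℝ) ≤ 2 := Real.sqrt_le_iff.2 ⟨by norm_num, by norm_num [hk]⟩
      nlinarith [Real.sqrt_nonneg (k + 2 : ℝ)]
    linarith [mul_le_mul_of_nonneg_left this hq]
  rcases ht.eq_or_lt with h0 | h0
  · rw [← h0] at hg0 hhalf ⊢
    rw [zero_mul]
    linarith
  set b : ℝ := k / 2 * t ^ 2 with hb
  have hk' : (1 : ℝ) ≤ k := by exact_mod_cast hk
  have hb0 : 0 < b := by positivity
  have hint : Integrable (fun x : ℝ => Real.exp (-b * x ^ 2)) := integrable_exp_neg_mul_sq hb0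
  have h1 : twoCaps k t 0 ≤ Real.pi⁻¹ * (arcDensity (k / 2) t 0 * (√(Real.pi / b) / 2)) := by
    unfold twoCaps
    gcongr
    calc ∫ x in (0 : ℝ)..Real.pi / 2, arcDensity (k / 2) t x
        ≤ ∫ x in (0 : ℝ)..Real.pi / 2, arcDensity (k / 2) t 0 * Real.exp (-b * x ^ 2) := by
          refine intervalIntegral.integral_mono_on (by positivity)
            (intervalIntegrable_arcDensity_nat ht _ _) (hint.const_mul _).intervalIntegrable
            fun x hx => arcDensity_le_gaussian ht ht1 hx.1 hx.2
      _ = arcDensity (k / 2) t 0 * ∫ x in (0 : ℝ)..Real.pi / 2, Real.exp (-b * x ^ 2) :=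
          intervalIntegral.integral_const_mul _ _
      _ ≤ arcDensity (k / 2) t 0 * ∫ x in Set.Ioi (0 : ℝ), Real.exp (-b * x ^ 2) := by
          gcongr
          rw [intervalIntegral.integral_of_le (by positivity)]
          exact setIntegral_mono_set hint.integrableOn
            (.of_forall fun x => (Real.exp_pos _).le) (.of_forall fun x hx => hx.1)
      _ = _ := by rw [integral_gaussian_Ioi]
  have h2 : √(Real.pi / b) * (t * √(k + 2)) ≤ 2 * Real.pi := by
    rw [← abs_of_pos h0, ← Real.sqrt_sq_eq_abs, ← Real.sqrt_mul (sq_nonneg t),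
      ← Real.sqrt_mul (by positivity)]
    refine Real.sqrt_le_iff.2 ⟨by positivity, ?_⟩
    have : Real.pi / b * (t ^ 2 * (k + 2)) = Real.pi * (2 * (k + 2) / k) := by
      rw [hb]; field_simp
    rw [this, mul_pow]
    have h3 : 2 * ((k : ℝ) + 2) / k ≤ 6 := by
      rw [div_le_iff₀ (by positivity)]; linarith
    nlinarith [Real.pi_gt_three, mul_le_mul_of_nonneg_left h3 Real.pi_pos.le]
  have h3 : twoCaps k t 0 * (t * √(k + 2)) ≤ arcDensity (k / 2) t 0 := by
    calc twoCaps k t 0 * (t * √(k + 2))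
        ≤ Real.pi⁻¹ * (arcDensity (k / 2) t 0 * (√(Real.pi / b) / 2)) * (t * √(k + 2)) := by
          gcongr
      _ = Real.pi⁻¹ * arcDensity (k / 2) t 0 / 2 * (√(Real.pi / b) * (t * √(k + 2))) := by ring
      _ ≤ Real.pi⁻¹ * arcDensity (k / 2) t 0 / 2 * (2 * Real.pi) := by gcongr
      _ = _ := by field_simp
  linarith

end

end RandomGeometric

/-! ### Thresholds versus logarithms, and lower bounds for overlap increments -/

namespace RandomGeometric

section

variable {k : ℕ} {t : ℝ} (ht : 0 ≤ t)

include ht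

theorem lt_one_of_twoCaps_pos (hq : 0 < twoCaps k t 0) : t < 1 := by
  by_contra h
  have h1 := twoCaps_zero_le (k := k) ht
  have h2 : arcDensity (k / 2) t 0 = 0 := by simp [arcDensity, h]
  linarith

theorem twoCaps_le_half (hq : 0 < twoCaps k t 0) : twoCaps k t 0 ≤ 1 / 2 := by
  have ht1 := lt_one_of_twoCaps_pos ht hq
  have := twoCaps_zero_le (k := k) ht
  have := arcDensity_le_one (m := k / 2) (by positivity) ht 0
  linarith

/-- The cap measure is at most `(1 - t²)^{k/2} ≤ exp(-t²k/2)`. Together with `one_sub_log_le`, this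
makes `1 + t²(k+2)` comparable to `1 - log q` for `t² ≤ 8/9`. -/
theorem one_add_sq_mul_le (hq : 0 < twoCaps k t 0) :
    1 + t ^ 2 * (k + 2) ≤ 3 * (1 - Real.log (twoCaps k t 0)) := by
  have ht1 := lt_one_of_twoCaps_pos ht hq
  have h1 := twoCaps_zero_le (k := k) ht
  rw [arcDensity_zero ht1] at h1
  have h0 : 0 ≤ 1 - t ^ 2 := by nlinarith
  have h2 : (1 - t ^ 2) ^ (k / 2 : ℝ) ≤ Real.exp (-(t ^ 2) * (k / 2)) := by
    rw [Real.exp_mul]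
    exact Real.rpow_le_rpow h0 (by linarith [Real.add_one_le_exp (-(t ^ 2))]) (by positivity)
  have h3 : Real.log (twoCaps k t 0) ≤ -(t ^ 2) * (k / 2) :=
    (Real.log_le_iff_le_exp hq).2 (by linarith)
  have h4 : 0 ≤ t ^ 2 * k := by positivity
  nlinarith

theorem one_sub_log_le (h8 : t ^ 2 ≤ 8 / 9) (hq : 0 < twoCaps k t 0) :
    1 - Real.log (twoCaps k t 0) ≤ 11 * (1 + t ^ 2 * (k + 2)) := by
  have ht1 := lt_one_of_twoCaps_pos ht hq
  have hs := arcDensity_zero_le_twoCaps (k := k) ht h8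
  rw [arcDensity_zero ht1] at hs
  set u := t * √(k + 2 : ℝ) with hu
  have hu0 : 0 ≤ u := by positivity
  have hu2 : u ^ 2 = t ^ 2 * (k + 2) := by rw [hu, mul_pow, Real.sq_sqrt (by positivity)]
  have hb : 0 < 1 - t ^ 2 := by linarith
  have h1 := Real.log_le_log (by positivity) hs
  rw [Real.log_rpow hb, Real.log_mul (by positivity) hq.ne', Real.log_mul (by positivity)
    (by positivity)] at h1
  have h2 : Real.log (18 * Real.pi) ≤ 4.2 := by
    have : Real.log (18 * Real.pi) ≤ Real.log (2 ^ 6) :=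
      Real.log_le_log (by positivity) (by linarith [Real.pi_lt_d2])
    rw [Real.log_pow] at this
    push_cast at this
    linarith [Real.log_two_lt_d9]
  have h3 : Real.log (1 + u) ≤ u := by linarith [Real.log_le_sub_one_of_pos (by positivity : 0 < 1 + u)]
  have h4 := Real.one_sub_inv_le_log_of_pos hb
  have h5 : -(9 * t ^ 2) ≤ 1 - (1 - t ^ 2)⁻¹ := by
    have : (1 - t ^ 2)⁻¹ ≤ 1 + 9 * t ^ 2 := by
      rw [inv_le_iff_one_le_mul₀ hb]
      nlinarith [sq_nonneg t]
    linarith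
  have h6 : (k / 2 : ℝ) * -(9 * t ^ 2) ≤ k / 2 * Real.log (1 - t ^ 2) := by
    have := h5.trans h4
    gcongr
  nlinarith [sq_nonneg (u - 1), sq_nonneg t]

/-- The increment is at least an arc length of order `t` times the density at inner product `9t/10`.
The base `1 - 2t²/(1 + 9t/10)` of that density beats `(1 - t²)²` by a factor `1 + t³/40`; raised to
the power `k/2`, this yields the gain `1 + (k+2)t³`. -/
theorem overlap_sub_ge_of_sq_le (h8 : t ^ 2 ≤ 8 / 9) :
    t / 16000 * arcDensity (k / 2) t 0 ^ 2 * (1 + (k + 2) * t ^ 3) ≤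
      overlap k t t - overlap k t (9 / 10 * t) := by
  have ht1 : t ≤ 0.943 := by nlinarith
  have hd := overlap_sub_ge (k := k) ht (s₀ := 9 / 10 * t) (s := t) (by linarith)
  have hbase : (1 - t ^ 2) ^ 2 * (1 + t ^ 3 / 40) ≤ 1 - 2 * t ^ 2 / (1 + 9 / 10 * t) := by
    have h1 : (1 - t ^ 2) ^ 2 ≤ 1 - t ^ 2 := by nlinarith [sq_nonneg t]
    have h2 : 0 ≤ 1.8 - t - 0.9 * t ^ 2 - 1.9 * (1 - t ^ 2) / 40 := by nlinarith
    have h3 : (1 + 9 / 10 * t) * (1 - t ^ 2) ^ 2 ≤ 1.9 * (1 - t ^ 2) := by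
      have h0 : 0 ≤ 1 - t ^ 2 := by linarith
      exact mul_le_mul (by linarith) h1 (sq_nonneg _) (by norm_num)
    have h4 : 0 ≤ t ^ 3 * (1.8 - t - 0.9 * t ^ 2 - (1 + 9 / 10 * t) * (1 - t ^ 2) ^ 2 / 40) := by
      refine mul_nonneg (by positivity) ?_
      linarith
    rw [le_sub_iff_add_le, ← le_sub_iff_add_le', div_le_iff₀ (by positivity)]
    linarith
  rw [arcDensity_half_arccos (by linarith) (by linarith) (by nlinarith)] at hd
  rw [arcDensity_zero (by linarith)]
  set m : ℝ := k / 2 with hm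
  have hm0 : 0 ≤ m := by positivity
  have hg : ((1 - t ^ 2) ^ m) ^ 2 * (1 + t ^ 3 / 40) ^ m ≤
      (1 - 2 * t ^ 2 / (1 + 9 / 10 * t)) ^ m := by
    refine le_trans (le_of_eq ?_) (Real.rpow_le_rpow (by positivity) hbase hm0)
    rw [Real.mul_rpow (by positivity) (by positivity), Real.rpow_pow_comm (by linarith)]
  have hz : (1 + (k + 2) * t ^ 3) / 160 ≤ (1 + t ^ 3 / 40) ^ m := by
    have h1 := one_add_mul_le_mul_rpow hm0 (z := t ^ 3 / 40) (by positivity)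
    have h2 : t ^ 3 ≤ 1 := pow_le_one₀ ht (by linarith)
    have h3 : 0 ≤ (1 + t ^ 3 / 40) ^ m := by positivity
    have h4 : (1 + t ^ 3 / 40) * (1 + t ^ 3 / 40) ^ m ≤ 2 * (1 + t ^ 3 / 40) ^ m := by
      gcongr; linarith
    rw [hm] at h1 ⊢
    rw [hm] at h4
    linarith
  have harc : t / 10 ≤ Real.arccos (9 / 10 * t) - Real.arccos t := by
    have h := Real.abs_cos_sub_cos_le (Real.arccos (9 / 10 * t)) (Real.arccos t)
    rw [Real.cos_arccos (by linarith) (by linarith), Real.cos_arccos (by linarith) (by linarith),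
      abs_of_nonpos (by linarith),
      abs_of_nonneg (sub_nonneg.2 (Real.antitone_arccos (by linarith)))] at h
    linarith
  refine le_trans ?_ hd
  have hpi : 1 / 5 ≤ Real.pi⁻¹ := by
    rw [one_div]
    exact inv_anti₀ Real.pi_pos (by linarith [Real.pi_lt_four])
  calc t / 16000 * ((1 - t ^ 2) ^ m) ^ 2 * (1 + (k + 2) * t ^ 3)
      = 1 / 5 * (t / 10 / 2 * (((1 - t ^ 2) ^ m) ^ 2 * ((1 + (k + 2) * t ^ 3) / 160))) := by ring
    _ ≤ 1 / 5 * (t / 10 / 2 * (((1 - t ^ 2) ^ m) ^ 2 * (1 + t ^ 3 / 40) ^ m)) := by gcongr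
    _ ≤ _ := by
        have : 0 ≤ (Real.arccos (9 / 10 * t) - Real.arccos t) / 2 := by linarith
        gcongr

/-- Since `4b²(k+2) = 1`, Bernoulli's inequality keeps the density above `1/2` on the whole arc,
whose length is at least `b/2`. -/
theorem overlap_sub_ge_of_le_sqrt {b s : ℝ} (hb : 2 * b * √(k + 2) = 1) (htb : t ≤ b)
    (hs0 : -b ≤ s) (hs1 : s ≤ 0) :
    b / 20 ≤ overlap k t (s + b) - overlap k t s := by
  have hb0 : 0 ≤ b := ht.trans htb
  have hr : √(k + 2 : ℝ) ^ 2 = k + 2 := Real.sq_sqrt (by positivity)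
  have hbd : 4 * b ^ 2 * (k + 2) = 1 := by
    rw [← hr]; nlinarith
  have hk0 : 0 ≤ b ^ 2 * (k : ℝ) := by positivity
  have hb8 : b ≤ 3 / 8 := by nlinarith
  have htb2 : t ^ 2 ≤ b ^ 2 := by gcongr
  have hd := overlap_sub_ge (k := k) ht (s₀ := s) (s := s + b) (by linarith)
  rw [arcDensity_half_arccos (by linarith) (by linarith) (by nlinarith)] at hd
  have hz : 2 * t ^ 2 / (1 + s) ≤ 4 * b ^ 2 := by
    rw [div_le_iff₀ (by linarith)]
    nlinarith [sq_nonneg b]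
  have hz0 : 0 ≤ 2 * t ^ 2 / (1 + s) := div_nonneg (by positivity) (by linarith)
  have hm := one_sub_mul_le_rpow (m := k / 2) (by positivity) hz0 (by linarith)
  have hz2 : ((k : ℝ) / 2 + 1) * (2 * t ^ 2 / (1 + s)) ≤ (k / 2 + 1) * (4 * b ^ 2) := by gcongr
  have harc : b ≤ Real.arccos s - Real.arccos (s + b) := by
    have h := Real.abs_cos_sub_cos_le (Real.arccos s) (Real.arccos (s + b))
    rw [Real.cos_arccos (by linarith) (by linarith), Real.cos_arccos (by linarith) (by linarith),
      abs_of_nonpos (by linarith),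
      abs_of_nonneg (sub_nonneg.2 (Real.antitone_arccos (by linarith)))] at h
    linarith
  refine le_trans ?_ hd
  have hpi : 1 / 5 ≤ Real.pi⁻¹ := by
    rw [one_div]
    exact inv_anti₀ Real.pi_pos (by linarith [Real.pi_lt_four])
  calc b / 20 = 1 / 5 * (b / 2 * (1 / 2)) := by ring
    _ ≤ _ := by gcongr <;> linarith

theorem twoCaps_ge_of_mul_sqrt_eq (hb : 2 * t * √(k + 2) = 1) : 1 / 100 ≤ twoCaps k t 0 := by
  have hr : √(k + 2 : ℝ) ^ 2 = k + 2 := Real.sq_sqrt (by positivity)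
  have hbd : 4 * t ^ 2 * (k + 2) = 1 := by
    rw [← hr]; nlinarith
  have hk0 : 0 ≤ t ^ 2 * (k : ℝ) := by positivity
  have h := arcDensity_zero_le_twoCaps (k := k) ht (by linarith)
  have hq := twoCaps_nonneg (k := k) ht Real.pi_div_two_pos.le
  rw [arcDensity_zero (by nlinarith)] at h
  have hm := one_sub_mul_le_rpow (m := k / 2) (z := t ^ 2) (by positivity) (by positivity)
    (by linarith)
  have h2 : 18 * Real.pi * (1 + t * √(k + 2)) * twoCaps k t 0 ≤ 86 * twoCaps k t 0 := by
    gcongr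
    have : t * √(k + 2 : ℝ) = 1 / 2 := by linarith
    rw [this]
    linarith [Real.pi_lt_d2]
  linarith

/-- For caps of small angular radius `α = arccos t`, take centres at angle `3α/2`. Let `g` be the
density at zero and `r = (1/3)^{k/2}`. The density at half-angle `3α/4` is still at least `r g`, and
`q ≤ π⁻¹ α g`, so the increment is at least `q r / 4`. As `1 - t² ≤ 1/9`, also `q ≤ g ≤ r²`, whence
`q³ ≤ (q r)²`. -/
theorem exists_overlap_sub_ge_of_le_sq (h8 : 8 / 9 ≤ t ^ 2) (ht1 : t < 1) :
    ∃ s, 0 ≤ s ∧ s ≤ t ∧ twoCaps k t 0 ^ 3 ≤ 16 * (overlap k t t - overlap k t s) ^ 2 := by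
  set α := Real.arccos t with hα
  have hα0 : 0 < α := Real.arccos_pos.2 ht1
  have hcos : Real.cos α = t := Real.cos_arccos (by linarith) ht1.le
  have hsc := Real.sin_sq_add_cos_sq α
  have hα2 : α ≤ Real.pi / 2 := Real.arccos_le_pi_div_two.2 ht
  have hsin0 : 0 ≤ Real.sin α := Real.sin_nonneg_of_nonneg_of_le_pi hα0.le (by linarith)
  have hsin : Real.sin α ≤ 1 / 3 := by
    rw [hcos] at hsc
    nlinarith
  have hα3 : α ≤ Real.pi / 6 := by
    by_contra h
    have := Real.sin_lt_sin_of_lt_of_le_pi_div_two (by linarith) hα2 (not_le.1 h)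
    rw [Real.sin_pi_div_six] at this
    linarith
  have hα4 : α ≤ 0.53 := by linarith [Real.pi_lt_d2]
  have hs : Real.arccos (Real.cos (3 / 2 * α)) = 3 / 2 * α :=
    Real.arccos_cos (by linarith) (by linarith)
  have hle : Real.cos (3 / 2 * α) ≤ t := by
    rw [← hcos]
    exact Real.cos_le_cos_of_nonneg_of_le_pi hα0.le (by linarith) (by linarith)
  refine ⟨Real.cos (3 / 2 * α), Real.cos_nonneg_of_neg_pi_div_two_le_of_le (by linarith)
    (by linarith), hle, ?_⟩
  have hd := overlap_sub_ge (k := k) ht hle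
  rw [hs, show 3 / 2 * α / 2 = 3 / 4 * α by ring, ← hα] at hd
  set m : ℝ := k / 2 with hm
  have hm0 : 0 ≤ m := by positivity
  set g := (1 - t ^ 2) ^ m with hg
  have ht2 : 0 ≤ 1 - t ^ 2 := by nlinarith
  have hg0 : 0 ≤ g := Real.rpow_nonneg ht2 _
  set r : ℝ := (1 / 3) ^ m with hr
  have hr0 : 0 ≤ r := by positivity
  have hgr : g ≤ r ^ 2 := by
    rw [hg, hr, Real.rpow_pow_comm (by norm_num)]
    refine Real.rpow_le_rpow ht2 ?_ hm0
    norm_num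
    linarith
  have hdens : r * g ≤ arcDensity m t (3 / 4 * α) := by
    have hsin34 : Real.sin (3 / 4 * α) ^ 2 ≤ (3 / 4 * α) ^ 2 := sq_le_sq.2 Real.abs_sin_le_abs
    have hsc34 := Real.sin_sq_add_cos_sq (3 / 4 * α)
    -- This leaves `cos²(3α/4) - t² ≥ sin² α / 3`, the source of the factor `1/3` in the base.
    have hkey : (3 / 4 * α) ^ 2 ≤ 2 / 3 * Real.sin α ^ 2 := by
      have h1 := Real.sin_gt_sub_cube hα0
      have h2 : 0.95 * α ≤ Real.sin α := by nlinarith [mul_pos hα0 hα0]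
      nlinarith [mul_pos hα0 hα0]
    have hc0 : 0 ≤ Real.cos (3 / 4 * α) :=
      Real.cos_nonneg_of_neg_pi_div_two_le_of_le (by linarith) (by linarith)
    have hsinpos : 0 < Real.sin α := Real.sin_pos_of_pos_of_lt_pi hα0 (by linarith)
    have hlt : t < Real.cos (3 / 4 * α) := by
      rw [← hcos]
      exact Real.cos_lt_cos_of_nonneg_of_le_pi_div_two (by linarith) hα2 (by linarith)
    rw [arcDensity, if_pos hlt, hr, hg, ← Real.mul_rpow (by norm_num) ht2]
    refine Real.rpow_le_rpow (by positivity) ?_ hm0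
    have hC : 0 < Real.cos (3 / 4 * α) ^ 2 := by
      have := ht.trans_lt hlt
      positivity
    rw [le_sub_iff_add_le, ← le_sub_iff_add_le', div_le_iff₀ hC]
    rw [hcos] at hsc
    have h5 : Real.cos (3 / 4 * α) ^ 2 ≤ 1 := by nlinarith [sq_nonneg (Real.sin (3 / 4 * α))]
    nlinarith
  have hq := twoCaps_zero_le_arccos (k := k) ht
  rw [arcDensity_zero ht1, ← hα, ← hm, ← hg] at hq
  have hq2 := twoCaps_zero_le (k := k) ht
  rw [arcDensity_zero ht1, ← hm, ← hg] at hq2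
  set q := twoCaps k t 0 with hqdef
  have hq0 : 0 ≤ q := twoCaps_nonneg ht Real.pi_div_two_pos.le
  have hdiff : q * r ≤ 4 * (overlap k t t - overlap k t (Real.cos (3 / 2 * α))) := by
    calc q * r ≤ Real.pi⁻¹ * (α * g) * r := by gcongr
      _ = 4 * (Real.pi⁻¹ * ((3 / 2 * α - α) / 2 * (r * g))) := by ring
      _ ≤ 4 * (Real.pi⁻¹ * ((3 / 2 * α - α) / 2 * arcDensity m t (3 / 4 * α))) := by
          have : 0 ≤ (3 / 2 * α - α) / 2 := by linarith
          gcongr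
      _ ≤ _ := by gcongr
  have h3 : q ^ 3 ≤ (q * r) ^ 2 := by
    have : q ≤ r ^ 2 := by linarith
    calc q ^ 3 = q ^ 2 * q := by ring
      _ ≤ q ^ 2 * r ^ 2 := by gcongr
      _ = _ := by ring
  refine h3.trans ?_
  calc (q * r) ^ 2 ≤ (4 * (overlap k t t - overlap k t (Real.cos (3 / 2 * α)))) ^ 2 := by
        gcongr
    _ = _ := by ring

end

end RandomGeometric

/-! ### Lower bounds for the mean of a signed triangle -/

namespace RandomGeometric

section

variable {k : ℕ} {τ p δ : ℝ}

theorem half_le_innerLaw_real_Iic {s : ℝ} (hs : 0 ≤ s) : 1 / 2 ≤ (innerLaw k).real (Set.Iic s) := by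
  have h1 := innerLaw_real_Ici_neg (k := k) 0
  rw [neg_zero] at h1
  have h2 : (innerLaw k).real (Set.Iio 0) = 1 - (innerLaw k).real (Set.Ici 0) := by
    rw [← Set.compl_Ici, probReal_compl_eq_one_sub measurableSet_Ici]
  have h3 : (innerLaw k).real (Set.Iio 0) ≤ (innerLaw k).real (Set.Iic s) :=
    measureReal_mono fun x hx => (le_of_lt hx).trans hs
  linarith

theorem innerLaw_real_Ici_le_Iic_neg (s : ℝ) :
    (innerLaw k).real (Set.Ici s) ≤ (innerLaw k).real (Set.Iic (-s)) := by
  have h1 := innerLaw_real_Ici_neg (k := k) s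
  have h2 : (innerLaw k).real (Set.Iio (-s)) = 1 - (innerLaw k).real (Set.Ici (-s)) := by
    rw [← Set.compl_Ici, probReal_compl_eq_one_sub measurableSet_Ici]
  have h3 : (innerLaw k).real (Set.Iio (-s)) ≤ (innerLaw k).real (Set.Iic (-s)) :=
    measureReal_mono Set.Iio_subset_Iic_self
  linarith

theorem integrable_overlap_abs : Integrable (overlap k |τ|) (innerLaw k) :=
  integrable_overlap (abs_nonneg τ)

variable (hp : 0 < p) (hτ : (innerLaw k).real (Set.Ici τ) = p)

include hτ in
theorem twoCaps_abs : 0 ≤ τ ∧ twoCaps k |τ| 0 = p ∨ τ ≤ 0 ∧ twoCaps k |τ| 0 = 1 - p := by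
  rcases le_total 0 τ with h | h
  · exact .inl ⟨h, by rw [abs_of_nonneg h, ← innerLaw_real_Ici h, hτ]⟩
  · refine .inr ⟨h, ?_⟩
    rw [abs_of_nonpos h, ← innerLaw_real_Ici (by linarith), innerLaw_real_Ici_neg, hτ]

include hp hτ

theorem triangleMean_nonneg (hp1 : p ≤ 1) : 0 ≤ triangleMean k τ p :=
  integral_centredStep_mul_nonneg hp.le hp1 integrable_overlap_abs (integral_centredStep hτ)
    (overlap_monotone (abs_nonneg τ))

variable (hδ : 0 < δ) (hpδ : p ≤ 1 - δ)

include hδ hpδ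

theorem twoCaps_abs_pos : 0 < twoCaps k |τ| 0 := by
  rcases twoCaps_abs hτ with ⟨_, h⟩ | ⟨_, h⟩ <;> rw [h] <;> linarith

theorem twoCaps_abs_le : twoCaps k |τ| 0 ≤ p := by
  have h1 := twoCaps_le_half (abs_nonneg τ) (twoCaps_abs_pos hp hτ hδ hpδ)
  rcases twoCaps_abs hτ with ⟨_, h⟩ | ⟨_, h⟩ <;> rw [h] at h1 ⊢
  linarith

theorem mul_le_twoCaps_abs : δ * p ≤ twoCaps k |τ| 0 := by
  rcases twoCaps_abs hτ with ⟨_, h⟩ | ⟨_, h⟩ <;> rw [h] <;> nlinarith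

/-- For `τ ≥ 0` the lower tail up to `s` is kept, of mass at least `1/2`. For `τ ≤ 0` the upper tail
from `-τ` is kept, of mass `1 - p`, and `h τ ≤ h s`. -/
theorem triangleMean_ge {s : ℝ} (hs0 : 0 ≤ s) (hs : s ≤ |τ|) :
    δ ^ 2 / 2 * p * (overlap k |τ| |τ| - overlap k |τ| s) ≤ triangleMean k τ p := by
  have hmono := overlap_monotone (k := k) (abs_nonneg τ)
  have hD : 0 ≤ overlap k |τ| |τ| - overlap k |τ| s := sub_nonneg.2 (hmono hs)
  have hδ2 : δ ^ 2 ≤ 1 := pow_le_one₀ hδ.le (by linarith)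
  have key := fun a b ha hb => integral_centredStep_mul_ge (τ := τ) (a := a) (b := b) hp.le
    (by linarith) (integrable_overlap_abs (k := k) (τ := τ)) (integral_centredStep hτ) hmono ha hb
  unfold triangleMean
  rcases le_total 0 τ with h | h
  · rw [abs_of_nonneg h] at *
    refine le_trans ?_ (key s τ hs le_rfl)
    rw [sub_self, mul_zero, zero_add]
    have h1 := half_le_innerLaw_real_Iic (k := k) hs0
    have h2 : δ ^ 2 / 2 * p ≤ p * (innerLaw k).real (Set.Iic s) := by nlinarith
    gcongr
  · rw [abs_of_nonpos h] at *
    refine le_trans ?_ (key τ (-τ) le_rfl (by linarith))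
    rw [sub_self, mul_zero, add_zero, innerLaw_real_Ici_neg, hτ]
    have h1 : δ ^ 2 / 2 * p ≤ (1 - p) * (1 - p) := by nlinarith
    have h2 := hmono (h.trans hs0)
    calc δ ^ 2 / 2 * p * (overlap k (-τ) (-τ) - overlap k (-τ) s)
        ≤ (1 - p) * (1 - p) * (overlap k (-τ) (-τ) - overlap k (-τ) s) := by gcongr
      _ ≤ _ := by
          have : 0 ≤ (1 - p) * (1 - p) := mul_self_nonneg _
          gcongr

/-- Both tails beyond `±b` have mass at least `1/100`, and `h` rises by at least `b/20` on each of
`[-b, 0]` and `[0, b]`. The sign of `τ` decides which tail is used. -/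
theorem triangleMean_ge_of_abs_le {b : ℝ} (hb : 2 * b * √(k + 2) = 1) (htb : |τ| ≤ b) :
    δ * p * (b / 2000) ≤ triangleMean k τ p := by
  have hb0 : 0 ≤ b := (abs_nonneg τ).trans htb
  have hmono := overlap_monotone (k := k) (abs_nonneg τ)
  have hge := integral_centredStep_mul_ge (τ := τ) (a := -b) (b := b) hp.le
    (by linarith) (integrable_overlap_abs (k := k) (τ := τ)) (integral_centredStep hτ) hmono
    (neg_le_of_abs_le htb) (le_of_abs_le htb)
  refine le_trans ?_ hge
  have hP : 1 / 100 ≤ (innerLaw k).real (Set.Ici b) := by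
    rw [innerLaw_real_Ici hb0]
    exact twoCaps_ge_of_mul_sqrt_eq hb0 hb
  have hN := hP.trans (innerLaw_real_Ici_le_Iic_neg b)
  have h1 := overlap_sub_ge_of_le_sqrt (abs_nonneg τ) hb htb le_rfl (by linarith)
  have h2 := overlap_sub_ge_of_le_sqrt (s := 0) (abs_nonneg τ) hb htb (by linarith) le_rfl
  rw [neg_add_cancel] at h1
  rw [zero_add] at h2
  have h3 := hmono (le_of_abs_le htb)
  have h4 := hmono (neg_le_of_abs_le htb)
  have hq : 0 ≤ 1 - p := by linarith
  have hA : 0 ≤ (1 - p) * (innerLaw k).real (Set.Ici b) * (overlap k |τ| b - overlap k |τ| τ) :=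
    mul_nonneg (mul_nonneg hq measureReal_nonneg) (by linarith)
  have hB : 0 ≤ p * (innerLaw k).real (Set.Iic (-b)) * (overlap k |τ| τ - overlap k |τ| (-b)) :=
    mul_nonneg (mul_nonneg hp.le measureReal_nonneg) (by linarith)
  rcases le_total 0 τ with h | h
  · have h5 := hmono h
    have : p * (1 / 100) * (b / 20) ≤
        p * (innerLaw k).real (Set.Iic (-b)) * (overlap k |τ| τ - overlap k |τ| (-b)) := by
      gcongr
      linarith
    have h6 : δ * (p * b) ≤ 1 * (p * b) := by gcongr; linarith
    linarith
  · have h5 := hmono h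
    have : (1 - p) * (1 / 100) * (b / 20) ≤
        (1 - p) * (innerLaw k).real (Set.Ici b) * (overlap k |τ| b - overlap k |τ| τ) := by
      gcongr
      linarith
    have h6 : δ * p * b ≤ (1 - p) * b := by
      gcongr
      nlinarith
    linarith

theorem wedgeMoment_le :
    wedgeMoment k τ p ≤
      2 / δ * (p * triangleMean k τ p) + p ^ 2 * ∫ s, overlap k |τ| s ^ 2 ∂(innerLaw k) := by
  have ht := abs_nonneg τ
  have h1 := integral_sq_centredStep_mul_le (τ := τ) hp.le (by linarith)
    (continuous_overlap (k := k) ht).measurable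
    (fun s => (abs_overlap_le ht s).trans (twoCaps_abs_le hp hτ hδ hpδ)) hτ
    (integral_overlap hτ) (overlap_monotone ht)
  refine h1.trans ?_
  have h2 : 2 * p / (1 - p) ≤ 2 * p / δ := by
    gcongr
    linarith
  have h3 := triangleMean_nonneg hp hτ (by linarith)
  have h4 : 2 * p / (1 - p) * triangleMean k τ p ≤ 2 * p / δ * triangleMean k τ p := by gcongr
  have h5 : 2 * p / δ * triangleMean k τ p = 2 / δ * (p * triangleMean k τ p) := by ring
  unfold triangleMean at *
  linarith

theorem one_sub_log_twoCaps_le :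
    1 - Real.log (twoCaps k |τ| 0) ≤ (1 - Real.log p) / δ := by
  have h1 := Real.log_le_log (by positivity) (mul_le_twoCaps_abs hp hτ hδ hpδ)
  rw [Real.log_mul hδ.ne' hp.ne'] at h1
  have h2 := Real.log_nonpos hp.le (by linarith)
  have h3 := Real.one_sub_inv_le_log_of_pos hδ
  have h4 : 1 ≤ δ⁻¹ := (one_le_inv₀ hδ).2 (by linarith)
  rw [div_eq_mul_inv]
  nlinarith

theorem one_sub_log_le_twoCaps :
    1 - Real.log p ≤ 1 - Real.log (twoCaps k |τ| 0) := by
  have := Real.log_le_log (twoCaps_abs_pos hp hτ hδ hpδ) (twoCaps_abs_le hp hτ hδ hpδ)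
  linarith

/-- With `u = |τ|√(k+2)`, the density at zero is at most of order `p(1 + u)`, and `(1 + u)² ≤ 2(1 +
u²) ≤ 6L/δ`. -/
theorem integral_overlap_sq_le_log (h8 : τ ^ 2 ≤ 8 / 9) :
    ∫ s, overlap k |τ| s ^ 2 ∂(innerLaw k) ≤
      1300 / δ * (p ^ 2 * (1 - Real.log p) / (k + 2)) := by
  have ht := abs_nonneg τ
  rw [← sq_abs] at h8
  have hq := twoCaps_abs_pos hp hτ hδ hpδ
  have hqp := twoCaps_abs_le hp hτ hδ hpδ
  have hg := arcDensity_zero_le_twoCaps (k := k) ht h8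
  have hy := one_add_sq_mul_le ht hq
  have hL := one_sub_log_twoCaps_le hp hτ hδ hpδ
  refine (integral_overlap_sq_le ht).trans ?_
  set q := twoCaps k |τ| 0
  set L := 1 - Real.log p
  set u := |τ| * √(k + 2 : ℝ) with hu
  have hu0 : 0 ≤ u := by positivity
  have hu2 : u ^ 2 = |τ| ^ 2 * (k + 2) := by rw [hu, mul_pow, Real.sq_sqrt (by positivity)]
  have hg2 : arcDensity (k / 2) |τ| 0 ^ 2 ≤ 20800 * (p ^ 2 * (L / δ)) := by
    calc arcDensity (k / 2) |τ| 0 ^ 2 ≤ (18 * Real.pi * (1 + u) * q) ^ 2 :=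
          pow_le_pow_left₀ (arcDensity_nonneg ht 0) hg 2
      _ ≤ (57 * (1 + u) * p) ^ 2 := by
          gcongr
          linarith [Real.pi_lt_d2]
      _ = 57 ^ 2 * (p ^ 2 * (1 + u) ^ 2) := by ring
      _ ≤ 57 ^ 2 * (p ^ 2 * (6 * (L / δ))) := by
          gcongr
          nlinarith [sq_nonneg (u - 1)]
      _ ≤ _ := by
          have : 0 ≤ p ^ 2 * (L / δ) := by
            have : 0 ≤ L / δ := by nlinarith [sq_nonneg u]
            positivity
          linarith
  calc arcDensity (k / 2) |τ| 0 ^ 2 / (16 * (k + 2))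
      ≤ 20800 * (p ^ 2 * (L / δ)) / (16 * (k + 2)) := by gcongr
    _ = _ := by field_simp; ring

/-- Here `L` is at most of order `u²`, so `L³/d` is at most of order `u⁴t²`, and `p u` is at most of
order `g`. The first bound uses the part `d t⁴ g²` of the increment `D`, the second only the part `t
g²`. -/
theorem triangleMean_ge_of_half_le (h8 : τ ^ 2 ≤ 8 / 9) (hu : 1 / 2 ≤ |τ| * √(k + 2)) :
    p ^ 3 * (1 - Real.log p) ^ 3 / (k + 2) ≤ 10 ^ 16 / δ ^ 8 * triangleMean k τ p ∧
      p ^ 6 * (1 - Real.log p) ^ 3 / (k + 2) ≤ 10 ^ 16 / δ ^ 8 * triangleMean k τ p ^ 2 := by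
  have ht := abs_nonneg τ
  rw [← sq_abs] at h8
  have hq := twoCaps_abs_pos hp hτ hδ hpδ
  have hqp := mul_le_twoCaps_abs hp hτ hδ hpδ
  have hg := twoCaps_mul_le (k := k) ht (lt_one_of_twoCaps_pos ht hq)
  have hL1 := one_sub_log_le ht h8 hq
  have hL2 := one_sub_log_le_twoCaps hp hτ hδ hpδ
  have hD := overlap_sub_ge_of_sq_le (k := k) ht h8
  have hΔ := triangleMean_ge hp hτ hδ hpδ (s := 9 / 10 * |τ|) (by positivity) (by linarith)
  have hLpos : 0 ≤ 1 - Real.log p := by linarith [Real.log_nonpos hp.le (by linarith)]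
  set q := twoCaps k |τ| 0
  set L := 1 - Real.log p
  set t := |τ|
  set g := arcDensity (k / 2) t 0
  set D := overlap k t t - overlap k t (9 / 10 * t)
  set Δ := triangleMean k τ p
  set u := t * √(k + 2 : ℝ) with hu'
  set d : ℝ := k + 2 with hd
  have hd0 : 0 < d := by positivity
  have hu2 : u ^ 2 = t ^ 2 * d := by rw [hu', mul_pow, Real.sq_sqrt (by positivity)]
  have hL : L ≤ 55 * u ^ 2 := by nlinarith
  have hg0 : 0 ≤ g := arcDensity_nonneg ht 0
  have hqu : q * u ≤ 2 * g := by nlinarith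
  have hpu : δ * p * u ≤ 2 * g := le_trans (by gcongr) hqu
  have hu0 : 0 < u := by linarith
  have hLd : L ^ 3 / d ≤ 55 ^ 3 * (u ^ 4 * t ^ 2) := by
    rw [div_le_iff₀ hd0]
    calc L ^ 3 ≤ (55 * u ^ 2) ^ 3 := by gcongr
      _ = 55 ^ 3 * (u ^ 4 * u ^ 2) := by ring
      _ = _ := by rw [hu2]; ring
  have hδ1 : δ ≤ 1 := by linarith
  constructor
  · have h1 : δ ^ 2 * (p ^ 2 * (L ^ 3 / d)) ≤ 4 * 55 ^ 3 * (g ^ 2 * (d * t ^ 4)) := by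
      calc δ ^ 2 * (p ^ 2 * (L ^ 3 / d)) ≤ δ ^ 2 * (p ^ 2 * (55 ^ 3 * (u ^ 4 * t ^ 2))) := by gcongr
        _ = 55 ^ 3 * ((δ * p * u) ^ 2 * (u ^ 2 * t ^ 2)) := by ring
        _ ≤ 55 ^ 3 * ((2 * g) ^ 2 * (u ^ 2 * t ^ 2)) := by gcongr
        _ = _ := by rw [hu2]; ring
    have h2 : g ^ 2 * (d * t ^ 4) ≤ 16000 * D := by
      have : 0 ≤ t * g ^ 2 := by positivity
      nlinarith
    have h3 : δ ^ 4 * (p ^ 3 * (L ^ 3 / d)) ≤ 10 ^ 16 * Δ := by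
      calc δ ^ 4 * (p ^ 3 * (L ^ 3 / d)) = δ ^ 2 * p * (δ ^ 2 * (p ^ 2 * (L ^ 3 / d))) := by ring
        _ ≤ δ ^ 2 * p * (4 * 55 ^ 3 * (16000 * D)) := by
            refine mul_le_mul_of_nonneg_left (h1.trans ?_) (by positivity)
            gcongr
        _ = 8 * 55 ^ 3 * 16000 * (δ ^ 2 / 2 * p * D) := by ring
        _ ≤ 8 * 55 ^ 3 * 16000 * Δ := by gcongr
        _ ≤ 10 ^ 16 * Δ := by
            have := triangleMean_nonneg hp hτ (by linarith)
            gcongr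
            norm_num
    have h4 : δ ^ 8 * (p ^ 3 * (L ^ 3 / d)) ≤ δ ^ 4 * (p ^ 3 * (L ^ 3 / d)) := by
      have : δ ^ 8 ≤ δ ^ 4 := pow_le_pow_of_le_one hδ.le hδ1 (by norm_num)
      gcongr
    rw [div_mul_eq_mul_div, le_div_iff₀ (by positivity), mul_comm, mul_div_assoc]
    exact h4.trans h3
  · have hD0 : t * g ^ 2 ≤ 16000 * D := by
      have : 0 ≤ t * g ^ 2 * (d * t ^ 3) := by positivity
      nlinarith
    have h1 : δ ^ 4 * (p ^ 4 * (L ^ 3 / d)) ≤ 16 * 55 ^ 3 * (16000 * D) ^ 2 := by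
      calc δ ^ 4 * (p ^ 4 * (L ^ 3 / d)) ≤ δ ^ 4 * (p ^ 4 * (55 ^ 3 * (u ^ 4 * t ^ 2))) := by gcongr
        _ = 55 ^ 3 * ((δ * p * u) ^ 4 * t ^ 2) := by ring
        _ ≤ 55 ^ 3 * ((2 * g) ^ 4 * t ^ 2) := by gcongr
        _ = 16 * 55 ^ 3 * (t * g ^ 2) ^ 2 := by ring
        _ ≤ _ := by gcongr
    have hDnn : 0 ≤ D := by
      have : 0 ≤ t * g ^ 2 := by positivity
      linarith
    have h3 : δ ^ 8 * (p ^ 6 * (L ^ 3 / d)) ≤ 10 ^ 16 * Δ ^ 2 := by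
      calc δ ^ 8 * (p ^ 6 * (L ^ 3 / d)) = (δ ^ 2 * p) ^ 2 * (δ ^ 4 * (p ^ 4 * (L ^ 3 / d))) := by ring
        _ ≤ (δ ^ 2 * p) ^ 2 * (16 * 55 ^ 3 * (16000 * D) ^ 2) := by gcongr
        _ = 64 * 55 ^ 3 * 16000 ^ 2 * (δ ^ 2 / 2 * p * D) ^ 2 := by ring
        _ ≤ 64 * 55 ^ 3 * 16000 ^ 2 * Δ ^ 2 := by gcongr
        _ ≤ 10 ^ 16 * Δ ^ 2 := by gcongr; norm_num
    rw [div_mul_eq_mul_div, le_div_iff₀ (by positivity), mul_comm, mul_div_assoc]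
    exact h3

/-- Here `L` is bounded and `1/d = 4b²`, while the mean is at least of order `p b`. -/
theorem triangleMean_ge_of_le_half (hu : |τ| * √(k + 2) ≤ 1 / 2) :
    p ^ 3 * (1 - Real.log p) ^ 3 / (k + 2) ≤ 10 ^ 16 / δ ^ 8 * triangleMean k τ p ∧
      p ^ 6 * (1 - Real.log p) ^ 3 / (k + 2) ≤ 10 ^ 16 / δ ^ 8 * triangleMean k τ p ^ 2 := by
  have ht := abs_nonneg τ
  have hq := twoCaps_abs_pos hp hτ hδ hpδ
  have hr0 : 0 < √(k + 2 : ℝ) := by positivity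
  have hr : √(k + 2 : ℝ) ^ 2 = k + 2 := Real.sq_sqrt (by positivity)
  set d : ℝ := k + 2 with hd
  have hd2 : 2 ≤ d := by rw [hd]; linarith [k.cast_nonneg (α := ℝ)]
  have htd : |τ| ^ 2 * d ≤ 1 / 4 := by
    rw [← hr, ← mul_pow]
    calc (|τ| * √d) ^ 2 ≤ (1 / 2) ^ 2 := by gcongr
      _ = 1 / 4 := by norm_num
  have h8 : |τ| ^ 2 ≤ 8 / 9 := by nlinarith [sq_nonneg |τ|]
  have hL1 := one_sub_log_le ht h8 hq
  have hL2 := one_sub_log_le_twoCaps hp hτ hδ hpδ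
  have hLpos : 0 ≤ 1 - Real.log p := by linarith [Real.log_nonpos hp.le (by linarith)]
  set b : ℝ := 1 / (2 * √d) with hb
  have hb1 : 2 * b * √d = 1 := by rw [hb]; field_simp
  have htb : |τ| ≤ b := by
    rw [hb, le_div_iff₀ (by positivity)]; linarith
  have hΔ := triangleMean_ge_of_abs_le hp hτ hδ hpδ hb1 htb
  have hb0 : 0 < b := by positivity
  have hbd : 1 / d = 4 * b ^ 2 := by
    rw [hb, div_pow, mul_pow, hr]
    field_simp
    norm_num
  have hb2 : b ≤ 1 := by
    have : 4 * b ^ 2 ≤ 1 := by rw [← hbd, div_le_one (by linarith)]; linarith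
    nlinarith
  set L := 1 - Real.log p
  set Δ := triangleMean k τ p
  have hLd : L ^ 3 / d ≤ 14 ^ 3 * (4 * b ^ 2) := by
    rw [← hbd, mul_one_div]
    have : L ≤ 14 := by rw [← hd] at hL1; linarith
    gcongr
  have hδ1 : δ ≤ 1 := by linarith
  have hp1 : p ≤ 1 := by linarith
  have hΔ0 : 0 ≤ Δ := triangleMean_nonneg hp hτ hp1
  constructor
  · have h1 : δ ^ 8 * (p ^ 3 * (L ^ 3 / d)) ≤ 10 ^ 16 * Δ := by
      calc δ ^ 8 * (p ^ 3 * (L ^ 3 / d)) ≤ δ ^ 1 * (p ^ 1 * (14 ^ 3 * (4 * b ^ 2))) := by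
            have e1 : δ ^ 8 ≤ δ ^ 1 := pow_le_pow_of_le_one hδ.le hδ1 (by norm_num)
            have e2 : p ^ 3 ≤ p ^ 1 := pow_le_pow_of_le_one hp.le hp1 (by norm_num)
            gcongr
        _ = 14 ^ 3 * 8000 * (δ * p * (b / 2000)) * b := by ring
        _ ≤ 14 ^ 3 * 8000 * Δ * 1 := by gcongr
        _ ≤ _ := by linarith
    rw [div_mul_eq_mul_div, le_div_iff₀ (by positivity), mul_comm, mul_div_assoc]
    exact h1
  · have h1 : δ ^ 8 * (p ^ 6 * (L ^ 3 / d)) ≤ 10 ^ 16 * Δ ^ 2 := by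
      calc δ ^ 8 * (p ^ 6 * (L ^ 3 / d)) ≤ δ ^ 2 * (p ^ 2 * (14 ^ 3 * (4 * b ^ 2))) := by
            have e1 : δ ^ 8 ≤ δ ^ 2 := pow_le_pow_of_le_one hδ.le hδ1 (by norm_num)
            have e2 : p ^ 6 ≤ p ^ 2 := pow_le_pow_of_le_one hp.le hp1 (by norm_num)
            gcongr
        _ = 14 ^ 3 * 4 * 2000 ^ 2 * (δ * p * (b / 2000)) ^ 2 := by ring
        _ ≤ 14 ^ 3 * 4 * 2000 ^ 2 * Δ ^ 2 := by gcongr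
        _ ≤ _ := by gcongr; norm_num
    rw [div_mul_eq_mul_div, le_div_iff₀ (by positivity), mul_comm, mul_div_assoc]
    exact h1

theorem triangleMean_sq_ge_of_le_sq (h8 : 8 / 9 ≤ τ ^ 2) :
    p ^ 5 ≤ 10 ^ 16 / δ ^ 8 * triangleMean k τ p ^ 2 := by
  have ht := abs_nonneg τ
  have hq := twoCaps_abs_pos hp hτ hδ hpδ
  have hqp := mul_le_twoCaps_abs hp hτ hδ hpδ
  obtain ⟨s, hs0, hs1, hD⟩ := exists_overlap_sub_ge_of_le_sq ht (by rwa [sq_abs])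
    (lt_one_of_twoCaps_pos ht hq)
  have hΔ := triangleMean_ge hp hτ hδ hpδ hs0 hs1
  have hDnn := sub_nonneg.2 (overlap_monotone (k := k) ht hs1)
  set D := overlap k |τ| |τ| - overlap k |τ| s
  set Δ := triangleMean k τ p
  have h1 : δ ^ 8 * p ^ 5 ≤ 10 ^ 16 * Δ ^ 2 := by
    calc δ ^ 8 * p ^ 5 ≤ δ ^ 7 * p ^ 5 := by
          have := pow_le_pow_of_le_one hδ.le (by linarith) (by norm_num : 7 ≤ 8)
          gcongr
      _ = δ ^ 4 * p ^ 2 * (δ * p) ^ 3 := by ring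
      _ ≤ δ ^ 4 * p ^ 2 * (16 * D ^ 2) := by
          gcongr
          exact le_trans (by gcongr) hD
      _ = 64 * (δ ^ 2 / 2 * p * D) ^ 2 := by ring
      _ ≤ 64 * Δ ^ 2 := by gcongr
      _ ≤ _ := by gcongr; norm_num
  rw [div_mul_eq_mul_div, le_div_iff₀ (by positivity), mul_comm]
  exact h1

/-- The mean of a signed triangle, compared with `x = (log (e / p)) ^ 3 / d` when the threshold is
bounded away from one, and with `p` otherwise. -/
theorem triangleMean_bounds :
    (p ^ 3 * (1 - Real.log p) ^ 3 / (k + 2) ≤ 10 ^ 16 / δ ^ 8 * triangleMean k τ p ∧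
      p ^ 6 * (1 - Real.log p) ^ 3 / (k + 2) ≤ 10 ^ 16 / δ ^ 8 * triangleMean k τ p ^ 2 ∧
      ∫ s, overlap k |τ| s ^ 2 ∂(innerLaw k) ≤
        1300 / δ * (p ^ 2 * (1 - Real.log p) / (k + 2))) ∨
    (p ^ 5 ≤ 10 ^ 16 / δ ^ 8 * triangleMean k τ p ^ 2 ∧
      ∫ s, overlap k |τ| s ^ 2 ∂(innerLaw k) ≤ 2 * p ^ 3) := by
  rcases le_total (τ ^ 2) (8 / 9) with h8 | h8
  · have h := integral_overlap_sq_le_log hp hτ hδ hpδ h8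
    rcases le_total (1 / 2) (|τ| * √(k + 2)) with hu | hu
    · exact .inl ⟨(triangleMean_ge_of_half_le hp hτ hδ hpδ h8 hu).1,
        (triangleMean_ge_of_half_le hp hτ hδ hpδ h8 hu).2, h⟩
    · exact .inl ⟨(triangleMean_ge_of_le_half hp hτ hδ hpδ hu).1,
        (triangleMean_ge_of_le_half hp hτ hδ hpδ hu).2, h⟩
  · refine .inr ⟨triangleMean_sq_ge_of_le_sq hp hτ hδ hpδ h8,
      (integral_overlap_sq_le_cube (abs_nonneg τ)).trans ?_⟩
    have := twoCaps_abs_le hp hτ hδ hpδ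
    have := (twoCaps_abs_pos hp hτ hδ hpδ).le
    gcongr

end

end RandomGeometric

/-! ### Comparing the variance with the squared mean -/

namespace RandomGeometric

theorem binEntropy_le {p : ℝ} (hp1 : p < 1) :
    Real.binEntropy p ≤ p * (1 - Real.log p) := by
  have h1 := Real.log_le_sub_one_of_pos (inv_pos.2 (sub_pos.2 hp1))
  have h2 : (1 - p) * Real.log (1 - p)⁻¹ ≤ (1 - p) * ((1 - p)⁻¹ - 1) :=
    mul_le_mul_of_nonneg_left h1 (by linarith)
  have h3 : (1 - p) * (1 - p)⁻¹ = 1 := mul_inv_cancel₀ (by linarith)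
  rw [Real.binEntropy, Real.log_inv]
  linarith

/-- Apply `1 + x ≤ exp x` at `x = -(log p)/6` to get `1 - log p ≤ 6 p^{-1/6}`. -/
theorem one_sub_log_pow_mul_le {p : ℝ} (hp : 0 < p) (hp1 : p ≤ 1) :
    (1 - Real.log p) ^ 6 * p ≤ 6 ^ 6 := by
  have hl := Real.log_nonpos hp.le hp1
  have h1 : 1 - Real.log p ≤ 6 * Real.exp (-(Real.log p) / 6) := by
    linarith [Real.add_one_le_exp (-(Real.log p) / 6)]
  have h2 : Real.exp (-(Real.log p) / 6) ^ 6 = p⁻¹ := by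
    rw [← Real.exp_nat_mul, ← Real.exp_log (inv_pos.2 hp), Real.log_inv]
    congr 1
    push_cast
    ring
  calc (1 - Real.log p) ^ 6 * p ≤ (6 * Real.exp (-(Real.log p) / 6)) ^ 6 * p := by
        have : 0 ≤ 1 - Real.log p := by linarith
        gcongr
    _ = 6 ^ 6 := by rw [mul_pow, h2]; field_simp

theorem cube_le_choose_three {n : ℕ} (hn : 3 ≤ n) : (n : ℝ) ^ 3 ≤ 27 * n.choose 3 := by
  obtain ⟨m, rfl⟩ := Nat.exists_eq_add_of_le' hn
  have h1 : ((m + 3).choose 3 : ℝ) = (m + 3) * (m + 2) * (m + 1) / 6 := by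
    have h3 := Nat.descFactorial_eq_factorial_mul_choose (m + 3) 3
    simp only [Nat.descFactorial_succ, Nat.descFactorial_zero, Nat.factorial] at h3
    have h4 : (m + 3) * (m + 2) * (m + 1) = 6 * (m + 3).choose 3 := by
      rw [show m + 3 - 2 = m + 1 by omega, show m + 3 - 1 = m + 2 by omega] at h3
      simp only [Nat.sub_zero] at h3
      linarith
    have h5 : ((m : ℝ) + 3) * (m + 2) * (m + 1) = 6 * (m + 3).choose 3 := by exact_mod_cast h4
    linarith
  rw [h1]
  push_cast
  have : (0 : ℝ) ≤ m := m.cast_nonneg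
  nlinarith [mul_nonneg this this, mul_nonneg (mul_nonneg this this) this]

section

variable {n p L d Δ W C r : ℝ}

/-- The four quantities are the variance terms against the squared mean, after cancelling common
factors; `r` is the gain. The first two follow by inserting `r²d ≤ (npL)³` into `h1` and `h2`. The
product of those two bounds is the cube of the third, and the fourth uses `r⁴ ≤ (npL)²`. -/
theorem noise_le_of_log_bounds (hn : 1 ≤ n) (hp : 0 < p) (hL : 1 ≤ L) (hd : 0 < d)
    (hΔ : 0 ≤ Δ) (hC : 1 ≤ C) (hr : 1 ≤ r) (hz : r ^ 2 ≤ n * p * L)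
    (hy : r ^ 2 * d ≤ (n * p * L) ^ 3) (h1 : p ^ 3 * L ^ 3 / d ≤ C * Δ)
    (h2 : p ^ 6 * L ^ 3 / d ≤ C * Δ ^ 2) (hW : W ≤ C * (p ^ 2 * L / d)) :
    r ≤ C ^ 2 * (n ^ 3 * Δ) ∧ r * p ^ 3 ≤ C ^ 2 * (n ^ 3 * Δ ^ 2) ∧
      r * p ≤ C ^ 2 * (n ^ 2 * Δ) ∧ r * (p ^ 2 * W) ≤ C ^ 2 * (n ^ 2 * Δ ^ 2) := by
  have hCC : C ≤ C ^ 2 := le_self_pow₀ hC two_ne_zero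
  have hrr : r ≤ r ^ 2 := le_self_pow₀ hr two_ne_zero
  have ha1 : r ^ 2 ≤ C * (n ^ 3 * Δ) := by
    calc r ^ 2 = r ^ 2 * d / d := by field_simp
      _ ≤ (n * p * L) ^ 3 / d := by gcongr
      _ = n ^ 3 * (p ^ 3 * L ^ 3 / d) := by ring
      _ ≤ n ^ 3 * (C * Δ) := by gcongr
      _ = _ := by ring
  have ha2 : r ^ 2 * p ^ 3 ≤ C * (n ^ 3 * Δ ^ 2) := by
    calc r ^ 2 * p ^ 3 = r ^ 2 * d / d * p ^ 3 := by field_simp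
      _ ≤ (n * p * L) ^ 3 / d * p ^ 3 := by gcongr
      _ = n ^ 3 * (p ^ 6 * L ^ 3 / d) := by ring
      _ ≤ n ^ 3 * (C * Δ ^ 2) := by gcongr
      _ = _ := by ring
  refine ⟨?_, ?_, ?_, ?_⟩
  · calc r ≤ C * (n ^ 3 * Δ) := hrr.trans ha1
      _ ≤ _ := by gcongr
  · calc r * p ^ 3 ≤ r ^ 2 * p ^ 3 := by gcongr
      _ ≤ C * (n ^ 3 * Δ ^ 2) := ha2
      _ ≤ _ := by gcongr
  · refine le_of_pow_le_pow_left₀ three_ne_zero (by positivity) ?_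
    calc (r * p) ^ 3 = r ^ 3 * p ^ 3 := by ring
      _ ≤ r ^ 4 * p ^ 3 := by
          have := pow_le_pow_right₀ hr (by norm_num : 3 ≤ 4)
          gcongr
      _ = r ^ 2 * (r ^ 2 * p ^ 3) := by ring
      _ ≤ C * (n ^ 3 * Δ) * (C * (n ^ 3 * Δ ^ 2)) := by gcongr
      _ = C ^ 2 * (n ^ 2 * Δ) ^ 3 := by ring
      _ ≤ C ^ 6 * (n ^ 2 * Δ) ^ 3 := by
          have := pow_le_pow_right₀ hC (by norm_num : 2 ≤ 6)
          gcongr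
      _ = _ := by ring
  · calc r * (p ^ 2 * W) ≤ r * (p ^ 2 * (C * (p ^ 2 * L / d))) := by gcongr
      _ ≤ (r ^ 2) ^ 2 * (p ^ 2 * (C * (p ^ 2 * L / d))) := by
          have : r ≤ (r ^ 2) ^ 2 := by
            rw [← pow_mul]; exact le_self_pow₀ hr (by norm_num)
          gcongr
      _ ≤ (n * p * L) ^ 2 * (p ^ 2 * (C * (p ^ 2 * L / d))) := by gcongr
      _ = C * n ^ 2 * (p ^ 6 * L ^ 3 / d) := by ring
      _ ≤ C * n ^ 2 * (C * Δ ^ 2) := by gcongr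
      _ = _ := by ring

/-- All four come from `r¹² ≤ (npL)⁶ = (L⁶p) n⁶p⁵ ≤ 6⁶ n⁶p⁵` and `p⁵ ≤ CΔ²`; the dimension no longer
enters. The constant `216` is the square root of `6⁶`. -/
theorem noise_le_of_pow_bounds (hn : 1 ≤ n) (hp : 0 < p) (hp1 : p ≤ 1)
    (hΔ : 0 ≤ Δ) (hC : 1 ≤ C) (hr : 1 ≤ r) (hz : r ^ 2 ≤ n * p * L)
    (hL : L ^ 6 * p ≤ 6 ^ 6) (h1 : p ^ 5 ≤ C * Δ ^ 2) (hW : W ≤ 2 * p ^ 3) :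
    r ≤ 216 * C * (n ^ 3 * Δ) ∧ r * p ^ 3 ≤ 216 * C * (n ^ 3 * Δ ^ 2) ∧
      r * p ≤ 216 * C * (n ^ 2 * Δ) ∧ r * (p ^ 2 * W) ≤ 216 * C * (n ^ 2 * Δ ^ 2) := by
  have h12 : r ^ 12 ≤ 6 ^ 6 * (n ^ 6 * p ^ 5) := by
    calc r ^ 12 = (r ^ 2) ^ 6 := by ring
      _ ≤ (n * p * L) ^ 6 := by gcongr
      _ = L ^ 6 * p * (n ^ 6 * p ^ 5) := by ring
      _ ≤ _ := by gcongr
  have hr2 : r ^ 2 ≤ r ^ 12 := pow_le_pow_right₀ hr (by norm_num)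
  have hr6 : r ^ 6 ≤ r ^ 12 := pow_le_pow_right₀ hr (by norm_num)
  have hC2 : C ≤ C ^ 2 := le_self_pow₀ hC two_ne_zero
  refine ⟨?_, ?_, ?_, ?_⟩
  · refine le_of_pow_le_pow_left₀ two_ne_zero (by positivity) ?_
    calc r ^ 2 ≤ 6 ^ 6 * (n ^ 6 * p ^ 5) := hr2.trans h12
      _ ≤ 6 ^ 6 * (n ^ 6 * (C * Δ ^ 2)) := by gcongr
      _ ≤ 6 ^ 6 * (n ^ 6 * (C ^ 2 * Δ ^ 2)) := by gcongr
      _ = _ := by ring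
  · refine le_of_pow_le_pow_left₀ two_ne_zero (by positivity) ?_
    calc (r * p ^ 3) ^ 2 = r ^ 2 * p ^ 6 := by ring
      _ ≤ 6 ^ 6 * (n ^ 6 * p ^ 5) * p ^ 5 := by
          have : p ^ 6 ≤ p ^ 5 := pow_le_pow_of_le_one hp.le hp1 (by norm_num)
          have := hr2.trans h12
          gcongr
      _ = 6 ^ 6 * (n ^ 6 * (p ^ 5) ^ 2) := by ring
      _ ≤ 6 ^ 6 * (n ^ 6 * (C * Δ ^ 2) ^ 2) := by gcongr
      _ = _ := by ring
  · refine le_of_pow_le_pow_left₀ (by norm_num : 6 ≠ 0) (by positivity) ?_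
    calc (r * p) ^ 6 = r ^ 6 * p ^ 6 := by ring
      _ ≤ r ^ 24 * p ^ 5 := by
          have := pow_le_pow_right₀ hr (by norm_num : 6 ≤ 24)
          have : p ^ 6 ≤ p ^ 5 := pow_le_pow_of_le_one hp.le hp1 (by norm_num)
          gcongr
      _ = (r ^ 12) ^ 2 * p ^ 5 := by ring
      _ ≤ (6 ^ 6 * (n ^ 6 * p ^ 5)) ^ 2 * p ^ 5 := by gcongr
      _ = 6 ^ 12 * (n ^ 12 * (p ^ 5) ^ 3) := by ring
      _ ≤ 6 ^ 12 * (n ^ 12 * (C * Δ ^ 2) ^ 3) := by gcongr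
      _ = 6 ^ 12 * C ^ 3 * (n ^ 2 * Δ) ^ 6 := by ring
      _ ≤ 216 ^ 6 * C ^ 6 * (n ^ 2 * Δ) ^ 6 := by
          have := pow_le_pow_right₀ hC (by norm_num : 3 ≤ 6)
          gcongr
          norm_num
      _ = _ := by ring
  · have hrn : r ≤ 6 * n := by
      refine le_of_pow_le_pow_left₀ (by norm_num : 6 ≠ 0) (by positivity) ?_
      calc r ^ 6 ≤ 6 ^ 6 * (n ^ 6 * p ^ 5) := hr6.trans h12
        _ ≤ 6 ^ 6 * (n ^ 6 * 1) := by
            have := pow_le_one₀ hp.le hp1 (n := 5)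
            gcongr
        _ = _ := by ring
    calc r * (p ^ 2 * W) ≤ r * (p ^ 2 * (2 * p ^ 3)) := by gcongr
      _ = 2 * r * p ^ 5 := by ring
      _ ≤ 2 * (6 * n) * (C * Δ ^ 2) := by gcongr
      _ = 12 * C * (n * Δ ^ 2) := by ring
      _ ≤ 216 * C * (n ^ 2 * Δ ^ 2) := by
          have := le_self_pow₀ hn two_ne_zero
          gcongr
          norm_num

end

section

variable {n k : ℕ} {p : unitInterval} {δ : ℝ}

/-- A common bound for the variance of the signed triangle count in both models. -/
noncomputable def varianceBound (k n : ℕ) (p δ : ℝ) : ℝ :=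
  n.choose 3 * (triangleMean k (threshold (k + 2) p) p + p ^ 3 +
    3 * n * (2 / δ * (p * triangleMean k (threshold (k + 2) p) p) +
      p ^ 2 * ∫ s, overlap k |threshold (k + 2) p| s ^ 2 ∂(innerLaw k)))

theorem variance_le_varianceBound (hδ : 0 < δ) (hp : 0 < (p : ℝ)) (hpδ : (p : ℝ) ≤ 1 - δ) :
    variance (signedTriangles (p : ℝ)) (geo (k + 2) n p) ≤ varianceBound k n p δ ∧
      variance (signedTriangles (p : ℝ)) (SimpleGraph.binomialRandom (Fin n) p) ≤
        varianceBound k n p δ := by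
  have hτ := (threshold_spec (k := k) hp.le (by linarith : (p : ℝ) ≤ 1)).2 hp
  have hQ := wedgeMoment_le hp hτ hδ hpδ
  have hΔ := triangleMean_nonneg hp hτ (by linarith)
  have hpp : ((p : ℝ) * (1 - p)) ^ 3 ≤ (p : ℝ) ^ 3 := by
    have : (p : ℝ) * (1 - p) ≤ p := by nlinarith
    have : 0 ≤ (p : ℝ) * (1 - p) := mul_nonneg hp.le (by linarith)
    gcongr
  unfold varianceBound
  constructor
  · refine (variance_signedTriangles_geo_le hp (by linarith)).trans ?_
    gcongr
    have h1 : (1 - 2 * (p : ℝ)) ^ 3 ≤ 1 := by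
      calc (1 - 2 * (p : ℝ)) ^ 3 ≤ |(1 - 2 * (p : ℝ)) ^ 3| := le_abs_self _
        _ = |1 - 2 * (p : ℝ)| ^ 3 := abs_pow _ _
        _ ≤ 1 := pow_le_one₀ (abs_nonneg _) (abs_le.2 ⟨by linarith, by linarith⟩)
    exact mul_le_of_le_one_left hΔ h1
  · refine (variance_signedTriangles_binomialRandom_le p).trans ?_
    gcongr
    have h2 : 0 ≤ ∫ s, overlap k |threshold (k + 2) p| s ^ 2 ∂(innerLaw k) :=
      integral_nonneg fun s => sq_nonneg _
    have h3 : 0 ≤ 3 * (n : ℝ) * (2 / δ * (p * triangleMean k (threshold (k + 2) p) p) +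
      (p : ℝ) ^ 2 * ∫ s, overlap k |threshold (k + 2) p| s ^ 2 ∂(innerLaw k)) := by positivity
    linarith

/-- The exponent `6` on `r` serves two ends: since `k + 2 ≥ 1`, a cube root gives `r² ≤ npL`, while
`r ≥ 1` gives `r²(k+2) ≤ (npL)³`. -/
theorem exists_varianceBound_le (hδ : 0 < δ) : ∃ K : ℝ, 0 < K ∧ ∀ (n k : ℕ) (p r : ℝ),
    3 ≤ n → 0 < p → p ≤ 1 - δ → 1 ≤ r → r ^ 6 * (k + 2) ≤ (n * Real.binEntropy p) ^ 3 →
    0 < triangleMean k (threshold (k + 2) p) p ∧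
      varianceBound k n p δ ≤
        K / r * (n.choose 3 * triangleMean k (threshold (k + 2) p) p) ^ 2 := by
  set C : ℝ := 10 ^ 16 / δ ^ 8 + 1300 / δ + 1 with hC
  have hC0 : 0 < 10 ^ 16 / δ ^ 8 := by positivity
  have hC1 : 0 < 1300 / δ := by positivity
  set K : ℝ := 216 * C ^ 2 with hK
  refine ⟨27 * (1 + 1 + 3 * (2 / δ + 1)) * K, by positivity, ?_⟩
  intro n k p r hn hp hpδ hr hH
  have hτ := (threshold_spec (k := k) hp.le (by linarith : p ≤ 1)).2 hp
  have hΔ0 := triangleMean_nonneg hp hτ (by linarith)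
  have hdich := triangleMean_bounds hp hτ hδ hpδ
  unfold varianceBound
  set Δ := triangleMean k (threshold (k + 2) p) p
  set W := ∫ s, overlap k |threshold (k + 2) p| s ^ 2 ∂(innerLaw k)
  have hn1 : (1 : ℝ) ≤ n := by exact_mod_cast (by omega : 1 ≤ n)
  have hn0 : (0 : ℝ) < n := by linarith
  have hd2 : (1 : ℝ) ≤ k + 2 := by linarith [k.cast_nonneg (α := ℝ)]
  have hL1 : 1 ≤ 1 - Real.log p := by linarith [Real.log_nonpos hp.le (by linarith)]
  have hy6 : r ^ 6 * (k + 2) ≤ (n * p * (1 - Real.log p)) ^ 3 := by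
    refine hH.trans ?_
    have h1 := binEntropy_le (p := p) (by linarith)
    have h2 := Real.binEntropy_nonneg hp.le (by linarith : p ≤ 1)
    calc (n * Real.binEntropy p) ^ 3 ≤ (n * (p * (1 - Real.log p))) ^ 3 := by gcongr
      _ = _ := by ring
  have hy : r ^ 2 * (k + 2) ≤ (n * p * (1 - Real.log p)) ^ 3 := by
    refine le_trans ?_ hy6
    have := pow_le_pow_right₀ hr (by norm_num : 2 ≤ 6)
    gcongr
  have hz : r ^ 2 ≤ n * p * (1 - Real.log p) := by
    refine le_of_pow_le_pow_left₀ three_ne_zero (by positivity) (le_trans ?_ hy6)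
    rw [← pow_mul]
    exact le_mul_of_one_le_right (by positivity) hd2
  have hC1' : 1 ≤ C := by linarith
  have hnoise : r ≤ K * (n ^ 3 * Δ) ∧ r * p ^ 3 ≤ K * (n ^ 3 * Δ ^ 2) ∧
      r * p ≤ K * (n ^ 2 * Δ) ∧ r * (p ^ 2 * W) ≤ K * (n ^ 2 * Δ ^ 2) := by
    rcases hdich with ⟨h1, h2, h3⟩ | ⟨h1, h2⟩
    · have hCK : C ^ 2 ≤ K := by rw [hK]; linarith [sq_nonneg C]
      have h1' := h1.trans (mul_le_mul_of_nonneg_right (by linarith : _ ≤ C) hΔ0)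
      have h2' := h2.trans (mul_le_mul_of_nonneg_right (by linarith : _ ≤ C) (sq_nonneg Δ))
      have h3' := h3.trans (mul_le_mul_of_nonneg_right (by linarith : _ ≤ C) (by positivity))
      obtain ⟨e1, e2, e3, e4⟩ := noise_le_of_log_bounds hn1 hp hL1 (by linarith) hΔ0 hC1' hr hz hy
        h1' h2' h3'
      exact ⟨e1.trans (by gcongr), e2.trans (by gcongr), e3.trans (by gcongr),
        e4.trans (by gcongr)⟩
    · have hCK : 216 * C ≤ K := by rw [hK]; nlinarith
      have h1' := h1.trans (mul_le_mul_of_nonneg_right (by linarith : _ ≤ C) (sq_nonneg Δ))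
      obtain ⟨e1, e2, e3, e4⟩ := noise_le_of_pow_bounds hn1 hp (by linarith) hΔ0 hC1' hr hz
        (one_sub_log_pow_mul_le hp (by linarith)) h1' h2
      exact ⟨e1.trans (by gcongr), e2.trans (by gcongr), e3.trans (by gcongr),
        e4.trans (by gcongr)⟩
  obtain ⟨e1, e2, e3, e4⟩ := hnoise
  -- If `Δ` vanished, `e1` would contradict `r ≥ 1`.
  have hΔ : 0 < Δ := by
    rcases hΔ0.eq_or_lt with h | h
    · rw [← h, mul_zero, mul_zero] at e1
      linarith
    · exact h
  refine ⟨hΔ, ?_⟩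
  have hN := cube_le_choose_three hn
  set N : ℝ := (n.choose 3 : ℝ)
  have hN0 : 0 ≤ N := Nat.cast_nonneg _
  rw [div_mul_eq_mul_div (27 * (1 + 1 + 3 * (2 / δ + 1)) * K), le_div_iff₀ (by linarith)]
  have t1 : r * Δ ≤ K * (n ^ 3 * Δ ^ 2) := by
    calc r * Δ ≤ K * (n ^ 3 * Δ) * Δ := by gcongr
      _ = _ := by ring
  have t3 : n * (2 / δ * (r * p) * Δ) ≤ 2 / δ * (K * (n ^ 3 * Δ ^ 2)) := by
    calc n * (2 / δ * (r * p) * Δ) ≤ n * (2 / δ * (K * (n ^ 2 * Δ)) * Δ) := by gcongr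
      _ = _ := by ring
  have t4 : n * (r * (p ^ 2 * W)) ≤ K * (n ^ 3 * Δ ^ 2) := by
    calc n * (r * (p ^ 2 * W)) ≤ n * (K * (n ^ 2 * Δ ^ 2)) := by gcongr
      _ = _ := by ring
  calc N * (Δ + p ^ 3 + 3 * n * (2 / δ * (p * Δ) + p ^ 2 * W)) * r
      = N * (r * Δ + r * p ^ 3 + 3 * (n * (2 / δ * (r * p) * Δ)) + 3 * (n * (r * (p ^ 2 * W)))) := by
        ring
    _ ≤ N * (K * (n ^ 3 * Δ ^ 2) + K * (n ^ 3 * Δ ^ 2) + 3 * (2 / δ * (K * (n ^ 3 * Δ ^ 2))) +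
          3 * (K * (n ^ 3 * Δ ^ 2))) := by gcongr
    _ = N * ((1 + 1 + 3 * (2 / δ + 1)) * K * Δ ^ 2) * n ^ 3 := by ring
    _ ≤ N * ((1 + 1 + 3 * (2 / δ + 1)) * K * Δ ^ 2) * (27 * N) := by gcongr
    _ = _ := by ring

end

/-! ### Chebyshev's inequality and the conclusion -/

section

variable {Ω : Type*} [MeasurableSpace Ω] {μ : Measure Ω} [IsProbabilityMeasure μ] {X : Ω → ℝ}
  {m ε : ℝ}

theorem measureReal_abs_sub_ge_le (hX : MemLp X 2 μ) (hm : 0 < m)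
    (hv : variance X μ ≤ ε * m ^ 2) :
    μ.real {ω | m / 2 ≤ |X ω - ∫ ω, X ω ∂μ|} ≤ 4 * ε := by
  have h := meas_ge_le_variance_div_sq hX (half_pos hm)
  have h2 := ENNReal.toReal_mono ENNReal.ofReal_ne_top h
  rw [ENNReal.toReal_ofReal (div_nonneg (variance_nonneg _ _) (sq_nonneg _))] at h2
  refine h2.trans ?_
  rw [div_le_iff₀ (by positivity)]
  linarith

theorem one_sub_le_measureReal_gt_half (hX : MemLp X 2 μ) (hm : 0 < m)
    (hv : variance X μ ≤ ε * m ^ 2) (hmean : ∫ ω, X ω ∂μ = m) :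
    1 - 4 * ε ≤ μ.real {ω | X ω ∈ Set.Ioi (m / 2)} := by
  have h := measureReal_abs_sub_ge_le hX hm hv
  rw [hmean] at h
  have h1 : (1 : ℝ) ≤ μ.real {ω | X ω ∈ Set.Ioi (m / 2)} + μ.real {ω | m / 2 ≤ |X ω - m|} := by
    rw [← probReal_univ (μ := μ)]
    refine (measureReal_mono fun ω _ => ?_).trans (measureReal_union_le _ _)
    by_cases hω : m / 2 < X ω
    · exact .inl hω
    · refine .inr ?_
      rw [Set.mem_ofPred_eq, abs_sub_comm]
      refine le_trans ?_ (le_abs_self _)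
      linarith
  linarith

theorem measureReal_gt_half_le (hX : MemLp X 2 μ) (hm : 0 < m)
    (hv : variance X μ ≤ ε * m ^ 2) (hmean : ∫ ω, X ω ∂μ = 0) :
    μ.real {ω | X ω ∈ Set.Ioi (m / 2)} ≤ 4 * ε := by
  have h := measureReal_abs_sub_ge_le hX hm hv
  rw [hmean] at h
  refine (measureReal_mono fun ω hω => ?_).trans h
  rw [Set.mem_ofPred_eq, sub_zero]
  exact (le_of_lt hω).trans (le_abs_self _)

end

/-- Along the sequence of the main theorem, the mean of the signed triangle count under the
geometric model eventually dominates the standard deviations of both models. -/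
theorem eventually_signedTriangles_bounds {δ : ℝ} (hδ : 0 < δ) {p : ℕ → unitInterval} {d : ℕ → ℕ}
    (hd : ∀ᶠ n in atTop, 2 ≤ d n)
    (hp_lower : (fun n : ℕ => 1 / (n : ℝ) ^ 2) =o[atTop] fun n : ℕ => (p n : ℝ))
    (hp_upper : ∀ᶠ n in atTop, (p n : ℝ) ≤ 1 - δ)
    (hdn : (fun n : ℕ => (d n : ℝ)) =o[atTop]
      fun n : ℕ => ((n : ℝ) * Real.binEntropy (p n)) ^ 3) {ε : ℝ} (hε : 0 < ε) :
    ∀ᶠ n in atTop, 2 ≤ d n ∧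
      0 < ∫ G, signedTriangles (p n : ℝ) G ∂(geo (d n) n (p n)) ∧
      variance (signedTriangles (p n : ℝ)) (geo (d n) n (p n)) ≤
        ε * (∫ G, signedTriangles (p n : ℝ) G ∂(geo (d n) n (p n))) ^ 2 ∧
      variance (signedTriangles (p n : ℝ)) (SimpleGraph.binomialRandom (Fin n) (p n)) ≤
        ε * (∫ G, signedTriangles (p n : ℝ) G ∂(geo (d n) n (p n))) ^ 2 := by
  obtain ⟨K, hK, hbound⟩ := exists_varianceBound_le hδ
  -- A constant gain suffices: the little-o hypothesis is applied with the constant `r⁻⁶`.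
  set r : ℝ := max 1 (K / ε) with hr
  have hr1 : 1 ≤ r := le_max_left _ _
  have hKr : K / r ≤ ε := by
    rw [div_le_iff₀ (by linarith), ← div_le_iff₀' hε]
    exact le_max_right _ _
  filter_upwards [hd, hp_upper, hp_lower.bound one_pos,
    hdn.bound (by positivity : 0 < (r ^ 6)⁻¹), eventually_ge_atTop 3] with n h2 hpδ hlow hdn hn
  obtain ⟨k, hk⟩ := Nat.exists_eq_add_of_le' h2
  rw [hk] at hdn ⊢
  -- Of the lower bound on `p`, only eventual positivity is needed here.
  have hp : 0 < (p n : ℝ) := by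
    have h0 : (0 : ℝ) < 1 / (n : ℝ) ^ 2 := by
      have : (0 : ℝ) < n := by exact_mod_cast (by omega : 0 < n)
      positivity
    rw [Real.norm_of_nonneg h0.le, Real.norm_of_nonneg (p n).2.1, one_mul] at hlow
    exact h0.trans_le hlow
  have hp1 : (p n : ℝ) < 1 := by linarith
  have hH0 := Real.binEntropy_nonneg hp.le hp1.le
  rw [Real.norm_of_nonneg (Nat.cast_nonneg _), Real.norm_of_nonneg (by positivity),
    inv_mul_eq_div, le_div_iff₀' (by positivity)] at hdn
  push_cast at hdn
  obtain ⟨hΔ, hV⟩ := hbound n k (p n) r hn hp hpδ hr1 hdn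
  obtain ⟨hV1, hV2⟩ := variance_le_varianceBound (n := n) (k := k) hδ hp hpδ
  rw [integral_signedTriangles_geo hp hp1]
  have hN : (0 : ℝ) < n.choose 3 := by exact_mod_cast Nat.choose_pos hn
  have hV3 := hV.trans (mul_le_mul_of_nonneg_right hKr (sq_nonneg _))
  exact ⟨by omega, mul_pos hN hΔ, hV1.trans hV3, hV2.trans hV3⟩

end RandomGeometric

theorem mainTheorem7 (δ : ℝ) (hδ : 0 < δ) (p : ℕ → unitInterval) (d : ℕ → ℕ)
    (hd : ∀ᶠ n in atTop, 2 ≤ d n)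
    (hp_lower : (fun n : ℕ => 1 / (n : ℝ) ^ 2) =o[atTop] fun n : ℕ => (p n : ℝ))
    (hp_upper : ∀ᶠ n in atTop, (p n : ℝ) ≤ 1 - δ)
    (hdn : (fun n : ℕ => (d n : ℝ)) =o[atTop]
      fun n : ℕ => ((n : ℝ) * Real.binEntropy (p n)) ^ 3) :
    ((fun n : ℕ => max
        (Real.sqrt (variance (RandomGeometric.signedTriangles (p n : ℝ))
          (RandomGeometric.geo (d n) n (p n))))
        (Real.sqrt (variance (RandomGeometric.signedTriangles (p n : ℝ))
          (SimpleGraph.binomialRandom (Fin n) (p n)))))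
      =o[atTop]
      fun n : ℕ =>
        |(∫ G, RandomGeometric.signedTriangles (p n : ℝ) G
            ∂(RandomGeometric.geo (d n) n (p n))) -
          ∫ G, RandomGeometric.signedTriangles (p n : ℝ) G
            ∂(SimpleGraph.binomialRandom (Fin n) (p n))|) ∧
    ∃ A : ℕ → Set ℝ,
      Tendsto (fun n : ℕ => (RandomGeometric.geo (d n) n (p n)).real
        {G | RandomGeometric.signedTriangles (p n : ℝ) G ∈ A n}) atTop (𝓝 1) ∧
      Tendsto (fun n : ℕ => (SimpleGraph.binomialRandom (Fin n) (p n)).real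
        {G | RandomGeometric.signedTriangles (p n : ℝ) G ∈ A n}) atTop (𝓝 0) := by
  have hev := fun {ε : ℝ} (hε : 0 < ε) =>
    RandomGeometric.eventually_signedTriangles_bounds hδ hd hp_lower hp_upper hdn hε
  have hER : ∀ n, ∫ G, RandomGeometric.signedTriangles (p n : ℝ) G
      ∂(SimpleGraph.binomialRandom (Fin n) (p n)) = 0 :=
    fun n => RandomGeometric.integral_signedTriangles_binomialRandom (p n)
  -- The test asks whether the count exceeds half of its geometric mean, the midpoint of the two
  -- means.
  refine ⟨isLittleO_iff.2 fun c hc => ?_, fun n => Set.Ioi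
    ((∫ G, RandomGeometric.signedTriangles (p n : ℝ) G
      ∂(RandomGeometric.geo (d n) n (p n))) / 2), ?_, ?_⟩
  · filter_upwards [hev (pow_pos hc 2)] with n hn
    obtain ⟨_, hm, h1, h2⟩ := hn
    rw [hER, sub_zero, Real.norm_of_nonneg (le_max_of_le_left (Real.sqrt_nonneg _)),
      Real.norm_of_nonneg (abs_nonneg _), abs_of_pos hm, max_le_iff]
    rw [← mul_pow] at h1 h2
    exact ⟨Real.sqrt_le_iff.2 ⟨by positivity, h1⟩, Real.sqrt_le_iff.2 ⟨by positivity, h2⟩⟩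
  · rw [tendsto_order]
    constructor
    · intro a ha
      -- Chebyshev at half the mean costs a factor `4`, so the failure probability is at most `(1 -
      -- a)/2 < 1 - a`.
      filter_upwards [hev (ε := (1 - a) / 8) (by linarith)] with n hn
      obtain ⟨h2, hm, h1, _⟩ := hn
      have := RandomGeometric.isProbabilityMeasure_geo (d := d n) (by omega) n (p n)
      have := RandomGeometric.one_sub_le_measureReal_gt_half MemLp.of_discrete hm h1 rfl
      linarith
    · intro a ha
      filter_upwards [hd] with n h2
      have := RandomGeometric.isProbabilityMeasure_geo (d := d n) (by omega) n (p n)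
      exact measureReal_le_one.trans_lt ha
  · rw [tendsto_order]
    constructor
    · intro a ha
      exact .of_forall fun n => ha.trans_le measureReal_nonneg
    · intro a ha
      filter_upwards [hev (ε := a / 8) (by linarith)] with n hn
      obtain ⟨_, hm, _, h1⟩ := hn
      have := RandomGeometric.measureReal_gt_half_le MemLp.of_discrete hm h1 (hER n)
      linarith
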